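/- Let $\mathbb H^3_1=\{(z^1,z^2)\in\mathbb C^2: |z^1|^2-|z^2|^2=1\}$, identified with $SU(1,1)$ through $(z^1,z^2)\mapsto\begin{pmatrix} z^1& z^2\\ \bar z^2&\bar z^1\end{pmatrix}$. Let $$X_0=\begin{pmatrix} i&0\\0&-i\end{pmatrix},\quad X_1=\begin{pmatrix}0&1\\1&0\end{pmatrix},\quad X_2=\begin{pmatrix}0&i\\-i&0\end{pmatrix}\in\mathfrak{su}(1,1),$$ regarded also as left-invariant vector fields, with dual left-invariant coframe $\theta^0,\theta^1,\theta^2$, and put $\theta^a\wedge\theta^b=\theta^a\otimes\theta^b-\theta^b\otimes\theta^a$. Let $g=\lambda\,\theta^0\otimes\theta^0+\mu\,\theta^1\otimes\theta^1+\nu\,\theta^2\otimes\theta^2$ with $\mu>0$ and $-\lambda=\mu=\nu$, let $\nabla$ be its Levi-Civita connection, and let $t\in\mathbb R$. Let $S=S_\mu(t)$ be the $(1,2)$-tensor field with $$g(S_XY,Z)=\bigl(\mu\,\theta^2\otimes\theta^0\wedge\theta^1+\mu\,\theta^0\otimes\theta^1\wedge\theta^2+t\,\theta^1\otimes\theta^2\wedge\theta^0\bigr)(X,Y,Z),$$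 and put $\widetilde\nabla=\nabla-S$. With $\bar X_0=X_0/\sqrt{|\lambda|}$, $\bar X_1=X_1/\sqrt\mu$, $\bar X_2=X_2/\sqrt\nu$ and dual forms $\bar\theta^a$, let $$(\tilde\phi_1,\xi_1,\eta_1)=\bigl(-\bar X_2\otimes\bar\theta^0-\bar X_0\otimes\bar\theta^2,\ \bar X_1,\ \bar\theta^1\bigr),$$ where $X\otimes\theta$ is the endomorphism $Y\mapsto\theta(Y)X$. Then $(\mathbb H^3_1,g,\tilde\phi_1,\xi_1,\eta_1)$ is a Lorentzian $-\frac1{\sqrt\mu}$-paraSasakian manifold: $\tilde\phi_1^2=\mathrm{id}-\eta_1\otimes\xi_1$, $\eta_1(\xi_1)=1$, $g(\tilde\phi_1X,\tilde\phi_1Y)=-g(X,Y)+\eta_1(X)\eta_1(Y)$ and $(\nabla_X\tilde\phi_1)Y=-\frac1{\sqrt\mu}\bigl(g(X,Y)\xi_1-\eta_1(Y)X\bigr)$. Moreover $(S,\tilde\phi_1,\xi_1,\eta_1)$ is a homogeneous almost paracontact metric structure on it: $\widetilde\nabla g=0$, $\widetilde\nabla R=0$, $\widetilde\nabla S=0$,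 $\widetilde\nabla\tilde\phi_1=0$, $\widetilde\nabla\xi_1=0$, $\widetilde\nabla\eta_1=0$, where $R$ is the curvature tensor of $\nabla$. (1) If $t\ne\mu$, the Lie group $SU(1,1)\times\mathbb R$ acts smoothly, transitively and effectively on $\mathbb H^3_1$ by $$\bigl((A,s),Z\bigr)\mapsto A\,Z\begin{pmatrix}\cosh s&-\sinh s\\-\sinh s&\cosh s\end{pmatrix},$$ by isometries of $g$ that preserve $\tilde\phi_1,\xi_1,\eta_1$. Let $D=(0,1)$ be the generator of the summand $\mathbb R$ of $\mathfrak g=\mathfrak{su}(1,1)\oplus\mathbb R$. Then $\mathfrak g=\mathfrak h\oplus\mathfrak m$ with $$\mathfrak h=\operatorname{span}_{\mathbb R}\{X_1+D\},\qquad \mathfrak m=\operatorname{span}_{\mathbb R}\Bigl\{X_0,\ \tfrac{\mu+t}{2\mu}X_1-\tfrac{\mu-t}{2\mu}D,\ X_2\Bigr\}$$ is a reductive decomposition for the isotropy group of $o=I_2$ (that is, $\mathfrak h$ is the Lie algebra of the isotropy group and $\mathfrak m$ is $\mathrm{Ad}$-invariant under it), and it is induced by $S$ in the following sense. Let $X^*$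 denote the vector field on $\mathbb H^3_1$ generated by $\exp(sX)$. (a) $\widetilde\nabla$ is the canonical connection of the decomposition: it is invariant under the action and $\widetilde\nabla_{X^*}Y^*|_o=-([X,Y]_{\mathfrak m})^*|_o$ for $X,Y\in\mathfrak m$. (b) Identify $\mathfrak m$ with $T_o\mathbb H^3_1$ by $X\mapsto X^*|_o$. There is a linear isomorphism of $\mathfrak h$ onto the holonomy algebra of $\widetilde\nabla$ at $o$ (the Lie algebra generated by the curvature operators $\widetilde R(X,Y)$ at $o$) under which the bracket of $\mathfrak g$ is $[U,V]=UV-VU$, $[U,X]=U(X)$ and $[X,Y]=S_XY-S_YX-\widetilde R(X,Y)$ for $U,V\in\mathfrak h$ and $X,Y\in\mathfrak m$. (2) If $t=\mu$, the same conclusions hold for the group $SU(1,1)$ acting by left translations, with $\mathfrak g=\mathfrak{su}(1,1)$ and the trivial reductive decomposition $\mathfrak h=\{0\}$, $\mathfrak m=\mathfrak{su}(1,1)$. -/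

import Mathlib

open scoped Manifold ContDiff Matrix
open Complex (I)

attribute [local instance] LieRing.ofAssociativeRing

noncomputable section

/-- The signature matrix `diag(1,-1)`. -/
def sigJ : Matrix (Fin 2) (Fin 2) ℂ := !![1, 0; 0, -1]

/-- The group `SU(1,1)` inside `SL(2,ℂ)`. -/
def su11Group : Subgroup (Matrix.SpecialLinearGroup (Fin 2) ℂ) where
  carrier := {A | (A : Matrix (Fin 2) (Fin 2) ℂ)ᴴ * sigJ * (A : Matrix (Fin 2) (Fin 2) ℂ) = sigJ}
  one_mem' := by simp
  mul_mem' := by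
    intro A B hA hB
    simp only [Set.mem_ofPred_eq, Matrix.SpecialLinearGroup.coe_mul,
      Matrix.conjTranspose_mul] at *
    calc _ = (B : Matrix (Fin 2) (Fin 2) ℂ)ᴴ *
          ((A : Matrix (Fin 2) (Fin 2) ℂ)ᴴ * sigJ * (A : Matrix (Fin 2) (Fin 2) ℂ)) * B := by
            simp only [Matrix.mul_assoc]
      _ = _ := by rw [hA, hB]
  inv_mem' := by
    intro A hA
    simp only [Set.mem_ofPred_eq] at *
    have h1 : (A : Matrix (Fin 2) (Fin 2) ℂ) * ((A⁻¹ : Matrix.SpecialLinearGroup (Fin 2) ℂ) :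
        Matrix (Fin 2) (Fin 2) ℂ) = 1 := by
      rw [← Matrix.SpecialLinearGroup.coe_mul]; simp
    have h2 := congrArg Matrix.conjTranspose h1
    rw [Matrix.conjTranspose_mul, Matrix.conjTranspose_one] at h2
    generalize ((A⁻¹ : Matrix.SpecialLinearGroup (Fin 2) ℂ) : Matrix (Fin 2) (Fin 2) ℂ) = B at *
    calc Bᴴ * sigJ * B
        = Bᴴ * ((A : Matrix (Fin 2) (Fin 2) ℂ)ᴴ * sigJ * (A : Matrix (Fin 2) (Fin 2) ℂ)) * B := by
          rw [hA]
      _ = (Bᴴ * (A : Matrix (Fin 2) (Fin 2) ℂ)ᴴ) * sigJ * ((A : Matrix (Fin 2) (Fin 2) ℂ) * B) := by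
          simp only [Matrix.mul_assoc]
      _ = sigJ := by rw [h1, h2]; simp

/-- `SU(1,1)`, which is also the manifold `{(z¹,z²) ∈ ℂ² : |z¹|² - |z²|² = 1}`, the point `(z¹,z²)`
being identified with the matrix with rows `(z¹, z²)` and `(conj z², conj z¹)`. -/
abbrev SU11 : Type := su11Group

/-- The matrix entries of an element of `SU(1,1)`. -/
def SU11.entry (Z : SU11) (i j : Fin 2) : ℂ := Z.1.1 i j

/-- The element of `SU(1,1)` with first row `(a, b)`. -/
def SU11.mk' (a b : ℂ) (h : Complex.normSq a - Complex.normSq b = 1) : SU11 :=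
  ⟨⟨!![a, b; (starRingEnd ℂ) b, (starRingEnd ℂ) a], by
    have := congrArg (fun x : ℝ => (x : ℂ)) h
    simp only [Complex.ofReal_sub, Complex.normSq_eq_conj_mul_self, Complex.ofReal_one] at this
    rw [Matrix.det_fin_two_of, ← this]; ring⟩, by
    have := congrArg (fun x : ℝ => (x : ℂ)) h
    simp only [Complex.ofReal_sub, Complex.normSq_eq_conj_mul_self, Complex.ofReal_one] at this
    change (!![a, b; (starRingEnd ℂ) b, (starRingEnd ℂ) a] : Matrix (Fin 2) (Fin 2) ℂ)ᴴ * sigJ *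
      !![a, b; (starRingEnd ℂ) b, (starRingEnd ℂ) a] = sigJ
    ext i j
    fin_cases i <;> fin_cases j <;>
      simp [sigJ, Matrix.mul_apply, Fin.sum_univ_two, Matrix.conjTranspose_apply]
    · linear_combination this
    · ring
    · ring
    · linear_combination -this⟩

theorem SU11.entry_rel (Z : SU11) :
    Z.entry 1 0 = (starRingEnd ℂ) (Z.entry 0 1) ∧ Z.entry 1 1 = (starRingEnd ℂ) (Z.entry 0 0) ∧
      Complex.normSq (Z.entry 0 0) - Complex.normSq (Z.entry 0 1) = 1 := by
  obtain ⟨⟨A, hdet⟩, hA⟩ := Z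
  change Aᴴ * sigJ * A = sigJ at hA
  simp only [SU11.entry]
  rw [Matrix.det_fin_two] at hdet
  have e00 := congrFun (congrFun hA 0) 0
  have e01 := congrFun (congrFun hA 0) 1
  have e11 := congrFun (congrFun hA 1) 1
  simp [sigJ, Matrix.mul_apply, Fin.sum_univ_two, Matrix.conjTranspose_apply] at e00 e01 e11
  have h10 : A 1 0 = (starRingEnd ℂ) (A 0 1) := by
    have h := congrArg (starRingEnd ℂ) e01
    simp at h
    linear_combination (A 1 0) * e11 - (A 1 1) * h + (starRingEnd ℂ) (A 0 1) * hdet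
  have h11 : A 1 1 = (starRingEnd ℂ) (A 0 0) := by
    linear_combination (-(A 1 1)) * e00 + (A 1 0) * e01 + (starRingEnd ℂ) (A 0 0) * hdet
  refine ⟨h10, h11, ?_⟩
  have : ((Complex.normSq (A 0 0) - Complex.normSq (A 0 1) : ℝ) : ℂ) = 1 := by
    push_cast
    rw [Complex.normSq_eq_conj_mul_self, Complex.normSq_eq_conj_mul_self, ← hdet, h10, h11]
    ring
  exact_mod_cast this

theorem SU11.ext' {Z W : SU11} (h0 : Z.entry 0 0 = W.entry 0 0) (h1 : Z.entry 0 1 = W.entry 0 1) :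
    Z = W := by
  obtain ⟨a, b, -⟩ := Z.entry_rel
  obtain ⟨c, d, -⟩ := W.entry_rel
  apply Subtype.ext
  apply Subtype.ext
  ext i j
  change Z.entry i j = W.entry i j
  fin_cases i <;> fin_cases j <;> simp_all

theorem SU11.entry_zero_ne (Z : SU11) : Z.entry 0 0 ≠ 0 := by
  intro h
  have := Z.entry_rel.2.2
  rw [h, map_zero] at this
  linarith [Complex.normSq_nonneg (Z.entry 0 1)]

theorem SU11.continuous_entry (i j : Fin 2) : Continuous fun Z : SU11 => Z.entry i j := by
  have h : Continuous fun Z : SU11 => (Z.1.1 : Matrix (Fin 2) (Fin 2) ℂ) :=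
    continuous_subtype_val.comp continuous_subtype_val
  exact h.matrix_elem i j

/-- The map `(z¹,z²) ↦ (e^{Re z²} z¹/|z¹|, Im z²)`, a diffeomorphism of `SU(1,1) ≅ S¹ × ℝ²` onto
the open set `(ℂ ∖ {0}) × ℝ`. -/
def SU11.coord (Z : SU11) : ℂ × ℝ :=
  ((Real.exp (Z.entry 0 1).re / ‖Z.entry 0 0‖ : ℝ) • Z.entry 0 0, (Z.entry 0 1).im)

/-- The second entry `z²` in terms of the coordinates. -/
def SU11.invB (p : ℂ × ℝ) : ℂ := (Real.log ‖p.1‖ : ℂ) + (p.2 : ℂ) * I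

/-- The first entry `z¹` in terms of the coordinates. -/
def SU11.invA (p : ℂ × ℝ) : ℂ :=
  (Real.sqrt (1 + Complex.normSq (SU11.invB p)) / ‖p.1‖ : ℝ) • p.1

theorem SU11.inv_rel (p : ℂ × ℝ) (hp : p.1 ≠ 0) :
    Complex.normSq (SU11.invA p) - Complex.normSq (SU11.invB p) = 1 := by
  have h0 : ‖p.1‖ ≠ 0 := by simpa using hp
  have h1 : 0 ≤ 1 + Complex.normSq (SU11.invB p) := by
    linarith [Complex.normSq_nonneg (SU11.invB p)]
  have : Complex.normSq (SU11.invA p) = 1 + Complex.normSq (SU11.invB p) := by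
    rw [SU11.invA, Complex.normSq_eq_norm_sq, norm_smul, Real.norm_eq_abs, mul_pow, sq_abs, div_pow,
      Real.sq_sqrt h1]
    field_simp
  linarith

open Classical in
/-- The inverse of the coordinate map. -/
def SU11.coordInv (p : ℂ × ℝ) : SU11 :=
  if hp : p.1 ≠ 0 then SU11.mk' (SU11.invA p) (SU11.invB p) (SU11.inv_rel p hp) else 1

theorem SU11.coordInv_entry (p : ℂ × ℝ) (hp : p.1 ≠ 0) :
    (SU11.coordInv p).entry 0 0 = SU11.invA p ∧ (SU11.coordInv p).entry 0 1 = SU11.invB p := by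
  simp [SU11.coordInv, hp, SU11.mk', SU11.entry]

theorem SU11.coord_fst_ne (Z : SU11) : Z.coord.1 ≠ 0 := by
  have := Z.entry_zero_ne
  simp [SU11.coord, this]

theorem SU11.norm_coord_fst (Z : SU11) : ‖Z.coord.1‖ = Real.exp (Z.entry 0 1).re := by
  have h : ‖Z.entry 0 0‖ ≠ 0 := by simpa using Z.entry_zero_ne
  simp only [SU11.coord]
  rw [norm_smul, Real.norm_eq_abs, abs_div, abs_norm, abs_of_pos (Real.exp_pos _)]
  field_simp

theorem SU11.invB_coord (Z : SU11) : SU11.invB Z.coord = Z.entry 0 1 := by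
  rw [SU11.invB, Z.norm_coord_fst, Real.log_exp]
  exact Complex.re_add_im _

theorem SU11.invA_coord (Z : SU11) : SU11.invA Z.coord = Z.entry 0 0 := by
  have h : ‖Z.entry 0 0‖ ≠ 0 := by simpa using Z.entry_zero_ne
  have h2 : 1 + Complex.normSq (Z.entry 0 1) = ‖Z.entry 0 0‖ ^ 2 := by
    rw [← Complex.normSq_eq_norm_sq]; linarith [Z.entry_rel.2.2]
  rw [SU11.invA, Z.invB_coord, Z.norm_coord_fst, h2, Real.sqrt_sq (norm_nonneg _)]
  simp only [SU11.coord]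
  rw [smul_smul]
  have : ‖Z.entry 0 0‖ / Real.exp (Z.entry 0 1).re *
      (Real.exp (Z.entry 0 1).re / ‖Z.entry 0 0‖) = 1 := by
    have := Real.exp_ne_zero (Z.entry 0 1).re
    field_simp
  rw [this, one_smul]

theorem SU11.coordInv_coord (Z : SU11) : SU11.coordInv Z.coord = Z := by
  have h := SU11.coordInv_entry Z.coord Z.coord_fst_ne
  exact SU11.ext' (h.1.trans Z.invA_coord) (h.2.trans Z.invB_coord)

theorem SU11.coord_coordInv (p : ℂ × ℝ) (hp : p.1 ≠ 0) : (SU11.coordInv p).coord = p := by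
  have h := SU11.coordInv_entry p hp
  have hn : ‖p.1‖ ≠ 0 := by simpa using hp
  have hpos : 0 < 1 + Complex.normSq (SU11.invB p) := by
    linarith [Complex.normSq_nonneg (SU11.invB p)]
  have hs := (Real.sqrt_pos.mpr hpos).ne'
  have hre : (SU11.invB p).re = Real.log ‖p.1‖ := by simp [SU11.invB]
  have him : (SU11.invB p).im = p.2 := by simp [SU11.invB]
  have hA : ‖SU11.invA p‖ = Real.sqrt (1 + Complex.normSq (SU11.invB p)) := by
    rw [SU11.invA, norm_smul, Real.norm_eq_abs, abs_div, abs_norm, abs_of_nonneg (Real.sqrt_nonneg _)]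
    field_simp
  apply Prod.ext
  · simp only [SU11.coord]
    rw [h.1, h.2, hre, hA, Real.exp_log (by positivity)]
    rw [SU11.invA, smul_smul]
    have : ‖p.1‖ / Real.sqrt (1 + Complex.normSq (SU11.invB p)) *
      (Real.sqrt (1 + Complex.normSq (SU11.invB p)) / ‖p.1‖) = 1 := by field_simp
    rw [this, one_smul]
  · simp only [SU11.coord]
    rw [h.2, him]

theorem SU11.contDiffOn_invB {n : ℕ∞ω} : ContDiffOn ℝ n SU11.invB {p | p.1 ≠ 0} := by
  intro p hp
  have h0 : ‖p.1‖ ≠ 0 := by simpa using hp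
  have h1 : ContDiffAt ℝ n (fun q : ℂ × ℝ => ‖q.1‖) p := contDiffAt_fst.norm ℝ hp
  have h2 := h1.log h0
  have h3 : ContDiffAt ℝ n (fun q : ℂ × ℝ => ((Real.log ‖q.1‖ : ℝ) : ℂ)) p :=
    Complex.ofRealCLM.contDiff.contDiffAt.comp p h2
  have h4 : ContDiffAt ℝ n (fun q : ℂ × ℝ => ((q.2 : ℝ) : ℂ)) p :=
    Complex.ofRealCLM.contDiff.contDiffAt.comp p contDiffAt_snd
  exact (h3.add (h4.mul contDiffAt_const)).contDiffWithinAt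

theorem SU11.contDiffOn_invA {n : ℕ∞ω} : ContDiffOn ℝ n SU11.invA {p | p.1 ≠ 0} := by
  intro p hp
  have h0 : ‖p.1‖ ≠ 0 := by simpa using hp
  have hpos : 0 < 1 + Complex.normSq (SU11.invB p) := by
    linarith [Complex.normSq_nonneg (SU11.invB p)]
  have hop : IsOpen {p : ℂ × ℝ | p.1 ≠ 0} := isOpen_ne.preimage continuous_fst
  have h1 : ContDiffAt ℝ n (fun q : ℂ × ℝ => ‖q.1‖) p := contDiffAt_fst.norm ℝ hp
  have hB : ContDiffAt ℝ n SU11.invB p := (SU11.contDiffOn_invB p hp).contDiffAt (hop.mem_nhds hp)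
  have hN : ContDiffAt ℝ n (fun q => Complex.normSq (SU11.invB q)) p := by
    have := hB.norm_sq ℝ
    refine this.congr_of_eventuallyEq (Filter.Eventually.of_forall fun q => ?_)
    exact Complex.normSq_eq_norm_sq _
  have hS := (contDiffAt_const (c := (1 : ℝ))).add hN |>.sqrt hpos.ne'
  exact ((hS.div h1 h0).smul contDiffAt_fst).contDiffWithinAt

/-- The global chart of `SU(1,1)`. -/
def SU11.chart : OpenPartialHomeomorph SU11 (ℂ × ℝ) where
  toFun := SU11.coord
  invFun := SU11.coordInv
  source := Set.univ
  target := {p | p.1 ≠ 0}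
  map_source' Z _ := Z.coord_fst_ne
  map_target' _ _ := Set.mem_univ _
  left_inv' Z _ := Z.coordInv_coord
  right_inv' p hp := SU11.coord_coordInv p hp
  open_source := isOpen_univ
  open_target := isOpen_ne.preimage continuous_fst
  continuousOn_toFun := by
    have h0 := SU11.continuous_entry 0 0
    have h1 := SU11.continuous_entry 0 1
    have hn : ∀ Z : SU11, ‖Z.entry 0 0‖ ≠ 0 := fun Z => by simpa using Z.entry_zero_ne
    apply Continuous.continuousOn
    exact (((Real.continuous_exp.comp (Complex.continuous_re.comp h1)).div h0.norm hn).smul h0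
      ).prodMk (Complex.continuous_im.comp h1)
  continuousOn_invFun := by
    have hA := (SU11.contDiffOn_invA (n := 0)).continuousOn
    have hB := (SU11.contDiffOn_invB (n := 0)).continuousOn
    have hA' := Complex.continuous_conj.comp_continuousOn hA
    have hB' := Complex.continuous_conj.comp_continuousOn hB
    refine Topology.IsInducing.subtypeVal.continuousOn_iff.mpr
      (Topology.IsInducing.subtypeVal.continuousOn_iff.mpr ?_)
    refine continuousOn_pi.mpr fun i => continuousOn_pi.mpr fun j => ?_
    have key : ∀ p ∈ {p : ℂ × ℝ | p.1 ≠ 0}, ∀ i j, (SU11.coordInv p).entry i j =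
        (!![SU11.invA p, SU11.invB p; (starRingEnd ℂ) (SU11.invB p),
          (starRingEnd ℂ) (SU11.invA p)] : Matrix (Fin 2) (Fin 2) ℂ) i j := by
      intro p hp i j
      have h := SU11.coordInv_entry p hp
      have h' := (SU11.coordInv p).entry_rel
      fin_cases i <;> fin_cases j <;> simp [h, h']
    refine ContinuousOn.congr ?_ (fun p hp => key p hp i j)
    fin_cases i <;> fin_cases j
    exacts [hA, hB, hB', hA']

instance SU11.instChartedSpace : ChartedSpace (ℂ × ℝ) SU11 :=
  SU11.chart.singletonChartedSpace rfl

instance SU11.instIsManifold (n : ℕ∞ω) : IsManifold 𝓘(ℝ, ℂ × ℝ) n SU11 :=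
  SU11.chart.isManifold_singleton rfl

theorem SU11.contMDiff_entry {n : ℕ∞ω} (i j : Fin 2) :
    ContMDiff 𝓘(ℝ, ℂ × ℝ) 𝓘(ℝ, ℂ) n fun Z : SU11 => Z.entry i j := by
  have key : ∀ f : SU11 → ℂ, Continuous f → ContDiffOn ℝ n (f ∘ SU11.coordInv) {p | p.1 ≠ 0} →
      ContMDiff 𝓘(ℝ, ℂ × ℝ) 𝓘(ℝ, ℂ) n f := by
    intro f hf h
    rw [contMDiff_iff]
    refine ⟨hf, fun x y => ?_⟩
    refine h.mono ?_ |>.congr ?_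
    · intro p hp
      have h2 : p ∈ (chartAt (ℂ × ℝ) x).target := by simpa using hp.1
      exact h2
    · intro p hp
      rfl
  have h0 := key (fun Z => Z.entry 0 0) (SU11.continuous_entry 0 0)
    (SU11.contDiffOn_invA.congr fun p hp => (SU11.coordInv_entry p hp).1)
  have h1 := key (fun Z => Z.entry 0 1) (SU11.continuous_entry 0 1)
    (SU11.contDiffOn_invB.congr fun p hp => (SU11.coordInv_entry p hp).2)
  fin_cases i <;> fin_cases j
  · exact h0
  · exact h1
  · have := Complex.conjCLE.contDiff.contMDiff.comp h1
    exact this.congr fun Z => Z.entry_rel.1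
  · have := Complex.conjCLE.contDiff.contMDiff.comp h0
    exact this.congr fun Z => Z.entry_rel.2.1

theorem SU11.contMDiff_of_entry {n : ℕ∞ω} {E' H' M' : Type*} [NormedAddCommGroup E']
    [NormedSpace ℝ E'] [TopologicalSpace H'] {I' : ModelWithCorners ℝ E' H'}
    [TopologicalSpace M'] [ChartedSpace H' M'] (f : M' → SU11)
    (h0 : ContMDiff I' 𝓘(ℝ, ℂ) n fun x => (f x).entry 0 0)
    (h1 : ContMDiff I' 𝓘(ℝ, ℂ) n fun x => (f x).entry 0 1) :
    ContMDiff I' 𝓘(ℝ, ℂ × ℝ) n f := by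
  have hn : ∀ x, ‖(f x).entry 0 0‖ ≠ 0 := fun x => by simpa using (f x).entry_zero_ne
  have hc : ContMDiff I' 𝓘(ℝ, ℂ × ℝ) n fun x => (f x).coord := by
    have hF : ∀ q : ℂ × ℂ, q.1 ≠ 0 → ContDiffAt ℝ n (fun q : ℂ × ℂ =>
        (((Real.exp q.2.re / ‖q.1‖ : ℝ) • q.1, q.2.im) : ℂ × ℝ)) q := by
      intro q hq
      have a1 : ContDiffAt ℝ n (fun q : ℂ × ℂ => ‖q.1‖) q := contDiffAt_fst.norm ℝ hq
      have a2 : ContDiffAt ℝ n (fun q : ℂ × ℂ => q.2.re) q :=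
        Complex.reCLM.contDiff.contDiffAt.comp q contDiffAt_snd
      have a3 : ContDiffAt ℝ n (fun q : ℂ × ℂ => q.2.im) q :=
        Complex.imCLM.contDiff.contDiffAt.comp q contDiffAt_snd
      exact ((a2.exp.div a1 (by simpa using hq)).smul contDiffAt_fst).prodMk a3
    intro x
    have h01 : ContMDiffAt I' 𝓘(ℝ, ℂ × ℂ) n (fun x => ((f x).entry 0 0, (f x).entry 0 1)) x :=
      (h0 x).prodMk_space (h1 x)
    exact (hF _ (f x).entry_zero_ne).contMDiffAt.comp x h01
  have hcont : Continuous f := by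
    have := (SU11.chart.continuousOn_symm).comp_continuous hc.continuous
      (fun x => (f x).coord_fst_ne)
    exact this.congr fun x => (f x).coordInv_coord
  intro x
  rw [contMDiffAt_iff_target]
  exact ⟨hcont.continuousAt, hc x⟩

instance SU11.instLieGroup : LieGroup 𝓘(ℝ, ℂ × ℝ) ω SU11 where
  contMDiff_mul := by
    have a : ∀ i j, ContMDiff (𝓘(ℝ, ℂ × ℝ).prod 𝓘(ℝ, ℂ × ℝ)) 𝓘(ℝ, ℂ) ω
        fun p : SU11 × SU11 => p.1.entry i j :=
      fun i j => (SU11.contMDiff_entry i j).comp contMDiff_fst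
    have b : ∀ i j, ContMDiff (𝓘(ℝ, ℂ × ℝ).prod 𝓘(ℝ, ℂ × ℝ)) 𝓘(ℝ, ℂ) ω
        fun p : SU11 × SU11 => p.2.entry i j :=
      fun i j => (SU11.contMDiff_entry i j).comp contMDiff_snd
    have e : ∀ (p : SU11 × SU11) i j, (p.1 * p.2).entry i j =
        p.1.entry i 0 * p.2.entry 0 j + p.1.entry i 1 * p.2.entry 1 j := by
      intro p i j
      simp [SU11.entry, Matrix.mul_apply, Fin.sum_univ_two]
    have hm : ContDiff ℝ ω fun q : (ℂ × ℂ) × (ℂ × ℂ) => q.1.1 * q.1.2 + q.2.1 * q.2.2 := by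
      fun_prop
    have c : ∀ i j, ContMDiff (𝓘(ℝ, ℂ × ℝ).prod 𝓘(ℝ, ℂ × ℝ)) 𝓘(ℝ, ℂ) ω
        fun p : SU11 × SU11 => (p.1 * p.2).entry i j := by
      intro i j
      have := hm.contMDiff.comp (((a i 0).prodMk_space (b 0 j)).prodMk_space
        ((a i 1).prodMk_space (b 1 j)))
      exact this.congr fun p => e p i j
    exact SU11.contMDiff_of_entry _ (c 0 0) (c 0 1)
  contMDiff_inv := by
    have e : ∀ Z : SU11, (Z⁻¹).entry 0 0 = Z.entry 1 1 ∧ (Z⁻¹).entry 0 1 = - Z.entry 0 1 := by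
      intro Z
      simp [SU11.entry, Matrix.SpecialLinearGroup.SL2_inv_expl]
    refine SU11.contMDiff_of_entry _ ?_ ?_
    · exact (SU11.contMDiff_entry 1 1).congr fun Z => (e Z).1
    · have := contDiff_neg (𝕜 := ℝ) (F := ℂ) (n := ω) |>.contMDiff.comp (SU11.contMDiff_entry 0 1)
      exact this.congr fun Z => (e Z).2

/-- The Lie algebra `su(1,1)` of trace-free matrices `B` with `Bᴴ J + J B = 0`. -/
def su11 : LieSubalgebra ℝ (Matrix (Fin 2) (Fin 2) ℂ) where
  carrier := {B | Bᴴ * sigJ + sigJ * B = 0 ∧ B.trace = 0}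
  add_mem' := by
    rintro A B ⟨hA, hA'⟩ ⟨hB, hB'⟩
    refine ⟨?_, by rw [Matrix.trace_add, hA', hB', add_zero]⟩
    rw [Matrix.conjTranspose_add, add_mul, mul_add]
    calc _ = (Aᴴ * sigJ + sigJ * A) + (Bᴴ * sigJ + sigJ * B) := by abel
      _ = 0 := by rw [hA, hB, add_zero]
  zero_mem' := by simp
  smul_mem' := by
    rintro c A ⟨hA, hA'⟩
    refine ⟨?_, by rw [Matrix.trace_smul, hA', smul_zero]⟩
    rw [Matrix.conjTranspose_smul, star_trivial, smul_mul_assoc, mul_smul_comm, ← smul_add, hA,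
      smul_zero]
  lie_mem' := by
    rintro A B ⟨hA, -⟩ ⟨hB, -⟩
    refine ⟨?_, by rw [Ring.lie_def, Matrix.trace_sub, Matrix.trace_mul_comm, sub_self]⟩
    have hA2 : Aᴴ * sigJ = -(sigJ * A) := eq_neg_of_add_eq_zero_left hA
    have hB2 : Bᴴ * sigJ = -(sigJ * B) := eq_neg_of_add_eq_zero_left hB
    rw [Ring.lie_def, Matrix.conjTranspose_sub, Matrix.conjTranspose_mul, Matrix.conjTranspose_mul,
      sub_mul, Matrix.mul_assoc, hA2, Matrix.mul_assoc Aᴴ, hB2, mul_neg, mul_neg,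
      ← Matrix.mul_assoc, hB2, ← Matrix.mul_assoc, hA2]
    noncomm_ring

theorem su11.exp_rel (B : su11) :
    (NormedSpace.exp (B : Matrix (Fin 2) (Fin 2) ℂ)).det = 1 ∧
      (NormedSpace.exp (B : Matrix (Fin 2) (Fin 2) ℂ))ᴴ * sigJ *
        NormedSpace.exp (B : Matrix (Fin 2) (Fin 2) ℂ) = sigJ := by
  obtain ⟨B, hB, htr⟩ := B
  change (NormedSpace.exp B).det = 1 ∧ (NormedSpace.exp B)ᴴ * sigJ * NormedSpace.exp B = sigJ
  have hinv : NormedSpace.exp (-B) * NormedSpace.exp B = 1 := by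
    rw [← Matrix.exp_add_of_commute _ _ (Commute.neg_left (Commute.refl B)), neg_add_cancel,
      NormedSpace.exp_zero]
  have hJJ : sigJ * sigJ = 1 := by
    ext i j; fin_cases i <;> fin_cases j <;> simp [sigJ, Matrix.mul_apply, Fin.sum_univ_two]
  have hJu : IsUnit sigJ := ⟨⟨sigJ, sigJ, hJJ, hJJ⟩, rfl⟩
  have hJinv : sigJ⁻¹ = sigJ := Matrix.inv_eq_right_inv hJJ
  constructor
  · set e : Matrix (Fin 2) (Fin 2) ℂ := !![0, 1; -1, 0] with he
    set f : Matrix (Fin 2) (Fin 2) ℂ := !![0, -1; 1, 0] with hf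
    have hef : e * f = 1 := by
      ext i j; fin_cases i <;> fin_cases j <;> simp [he, hf, Matrix.mul_apply, Fin.sum_univ_two]
    have hfe : f * e = 1 := by
      ext i j; fin_cases i <;> fin_cases j <;> simp [he, hf, Matrix.mul_apply, Fin.sum_univ_two]
    have heu : IsUnit e := ⟨⟨e, f, hef, hfe⟩, rfl⟩
    have heinv : e⁻¹ = f := Matrix.inv_eq_right_inv hef
    have hadj : ∀ A : Matrix (Fin 2) (Fin 2) ℂ, e * Aᵀ * e⁻¹ = A.adjugate := by
      intro A
      rw [heinv, Matrix.adjugate_fin_two]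
      ext i j
      fin_cases i <;> fin_cases j <;>
        simp [he, hf, Matrix.vecMul, dotProduct, Matrix.mul_apply, Fin.sum_univ_two]
    have hBadj : B.adjugate = -B := by
      rw [Matrix.trace_fin_two] at htr
      rw [Matrix.adjugate_fin_two]
      ext i j
      fin_cases i <;> fin_cases j <;> simp
      · linear_combination htr
      · linear_combination htr
    have h1 : (NormedSpace.exp B).adjugate = NormedSpace.exp (-B) := by
      rw [← hadj, ← Matrix.exp_transpose, ← Matrix.exp_conj _ _ heu, hadj, hBadj]
    have h2 := Matrix.adjugate_mul (NormedSpace.exp B)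
    rw [h1, hinv] at h2
    have h3 := congrFun (congrFun h2 0) 0
    simpa using h3.symm
  · have hBH : Bᴴ = sigJ * (-B) * sigJ⁻¹ := by
      have : Bᴴ * sigJ = sigJ * (-B) := by
        rw [mul_neg]; exact eq_neg_of_add_eq_zero_left hB
      rw [← this, hJinv, Matrix.mul_assoc, hJJ, Matrix.mul_one]
    rw [← Matrix.exp_conjTranspose, hBH, Matrix.exp_conj _ _ hJu, hJinv]
    calc _ = sigJ * NormedSpace.exp (-B) * (sigJ * sigJ) * NormedSpace.exp B := by
          simp only [Matrix.mul_assoc]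
      _ = sigJ * (NormedSpace.exp (-B) * NormedSpace.exp B) := by
          rw [hJJ, Matrix.mul_one, Matrix.mul_assoc]
      _ = sigJ := by rw [hinv, Matrix.mul_one]

/-- The exponential map `su(1,1) → SU(1,1)`, given by the matrix exponential. -/
def su11.exp (B : su11) : SU11 :=
  ⟨⟨NormedSpace.exp (B : Matrix (Fin 2) (Fin 2) ℂ), (su11.exp_rel B).1⟩, (su11.exp_rel B).2⟩

/-- The basis `X₀ = diag(i,-i)`, `X₁ = (0 1; 1 0)`, `X₂ = (0 i; -i 0)` of `su(1,1)`. -/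
def pauli : Fin 3 → su11 := ![
  ⟨!![I, 0; 0, -I], by
    refine ⟨?_, by simp [Matrix.trace_fin_two]⟩
    ext i j; fin_cases i <;> fin_cases j <;>
      simp [sigJ, Matrix.mul_apply, Fin.sum_univ_two, Matrix.conjTranspose_apply]⟩,
  ⟨!![0, 1; 1, 0], by
    refine ⟨?_, by simp [Matrix.trace_fin_two]⟩
    ext i j; fin_cases i <;> fin_cases j <;>
      simp [sigJ, Matrix.mul_apply, Fin.sum_univ_two, Matrix.conjTranspose_apply]⟩,
  ⟨!![0, I; -I, 0], by
    refine ⟨?_, by simp [Matrix.trace_fin_two]⟩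
    ext i j; fin_cases i <;> fin_cases j <;>
      simp [sigJ, Matrix.mul_apply, Fin.sum_univ_two, Matrix.conjTranspose_apply]⟩]

/-- The matrix with rows `(cosh s, -sinh s)` and `(-sinh s, cosh s)`, as an element of `SU(1,1)`. -/
def boost (s : ℝ) : SU11 :=
  SU11.mk' (Real.cosh s) (-Real.sinh s) (by
    rw [Complex.normSq_neg, Complex.normSq_ofReal, Complex.normSq_ofReal]
    linarith [Real.cosh_sq s])

theorem boost_add (s r : ℝ) : boost (s + r) = boost s * boost r := by
  have e : ∀ (Z W : SU11) (i j : Fin 2), (Z * W).entry i j =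
      Z.entry i 0 * W.entry 0 j + Z.entry i 1 * W.entry 1 j := by
    intro Z W i j
    simp [SU11.entry, Matrix.mul_apply, Fin.sum_univ_two]
  apply SU11.ext'
  · rw [e]
    simp [boost, SU11.mk', SU11.entry, Complex.cosh_add, ← Complex.sinh_conj]
  · rw [e]
    simp [boost, SU11.mk', SU11.entry, Complex.sinh_add, ← Complex.cosh_conj]

theorem boost_zero : boost 0 = 1 := by
  apply SU11.ext' <;> simp [boost, SU11.mk', SU11.entry]

/-- The action `((A, s), Z) ↦ A Z (cosh s, -sinh s; -sinh s, cosh s)` of `SU(1,1) × ℝ` on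
`SU(1,1)`. The additive group `ℝ` is written multiplicatively. -/
def boostAction : SU11 × Multiplicative ℝ →* Equiv.Perm SU11 where
  toFun a :=
    { toFun := fun Z => a.1 * Z * boost a.2.toAdd
      invFun := fun Z => a.1⁻¹ * Z * boost (-a.2.toAdd)
      left_inv := fun Z => by
        have : boost a.2.toAdd * boost (-a.2.toAdd) = 1 := by
          rw [← boost_add, add_neg_cancel, boost_zero]
        simp [mul_assoc, this]
      right_inv := fun Z => by
        have : boost (-a.2.toAdd) * boost a.2.toAdd = 1 := by
          rw [← boost_add, neg_add_cancel, boost_zero]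
        simp [mul_assoc, this] }
  map_one' := by
    ext1 Z
    simp [boost_zero]
  map_mul' a b := by
    ext1 Z
    have : boost (b.2.toAdd + a.2.toAdd) = boost b.2.toAdd * boost a.2.toAdd := boost_add _ _
    simp [mul_assoc, add_comm a.2.toAdd, this]

/-- The action of `SU(1,1)` on itself by left translations. -/
def leftAction : SU11 →* Equiv.Perm SU11 := MulAction.toPermHom SU11 SU11

/-- The exponential map of `SU(1,1) × ℝ`, whose Lie algebra is `su(1,1) ⊕ ℝ`. -/
def prodExp (X : su11 × ℝ) : SU11 × Multiplicative ℝ :=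
  (su11.exp X.1, Multiplicative.ofAdd X.2)

instance instChartedSpaceMultReal : ChartedSpace ℝ (Multiplicative ℝ) :=
  inferInstanceAs (ChartedSpace ℝ ℝ)

instance instLieGroupMultReal : LieGroup 𝓘(ℝ, ℝ) ω (Multiplicative ℝ) where
  toIsManifold := inferInstanceAs (IsManifold 𝓘(ℝ, ℝ) ω ℝ)
  contMDiff_mul := contMDiff_add (I := 𝓘(ℝ, ℝ)) (n := ω) (G := ℝ)
  contMDiff_inv := contMDiff_neg (I := 𝓘(ℝ, ℝ)) (n := ω) (G := ℝ)

/-! ### Pseudo-Riemannian geometry and connections -/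

section Geometry

open VectorField

variable {E : Type*} [NormedAddCommGroup E] [NormedSpace ℝ E] {H : Type*} [TopologicalSpace H]
  {J : ModelWithCorners ℝ E H} {M : Type*} [TopologicalSpace M] [ChartedSpace H M]
  [IsManifold J ∞ M]

/-- A vector field is smooth. -/
def IsSmoothField (X : Π x : M, TangentSpace J x) : Prop :=
  ContMDiff J J.tangent ∞ fun x => (⟨x, X x⟩ : TangentBundle J M)

/-- `g` is a smooth symmetric nondegenerate `(0,2)`-tensor field. -/
structure IsPseudoRiemannianMetric
    (g : Π x : M, TangentSpace J x →L[ℝ] TangentSpace J x →L[ℝ] ℝ) : Prop where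
  symm : ∀ x u v, g x u v = g x v u
  nondegenerate : ∀ x u, (∀ v, g x u v = 0) → u = 0
  smooth : ∀ X Y : Π x : M, TangentSpace J x, IsSmoothField X → IsSmoothField Y →
    ContMDiff J 𝓘(ℝ, ℝ) ∞ fun x => g x (X x) (Y x)

/-- At every point `g` is diagonal with entries `-1, 1, …, 1` in a suitable basis. -/
def HasLorentzianSignature
    (g : Π x : M, TangentSpace J x →L[ℝ] TangentSpace J x →L[ℝ] ℝ) : Prop :=
  ∀ x, ∃ (n : ℕ) (b : Module.Basis (Fin (n + 1)) ℝ (TangentSpace J x)), ∀ i j,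
    g x (b i) (b j) = if i = j then (if i = 0 then -1 else 1) else 0

/-- `∇ g = 0`. Here, as everywhere below, `∇_X Y` at `x` is `D Y x (X x)`. -/
def ParallelMetric (D : CovariantDerivative J E (TangentSpace J : M → Type _))
    (g : Π x : M, TangentSpace J x →L[ℝ] TangentSpace J x →L[ℝ] ℝ) : Prop :=
  ∀ W X Y : Π x : M, TangentSpace J x, IsSmoothField W → IsSmoothField X → IsSmoothField Y →
    ∀ x, mvfderiv J (fun y => g y (X y) (Y y)) x (W x) =
      g x (D X x (W x)) (Y x) + g x (X x) (D Y x (W x))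

/-- `D` is the Levi-Civita connection of `g`: metric and torsion-free. -/
def IsLeviCivita [CompleteSpace E] [FiniteDimensional ℝ E]
    (g : Π x : M, TangentSpace J x →L[ℝ] TangentSpace J x →L[ℝ] ℝ)
    (D : CovariantDerivative J E (TangentSpace J : M → Type _)) : Prop :=
  ParallelMetric D g ∧ D.torsion = 0

/-- `R(X,Y)Z = ∇_X ∇_Y Z - ∇_Y ∇_X Z - ∇_[X,Y] Z`. -/
def curvatureField (D : CovariantDerivative J E (TangentSpace J : M → Type _))
    (X Y Z : Π x : M, TangentSpace J x) : Π x : M, TangentSpace J x := fun x =>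
  D (fun y => D Z y (Y y)) x (X x) - D (fun y => D Z y (X y)) x (Y x) -
    D Z x (mlieBracket J X Y x)

/-- The connection `∇ - S`, where `S x u v` is `S_u v`. -/
def canonicalConnection (D : CovariantDerivative J E (TangentSpace J : M → Type _))
    (S : Π x : M, TangentSpace J x →L[ℝ] TangentSpace J x →L[ℝ] TangentSpace J x) :
    CovariantDerivative J E (TangentSpace J : M → Type _) :=
  D.addOneForm fun x =>
    let T : E →L[ℝ] E →L[ℝ] E := S x
    let T' : E →L[ℝ] E →L[ℝ] E := -T.flip
    T'

/-- The smooth `(1,2)`-tensor field `S` is a homogeneous pseudo-Riemannian structure on `(M,g)`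
with Levi-Civita connection `D`: for `∇̃ = ∇ - S` one has `∇̃ g = 0`, `∇̃ R = 0`, `∇̃ S = 0`. -/
structure IsHomogeneousStructure
    (g : Π x : M, TangentSpace J x →L[ℝ] TangentSpace J x →L[ℝ] ℝ)
    (D : CovariantDerivative J E (TangentSpace J : M → Type _))
    (S : Π x : M, TangentSpace J x →L[ℝ] TangentSpace J x →L[ℝ] TangentSpace J x) : Prop where
  smooth : ∀ X Y : Π x : M, TangentSpace J x, IsSmoothField X → IsSmoothField Y →
    IsSmoothField fun x => S x (X x) (Y x)
  parallel_metric : ParallelMetric (canonicalConnection D S) g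
  parallel_curvature : ∀ W X Y Z : Π x : M, TangentSpace J x,
    IsSmoothField W → IsSmoothField X → IsSmoothField Y → IsSmoothField Z → ∀ x,
      canonicalConnection D S (curvatureField D X Y Z) x (W x) =
        curvatureField D (fun y => canonicalConnection D S X y (W y)) Y Z x +
        curvatureField D X (fun y => canonicalConnection D S Y y (W y)) Z x +
        curvatureField D X Y (fun y => canonicalConnection D S Z y (W y)) x
  parallel_structure : ∀ W X Y : Π x : M, TangentSpace J x,
    IsSmoothField W → IsSmoothField X → IsSmoothField Y → ∀ x,
      canonicalConnection D S (fun y => S y (X y) (Y y)) x (W x) =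
        S x (canonicalConnection D S X x (W x)) (Y x) +
        S x (X x) (canonicalConnection D S Y x (W x))

/-- `(φ, ξ, η)` is a smooth almost paracontact structure compatible with `g`. -/
structure IsAlmostParacontactMetric
    (g : Π x : M, TangentSpace J x →L[ℝ] TangentSpace J x →L[ℝ] ℝ)
    (φ : Π x : M, TangentSpace J x →L[ℝ] TangentSpace J x)
    (ξ : Π x : M, TangentSpace J x) (η : Π x : M, TangentSpace J x →L[ℝ] ℝ) : Prop where
  smooth_phi : ∀ X : Π x : M, TangentSpace J x, IsSmoothField X →
    IsSmoothField fun x => φ x (X x)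
  smooth_xi : IsSmoothField ξ
  smooth_eta : ∀ X : Π x : M, TangentSpace J x, IsSmoothField X →
    ContMDiff J 𝓘(ℝ, ℝ) ∞ fun x => η x (X x)
  phi_sq : ∀ x u, φ x (φ x u) = u - η x u • ξ x
  eta_xi : ∀ x, η x (ξ x) = 1
  compatible : ∀ x u v, g x (φ x u) (φ x v) = -g x u v + η x u * η x v

/-- The almost paracontact metric structure is `β`-paraSasakian:
`(∇_X φ) Y = β (g(X,Y) ξ - η(Y) X)`. -/
structure IsParaSasakian (β : ℝ)
    (g : Π x : M, TangentSpace J x →L[ℝ] TangentSpace J x →L[ℝ] ℝ)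
    (D : CovariantDerivative J E (TangentSpace J : M → Type _))
    (φ : Π x : M, TangentSpace J x →L[ℝ] TangentSpace J x)
    (ξ : Π x : M, TangentSpace J x) (η : Π x : M, TangentSpace J x →L[ℝ] ℝ) : Prop where
  almostParacontact : IsAlmostParacontactMetric g φ ξ η
  nabla_phi : ∀ X Y : Π x : M, TangentSpace J x, IsSmoothField X → IsSmoothField Y → ∀ x,
    D (fun y => φ y (Y y)) x (X x) - φ x (D Y x (X x)) =
      β • (g x (X x) (Y x) • ξ x - η x (Y x) • X x)

/-- `(S, φ, ξ, η)` is a homogeneous almost paracontact metric structure: `S` is a homogeneous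
structure on the almost paracontact metric manifold, and `φ`, `ξ`, `η` are parallel for `∇ - S`. -/
structure IsHomogeneousAlmostParacontact
    (g : Π x : M, TangentSpace J x →L[ℝ] TangentSpace J x →L[ℝ] ℝ)
    (D : CovariantDerivative J E (TangentSpace J : M → Type _))
    (S : Π x : M, TangentSpace J x →L[ℝ] TangentSpace J x →L[ℝ] TangentSpace J x)
    (φ : Π x : M, TangentSpace J x →L[ℝ] TangentSpace J x)
    (ξ : Π x : M, TangentSpace J x) (η : Π x : M, TangentSpace J x →L[ℝ] ℝ) : Prop where
  almostParacontact : IsAlmostParacontactMetric g φ ξ η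
  homogeneous : IsHomogeneousStructure g D S
  parallel_phi : ∀ W X : Π x : M, TangentSpace J x, IsSmoothField W → IsSmoothField X → ∀ x,
    canonicalConnection D S (fun y => φ y (X y)) x (W x) =
      φ x (canonicalConnection D S X x (W x))
  parallel_xi : ∀ x u, canonicalConnection D S ξ x u = 0
  parallel_eta : ∀ W X : Π x : M, TangentSpace J x, IsSmoothField W → IsSmoothField X → ∀ x,
    mvfderiv J (fun y => η y (X y)) x (W x) = η x (canonicalConnection D S X x (W x))

/-- `A` is the endomorphism `R(u,v)` of the tangent space at `o`. -/
def IsCurvatureOperator (D : CovariantDerivative J E (TangentSpace J : M → Type _)) (o : M)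
    (u v : TangentSpace J o) (A : Module.End ℝ (TangentSpace J o)) : Prop :=
  ∀ X Y Z : Π x : M, TangentSpace J x, IsSmoothField X → IsSmoothField Y → IsSmoothField Z →
    X o = u → Y o = v → A (Z o) = curvatureField D X Y Z o

/-- The Lie algebra of endomorphisms of the tangent space at `o` generated by the curvature
operators of `D`. If the curvature and the torsion of `D` are parallel, it is the holonomy
algebra of `D`. -/
def holonomyAlgebra (D : CovariantDerivative J E (TangentSpace J : M → Type _)) (o : M) :
    LieSubalgebra ℝ (Module.End ℝ (TangentSpace J o)) :=
  LieSubalgebra.lieSpan ℝ (Module.End ℝ (TangentSpace J o))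
    {A | ∃ u v, IsCurvatureOperator D o u v A}

end Geometry

/-! ### Group actions and reductive decompositions

An action of a group `G` on `M` is a homomorphism `act : G →* Equiv.Perm M`. The Lie algebra of `G`
is `𝔤`, with exponential map `ex : 𝔤 → G`. -/

section Actions

variable {E : Type*} [NormedAddCommGroup E] [NormedSpace ℝ E] {H : Type*} [TopologicalSpace H]
  {J : ModelWithCorners ℝ E H} {M : Type*} [TopologicalSpace M] [ChartedSpace H M]
  {G : Type*} [Group G]

/-- The Lie group `G` acts smoothly, transitively and effectively on `M`. -/
structure IsTransitiveEffectiveAction {E' : Type*} [NormedAddCommGroup E'] [NormedSpace ℝ E']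
    {H' : Type*} [TopologicalSpace H'] (J' : ModelWithCorners ℝ E' H') [TopologicalSpace G]
    [ChartedSpace H' G] (J : ModelWithCorners ℝ E H)
    (act : G →* Equiv.Perm M) : Prop where
  smooth : ContMDiff (J'.prod J) J ∞ fun p : G × M => act p.1 p.2
  transitive : ∀ x y, ∃ a, act a x = y
  effective : ∀ a, (∀ x, act a x = x) → a = 1

/-- Every element of `G` acts as an isometry of `g`. -/
def IsIsometricAction (act : G →* Equiv.Perm M)
    (g : Π x : M, TangentSpace J x →L[ℝ] TangentSpace J x →L[ℝ] ℝ) : Prop :=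
  ∀ a x u v, g (act a x) (mfderiv J J (act a) x u) (mfderiv J J (act a) x v) = g x u v

/-- Every element of `G` preserves `φ`, `ξ` and `η`. -/
structure PreservesParacontact (act : G →* Equiv.Perm M)
    (φ : Π x : M, TangentSpace J x →L[ℝ] TangentSpace J x)
    (ξ : Π x : M, TangentSpace J x) (η : Π x : M, TangentSpace J x →L[ℝ] ℝ) : Prop where
  phi : ∀ a x u, mfderiv J J (act a) x (φ x u) = φ (act a x) (mfderiv J J (act a) x u)
  xi : ∀ a x, mfderiv J J (act a) x (ξ x) = ξ (act a x)
  eta : ∀ a x u, η (act a x) (mfderiv J J (act a) x u) = η x u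

variable {𝔤 : Type*} [LieRing 𝔤] [LieAlgebra ℝ 𝔤]

/-- The vector field `X*` generated by the one-parameter group `exp(sX)`. -/
def generatedField (J : ModelWithCorners ℝ E H) (ex : 𝔤 → G)
    (act : G →* Equiv.Perm M) (X : 𝔤) (x : M) : TangentSpace J x :=
  mfderiv 𝓘(ℝ, ℝ) J (fun s : ℝ => act (ex (s • X)) x) (0 : ℝ) (1 : ℝ)

/-- `𝔤 = 𝔥 ⊕ 𝔪` is a reductive decomposition for the isotropy group of `o`: `𝔥` is the Lie algebra
of the isotropy group, and `𝔪` is a complement invariant under `Ad_h` for all `h` in the isotropy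
group, where `Y = Ad_h X` is expressed by `h exp(sX) h⁻¹ = exp(sY)`. -/
structure IsReductiveDecomposition (ex : 𝔤 → G) (act : G →* Equiv.Perm M) (o : M)
    (𝔥 𝔪 : Submodule ℝ 𝔤) : Prop where
  isCompl : IsCompl 𝔥 𝔪
  mem_isotropy : ∀ X, X ∈ 𝔥 ↔ ∀ s : ℝ, act (ex (s • X)) o = o
  ad_invariant : ∀ h, act h o = o → ∀ X ∈ 𝔪, ∃ Y ∈ 𝔪, ∀ s : ℝ, h * ex (s • X) * h⁻¹ = ex (s • Y)

variable [IsManifold J ∞ M]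

/-- `D` is the canonical connection of the reductive decomposition `𝔤 = 𝔥 ⊕ 𝔪` at `o`: it is
invariant under `G`, and `D_{X*} Y* = -([X,Y]_𝔪)*` at `o` for `X, Y ∈ 𝔪`. -/
structure IsCanonicalConnection (ex : 𝔤 → G) (act : G →* Equiv.Perm M) (o : M)
    (𝔥 𝔪 : Submodule ℝ 𝔤) (D : CovariantDerivative J E (TangentSpace J : M → Type _)) : Prop where
  invariant : ∀ a, ∀ Y : Π x : M, TangentSpace J x, IsSmoothField Y → ∀ x u,
    mfderiv J J (act a) x (D (VectorField.mpullback J J (act a) Y) x u) =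
      D Y (act a x) (mfderiv J J (act a) x u)
  at_base : ∀ X ∈ 𝔪, ∀ Y ∈ 𝔪, ∀ V ∈ 𝔪, ⁅X, Y⁆ - V ∈ 𝔥 →
    D (generatedField J ex act Y) o (generatedField J ex act X o) = -generatedField J ex act V o

/-- The decomposition `𝔤 = 𝔥 ⊕ 𝔪` is the one determined by the homogeneous structure `S`: `𝔥` is
identified by `ρ` with the holonomy algebra of `∇̃ = ∇ - S` at `o`, `𝔪` is identified with the
tangent space at `o` by `τ X = X*_o`, and for `U, V ∈ 𝔥`, `X, Y ∈ 𝔪` the brackets of `𝔤` are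
`[U,V] = UV - VU`, `[U,X] = U(X)` and `[X,Y] = S_X Y - S_Y X - R̃(X,Y)`. -/
def IsDecompositionOfStructure (ex : 𝔤 → G) (act : G →* Equiv.Perm M) (o : M)
    (𝔥 𝔪 : Submodule ℝ 𝔤) (D : CovariantDerivative J E (TangentSpace J : M → Type _))
    (S : Π x : M, TangentSpace J x →L[ℝ] TangentSpace J x →L[ℝ] TangentSpace J x) : Prop :=
  ∃ (ρ : 𝔥 ≃ₗ[ℝ] holonomyAlgebra (canonicalConnection D S) o) (τ : 𝔪 ≃ₗ[ℝ] TangentSpace J o),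
    (∀ X : 𝔪, τ X = generatedField J ex act (X : 𝔤) o) ∧
    (∀ U V : 𝔥, ⁅(U : 𝔤), (V : 𝔤)⁆ = (ρ.symm ⁅ρ U, ρ V⁆ : 𝔥)) ∧
    (∀ (U : 𝔥) (X : 𝔪), ⁅(U : 𝔤), (X : 𝔤)⁆ =
      (τ.symm ((ρ U : Module.End ℝ (TangentSpace J o)) (τ X)) : 𝔪)) ∧
    (∀ X Y : 𝔪, ∃ W : 𝔥,
      IsCurvatureOperator (canonicalConnection D S) o (τ X) (τ Y)
        (ρ W : Module.End ℝ (TangentSpace J o)) ∧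
      ⁅(X : 𝔤), (Y : 𝔤)⁆ = (τ.symm (S o (τ X) (τ Y) - S o (τ Y) (τ X)) : 𝔪) - (W : 𝔤))

end Actions

/-! ### Metrics of Kaluza-Klein type on `SU(1,1)` -/

/-- The left-invariant vector field `X_a`, at `Z` the velocity of `s ↦ Z exp(s X_a)`. -/
def frame (a : Fin 3) (Z : SU11) : TangentSpace 𝓘(ℝ, ℂ × ℝ) Z :=
  mfderiv 𝓘(ℝ, ℝ) 𝓘(ℝ, ℂ × ℝ) (fun s : ℝ => Z * su11.exp (s • pauli a)) (0 : ℝ) (1 : ℝ)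

/-- The `(i,j)` entry of the Maurer-Cartan form `Z⁻¹ dZ`. -/
def maurerCartan (i j : Fin 2) (Z : SU11) : TangentSpace 𝓘(ℝ, ℂ × ℝ) Z →L[ℝ] ℂ :=
  ∑ k, (Z⁻¹).entry i k • mvfderiv 𝓘(ℝ, ℂ × ℝ) (fun W : SU11 => W.entry k j) Z

/-- The left-invariant coframe `θ⁰, θ¹, θ²` dual to `X₀, X₁, X₂`, that is,
`Z⁻¹ dZ = θ⁰ X₀ + θ¹ X₁ + θ² X₂`. -/
def coframe (a : Fin 3) (Z : SU11) : TangentSpace 𝓘(ℝ, ℂ × ℝ) Z →L[ℝ] ℝ :=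
  ![Complex.imCLM.comp (maurerCartan 0 0 Z), Complex.reCLM.comp (maurerCartan 0 1 Z),
    Complex.imCLM.comp (maurerCartan 0 1 Z)] a

/-- The metric `g = λ θ⁰⊗θ⁰ + μ θ¹⊗θ¹ + ν θ²⊗θ²`. -/
def kkMetric (lam mu nu : ℝ) (Z : SU11) :
    TangentSpace 𝓘(ℝ, ℂ × ℝ) Z →L[ℝ] TangentSpace 𝓘(ℝ, ℂ × ℝ) Z →L[ℝ] ℝ :=
  ∑ a, ![lam, mu, nu] a • (coframe a Z).smulRight (coframe a Z)

/-- `θᵃ ∧ θᵇ = θᵃ⊗θᵇ - θᵇ⊗θᵃ`. -/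
def wedge (a b : Fin 3) (Z : SU11) (u v : TangentSpace 𝓘(ℝ, ℂ × ℝ) Z) : ℝ :=
  coframe a Z u * coframe b Z v - coframe b Z u * coframe a Z v

/-- The `(0,3)`-tensor `S_μ(t) = μ θ²⊗θ⁰∧θ¹ + μ θ⁰⊗θ¹∧θ² + t θ¹⊗θ²∧θ⁰`. -/
def sMuLow (mu t : ℝ) (Z : SU11) (u v w : TangentSpace 𝓘(ℝ, ℂ × ℝ) Z) : ℝ :=
  mu * coframe 2 Z u * wedge 0 1 Z v w + mu * coframe 0 Z u * wedge 1 2 Z v w +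
    t * coframe 1 Z u * wedge 2 0 Z v w

/-- The vector fields `X₀/√|λ|`, `X₁/√μ`, `X₂/√ν`. -/
def unitFrame (lam mu nu : ℝ) (a : Fin 3) (Z : SU11) : TangentSpace 𝓘(ℝ, ℂ × ℝ) Z :=
  (Real.sqrt (![|lam|, mu, nu] a))⁻¹ • frame a Z

/-- The one-forms dual to `unitFrame`. -/
def unitCoframe (lam mu nu : ℝ) (a : Fin 3) (Z : SU11) : TangentSpace 𝓘(ℝ, ℂ × ℝ) Z →L[ℝ] ℝ :=
  Real.sqrt (![|lam|, mu, nu] a) • coframe a Z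

/-- `φ̃₁ = -X̄₂⊗θ̄⁰ - X̄₀⊗θ̄²`, the endomorphism `u ↦ -θ̄⁰(u) X̄₂ - θ̄²(u) X̄₀`. -/
def phiOne (lam mu nu : ℝ) (Z : SU11) :
    TangentSpace 𝓘(ℝ, ℂ × ℝ) Z →L[ℝ] TangentSpace 𝓘(ℝ, ℂ × ℝ) Z :=
  -(unitCoframe lam mu nu 0 Z).smulRight (unitFrame lam mu nu 2 Z) -
    (unitCoframe lam mu nu 2 Z).smulRight (unitFrame lam mu nu 0 Z)

/-- The vector field metrically equivalent to `θᵃ` for `g = λ θ⁰⊗θ⁰ + μ θ¹⊗θ¹ + ν θ²⊗θ²`. -/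
def sharp (lam mu nu : ℝ) (a : Fin 3) (Z : SU11) : TangentSpace 𝓘(ℝ, ℂ × ℝ) Z :=
  (![lam, mu, nu] a)⁻¹ • frame a Z

/-- The `(1,2)`-tensor metrically equivalent to `θᵃ ⊗ θᵇ ∧ θᶜ`. -/
def raisedTensor (lam mu nu : ℝ) (a b c : Fin 3) (Z : SU11) : TangentSpace 𝓘(ℝ, ℂ × ℝ) Z →L[ℝ]
    TangentSpace 𝓘(ℝ, ℂ × ℝ) Z →L[ℝ] TangentSpace 𝓘(ℝ, ℂ × ℝ) Z :=
  (coframe a Z).smulRight ((coframe b Z).smulRight (sharp lam mu nu c Z) -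
    (coframe c Z).smulRight (sharp lam mu nu b Z))

/-- The `(1,2)`-tensor field metrically equivalent to the `(0,3)`-tensor field `S_μ(t)`. -/
def sMu (lam mu nu t : ℝ) (Z : SU11) : TangentSpace 𝓘(ℝ, ℂ × ℝ) Z →L[ℝ]
    TangentSpace 𝓘(ℝ, ℂ × ℝ) Z →L[ℝ] TangentSpace 𝓘(ℝ, ℂ × ℝ) Z :=
  mu • raisedTensor lam mu nu 2 0 1 Z + mu • raisedTensor lam mu nu 0 1 2 Z +
    t • raisedTensor lam mu nu 1 2 0 Z

/-- The subalgebra `𝔥 = span {X₁ + D}` of `su(1,1) ⊕ ℝ`, where `D = (0,1)`. -/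
def hSub : Submodule ℝ (su11 × ℝ) := Submodule.span ℝ {(pauli 1, 1)}

/-- `𝔪 = span {X₀, ((μ+t)/2μ) X₁ - ((μ-t)/2μ) D, X₂}`. -/
def mSub (mu t : ℝ) : Submodule ℝ (su11 × ℝ) :=
  Submodule.span ℝ {(pauli 0, 0),
    (((mu + t) / (2 * mu)) • pauli 1, -((mu - t) / (2 * mu))), (pauli 2, 0)}
end

/-! In the left-invariant frame the metric, `S`, `φ`, `ξ`, `η` and the connections have constant
coefficients, so their properties become linear algebra on su(1,1) ≅ ℝ³ with [X₀,X₁] = 2X₂, [X₁,X₂]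
= -2X₀, [X₂,X₀] = 2X₁. The condition -λ = μ = ν makes g a multiple of the Killing form, hence
ad-invariant; its Levi-Civita connection is ∇_X Y = ½[X,Y] on left-invariant fields
(`isLeviCivita_symbolConnection`), and it is unique on smooth fields (`IsLeviCivita.eq_on_smooth`).

The decisive identity is `half_pauliBracket_sub_structForm`: subtracting S from ½[·,·] leaves the
symbol c θ¹⊗φ, with c = 1 - t/μ. Moreover φ = ½ ad X₁. Thus each endomorphism of the canonical
connection is a multiple of ad X₁: it is skew for g, a derivation of the bracket, commutes with φ,
and is compatible with X₁ and θ¹. Parallelism of g, R, S, φ, ξ, η follows at once. The endomorphisms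
also commute with each other, so the curvature of ∇ - S is R̃(u,v) = -c θ¹([u,v]) φ. The holonomy
algebra is the line ℝφ if t ≠ μ and zero if t = μ.

The right factor of the action is exp(-sX₁), so in the left frame the differential of (A,s) is Ad of
exp(sX₁), that is exp(2sφ) (`frameCoord_mfderiv_boostAction`). It preserves everything built from g,
φ and θ¹, including the connection. Infinitesimally, (B,d) in su(1,1) ⊕ ℝ moves I₂ with velocity B -
dX₁ (`orbitCoord`). The kernel of this map is 𝔥, and the coefficients of 𝔪 are chosen so that
`mSubParam` is a section of it.

The choice of the middle vector of 𝔪, with X₁-coefficient κ = (μ+t)/2μ, enters through 2(1-κ) = c.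
This makes -[X,Y]_𝔪 agree with the canonical connection at the base point and makes the 𝔥-part of
[X,Y] equal to -R̃(X,Y), once X₁ + D is identified with ad X₁ = 2φ. For t = μ one has c = 0 and S =
½[·,·], and the same formulas with D-component zero give the statement for left translations. -/

noncomputable section

/-! ### Derivatives of vector-valued functions on manifolds -/

section Calculus

variable {E : Type*} [NormedAddCommGroup E] [NormedSpace ℝ E] {H : Type*} [TopologicalSpace H]
  {J : ModelWithCorners ℝ E H} {M : Type*} [TopologicalSpace M] [ChartedSpace H M]
  {F : Type*} [NormedAddCommGroup F] [NormedSpace ℝ F]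
  {F' : Type*} [NormedAddCommGroup F'] [NormedSpace ℝ F']
  {F'' : Type*} [NormedAddCommGroup F''] [NormedSpace ℝ F'']

theorem mvfderiv_comp_mfderiv {E' : Type*} [NormedAddCommGroup E'] [NormedSpace ℝ E'] {H' : Type*}
    [TopologicalSpace H'] {J' : ModelWithCorners ℝ E' H'} {M' : Type*} [TopologicalSpace M']
    [ChartedSpace H' M'] {g : M → F} {f : M' → M} {x : M'}
    (hg : MDifferentiableAt J 𝓘(ℝ, F) g (f x)) (hf : MDifferentiableAt J' J f x)
    (v : TangentSpace J' x) :
    mvfderiv J' (fun y => g (f y)) x v = mvfderiv J g (f x) (mfderiv J' J f x v) := by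
  have h : mfderiv J' 𝓘(ℝ, F) (g ∘ f) x = _ := mfderiv_comp x hg hf
  change mfderiv J' 𝓘(ℝ, F) (g ∘ f) x v = mfderiv J 𝓘(ℝ, F) g (f x) (mfderiv J' J f x v)
  rw [h]
  rfl

theorem HasFDerivAt.mvfderiv_comp {Φ : F → F'} {Φ' : F →L[ℝ] F'} {f : M → F} {x : M}
    (hΦ : HasFDerivAt Φ Φ' (f x)) (hf : MDifferentiableAt J 𝓘(ℝ, F) f x) (v : TangentSpace J x) :
    mvfderiv J (fun y => Φ (f y)) x v = Φ' (mvfderiv J f x v) := by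
  have h := (hΦ.hasMFDerivAt.comp x hf.hasMFDerivAt).mfderiv
  change mfderiv J 𝓘(ℝ, F') (Φ ∘ f) x v = Φ' (mfderiv J 𝓘(ℝ, F) f x v)
  rw [h]
  rfl

theorem ContinuousLinearMap.mvfderiv_comp (A : F →L[ℝ] F') {f : M → F} {x : M}
    (hf : MDifferentiableAt J 𝓘(ℝ, F) f x) (v : TangentSpace J x) :
    mvfderiv J (fun y => A (f y)) x v = A (mvfderiv J f x v) :=
  A.hasFDerivAt.mvfderiv_comp hf v

theorem mvfderiv_prodMk {f : M → F} {g : M → F'} {x : M}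
    (hf : MDifferentiableAt J 𝓘(ℝ, F) f x) (hg : MDifferentiableAt J 𝓘(ℝ, F') g x)
    (v : TangentSpace J x) :
    mvfderiv J (fun y => (f y, g y)) x v = (mvfderiv J f x v, mvfderiv J g x v) := by
  have h := hf.prodMk_space hg
  exact Prod.ext ((ContinuousLinearMap.fst ℝ F F').mvfderiv_comp h v).symm
    ((ContinuousLinearMap.snd ℝ F F').mvfderiv_comp h v).symm

theorem ContinuousLinearMap.mvfderiv_bilin (B : F →L[ℝ] F' →L[ℝ] F'') {f : M → F} {g : M → F'}
    {x : M} (hf : MDifferentiableAt J 𝓘(ℝ, F) f x) (hg : MDifferentiableAt J 𝓘(ℝ, F') g x)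
    (v : TangentSpace J x) :
    mvfderiv J (fun y => B (f y) (g y)) x v =
      B (mvfderiv J f x v) (g x) + B (f x) (mvfderiv J g x v) := by
  have h := (B.hasFDerivAt_of_bilinear (hasFDerivAt_fst (𝕜 := ℝ) (p := (f x, g x)))
    hasFDerivAt_snd).mvfderiv_comp (f := fun y => (f y, g y)) (hf.prodMk_space hg) v
  rw [mvfderiv_prodMk hf hg] at h
  rw [h]
  simp [add_comm]

theorem ContMDiff.mdiffAt {f : M → F} (hf : ContMDiff J 𝓘(ℝ, F) ∞ f) (x : M) :
    MDifferentiableAt J 𝓘(ℝ, F) f x :=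
  (hf x).mdifferentiableAt (by simp)

theorem ContDiff.comp_contMDiff_fun {Φ : F → F'} (hΦ : ContDiff ℝ ∞ Φ) {f : M → F}
    (hf : ContMDiff J 𝓘(ℝ, F) ∞ f) : ContMDiff J 𝓘(ℝ, F') ∞ fun x => Φ (f x) :=
  hΦ.contMDiff.comp hf

theorem ContinuousLinearMap.contMDiff_bilin (B : F →L[ℝ] F' →L[ℝ] F'') {f : M → F} {g : M → F'}
    (hf : ContMDiff J 𝓘(ℝ, F) ∞ f) (hg : ContMDiff J 𝓘(ℝ, F') ∞ g) :
    ContMDiff J 𝓘(ℝ, F'') ∞ fun x => B (f x) (g x) :=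
  B.isBoundedBilinearMap.contDiff.contMDiff.comp (hf.prodMk_space hg)

variable [IsManifold J ∞ M]

theorem ContMDiff.mvfderiv_field {f : M → F} (hf : ContMDiff J 𝓘(ℝ, F) ∞ f)
    {X : Π x : M, TangentSpace J x} (hX : IsSmoothField X) :
    ContMDiff J 𝓘(ℝ, F) ∞ fun x => mvfderiv J f x (X x) := by
  have : IsManifold J 1 M := IsManifold.of_le (n := ∞) (by simp)
  have h1 : ContMDiff J.tangent 𝓘(ℝ, F).tangent ∞ (tangentMap J 𝓘(ℝ, F) f) :=
    hf.contMDiff_tangentMap (by simp)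
  exact (contMDiff_snd_tangentBundle_modelSpace F 𝓘(ℝ, F)).comp (h1.comp hX)

/-- The axioms of a covariant derivative concern fields differentiable only at one point, so the
smooth version does not suffice to construct a connection. -/
theorem ContMDiff.mdifferentiableAt_mvfderiv {f : M → F} (hf : ContMDiff J 𝓘(ℝ, F) ∞ f)
    {X : Π x : M, TangentSpace J x} {x : M}
    (hX : MDifferentiableAt J J.tangent (fun x => (⟨x, X x⟩ : TangentBundle J M)) x) :
    MDifferentiableAt J 𝓘(ℝ, F) (fun x => mvfderiv J f x (X x)) x := by
  have : IsManifold J 1 M := IsManifold.of_le (n := ∞) (by simp)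
  have h1 : ContMDiff J.tangent 𝓘(ℝ, F).tangent 1 (tangentMap J 𝓘(ℝ, F) f) :=
    hf.contMDiff_tangentMap (WithTop.coe_le_coe.2 (le_top : (2 : ℕ∞) ≤ ⊤))
  exact ((contMDiff_snd_tangentBundle_modelSpace (n := 1) F 𝓘(ℝ, F) _).mdifferentiableAt
    (by simp)).comp x ((h1 _).mdifferentiableAt (by simp) |>.comp x hX)

theorem IsSmoothField.mdiffAt {X : Π x : M, TangentSpace J x} (hX : IsSmoothField X) (x : M) :
    MDifferentiableAt J J.tangent (fun x => (⟨x, X x⟩ : TangentBundle J M)) x :=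
  (hX x).mdifferentiableAt (by simp)

theorem IsSmoothField.mlieBracket_smooth [CompleteSpace E] {X Y : Π x : M, TangentSpace J x}
    (hX : IsSmoothField X) (hY : IsSmoothField Y) :
    IsSmoothField (VectorField.mlieBracket J X Y) := by
  have : IsManifold J (((⊤ : ℕ∞) : ℕ∞ω) + 1) M := ‹IsManifold J ∞ M›
  have : IsManifold J (minSmoothness ℝ 2) M := IsManifold.of_le (n := ∞) (by
    simpa using (WithTop.coe_le_coe.2 (le_top : (2 : ℕ∞) ≤ ⊤)))
  have : IsManifold J (minSmoothness ℝ 3) M := IsManifold.of_le (n := ∞) (by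
    simpa using (WithTop.coe_le_coe.2 (le_top : (3 : ℕ∞) ≤ ⊤)))
  exact ContDiff.mlieBracket_vectorField (m := ⊤) (n := ⊤) hX hY (by simp)

/-- The Lie bracket of vector fields is the commutator of derivations. -/
theorem mvfderiv_mlieBracket_real [CompleteSpace E] {X Y Z : Π x : M, TangentSpace J x}
    (hX : IsSmoothField X) (hY : IsSmoothField Y) (hZ : IsSmoothField Z) {x : M} (hZx : Z x ≠ 0)
    {f : M → ℝ} (hf : ContMDiff J 𝓘(ℝ, ℝ) ∞ f) :
    mvfderiv J f x (VectorField.mlieBracket J X Y x) =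
      mvfderiv J (fun y => mvfderiv J f y (Y y)) x (X x) -
        mvfderiv J (fun y => mvfderiv J f y (X y)) x (Y x) := by
  have hM3 : IsManifold J (minSmoothness ℝ 3) M := IsManifold.of_le (n := ∞) (by
    simpa using (WithTop.coe_le_coe.2 (le_top : (3 : ℕ∞) ≤ ⊤)))
  have h2 : minSmoothness ℝ 2 ≤ ∞ := by
    simpa using (WithTop.coe_le_coe.2 (le_top : (2 : ℕ∞) ≤ ⊤))
  have hM2 : IsManifold J (minSmoothness ℝ 2) M := IsManifold.of_le (n := ∞) h2
  have hM1 : IsManifold J 1 M := IsManifold.of_le (n := ∞) (by simp)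
  have hb : ∀ {V W : Π x : M, TangentSpace J x}, IsSmoothField V → IsSmoothField W →
      IsSmoothField (VectorField.mlieBracket J V W) := fun hV hW =>
    hV.mlieBracket_smooth hW
  have e : ∀ {V : Π x : M, TangentSpace J x}, IsSmoothField V →
      VectorField.mlieBracket J V (f • Z) = (fun y => mvfderiv J f y (V y)) • Z +
        f • VectorField.mlieBracket J V Z := by
    intro V hV
    ext y
    exact VectorField.mlieBracket_smul_right (hf.mdiffAt y) (hZ.mdiffAt y)
  have hfZ : IsSmoothField (f • Z) := hf.smul_section hZ
  have hs : ∀ {V : Π x : M, TangentSpace J x}, IsSmoothField V → ContMDiffAt J J.tangent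
    (minSmoothness ℝ 2) (fun x => (⟨x, V x⟩ : TangentBundle J M)) x := fun hV =>
    (hV x).of_le h2
  -- The Jacobi identity for X, Y, fZ, minus f times the one for X, Y, Z, leaves the commutator
  -- formula for f as the coefficient of Z x. This is why a field with Z x ≠ 0 is needed.
  have key := VectorField.leibniz_identity_mlieBracket_apply (hs hX) (hs hY) (hs hfZ)
  have key0 := VectorField.leibniz_identity_mlieBracket_apply (hs hX) (hs hY) (hs hZ)
  have ex : ∀ {V W : Π x : M, TangentSpace J x}, IsSmoothField V → IsSmoothField W →
      VectorField.mlieBracket J V (VectorField.mlieBracket J W (f • Z)) x =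
        (mvfderiv J (fun y => mvfderiv J f y (W y)) x (V x) • Z x +
          mvfderiv J f x (W x) • VectorField.mlieBracket J V Z x) +
        (mvfderiv J f x (V x) • VectorField.mlieBracket J W Z x +
          f x • VectorField.mlieBracket J V (VectorField.mlieBracket J W Z) x) := by
    intro V W hV hW
    have h1 := (hf.mvfderiv_field hW).smul_section hZ
    have h2 := hf.smul_section (hb hW hZ)
    rw [e hW, VectorField.mlieBracket_add_right (IsSmoothField.mdiffAt h1 x)
      (IsSmoothField.mdiffAt h2 x),
      VectorField.mlieBracket_smul_right ((hf.mvfderiv_field hW).mdiffAt x) (hZ.mdiffAt x),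
      VectorField.mlieBracket_smul_right (hf.mdiffAt x) ((hb hW hZ).mdiffAt x)]
  rw [ex hX hY, ex hY hX, congrFun (e (hb hX hY)) x, key0] at key
  simp only [Pi.add_apply, Pi.smul_apply', smul_add] at key
  have : (mvfderiv J f x (VectorField.mlieBracket J X Y x) -
      (mvfderiv J (fun y => mvfderiv J f y (Y y)) x (X x) -
        mvfderiv J (fun y => mvfderiv J f y (X y)) x (Y x))) • Z x = 0 := by
    rw [sub_smul, sub_smul]
    rw [← sub_eq_zero] at key
    rw [← neg_eq_zero, ← key]
    abel
  exact sub_eq_zero.mp ((smul_eq_zero.mp this).resolve_right hZx)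

end Calculus

/-! ### The left-invariant frame of `SU(1,1)` -/

theorem SU11.entry_mul (Z W : SU11) (i j : Fin 2) : (Z * W).entry i j =
    Z.entry i 0 * W.entry 0 j + Z.entry i 1 * W.entry 1 j := by
  simp [SU11.entry, Matrix.mul_apply, Fin.sum_univ_two]

theorem SU11.entry_one (i j : Fin 2) :
    (1 : SU11).entry i j = (1 : Matrix (Fin 2) (Fin 2) ℂ) i j := rfl

theorem SU11.ext_entry {Z W : SU11} (h : ∀ i j, Z.entry i j = W.entry i j) : Z = W :=
  SU11.ext' (h 0 0) (h 0 1)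

/-! ### One-parameter groups and the dual frame -/

open scoped Matrix.Norms.Operator in
theorem su11.hasDerivAt_exp (X : su11) (s : ℝ) :
    HasDerivAt (fun s : ℝ => NormedSpace.exp (s • (X : Matrix (Fin 2) (Fin 2) ℂ)))
      (NormedSpace.exp (s • (X : Matrix (Fin 2) (Fin 2) ℂ)) * (X : Matrix (Fin 2) (Fin 2) ℂ)) s :=
  hasDerivAt_exp_smul_const _ s

open scoped Matrix.Norms.Operator in
theorem su11.hasDerivAt_exp_entry (X : su11) (s : ℝ) (i j : Fin 2) :
    HasDerivAt (fun s : ℝ => (su11.exp (s • X)).entry i j)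
      (∑ k, (su11.exp (s • X)).entry i k * (X : Matrix (Fin 2) (Fin 2) ℂ) k j) s := by
  have h := hasDerivAt_pi.1 (hasDerivAt_pi.1 (su11.hasDerivAt_exp X s) i) j
  rw [Matrix.mul_apply] at h
  exact h

theorem su11.exp_zero : su11.exp 0 = 1 := by
  apply Subtype.ext
  apply Subtype.ext
  exact NormedSpace.exp_zero

theorem su11.hasDerivAt_exp_entry_zero (X : su11) (i j : Fin 2) :
    HasDerivAt (fun s : ℝ => (su11.exp (s • X)).entry i j)
      ((X : Matrix (Fin 2) (Fin 2) ℂ) i j) 0 := by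
  have h := su11.hasDerivAt_exp_entry X 0 i j
  rw [zero_smul, su11.exp_zero] at h
  simpa [SU11.entry_one, Matrix.one_apply] using h

open scoped Matrix.Norms.Operator in
theorem su11.contMDiff_exp_smul (X : su11) :
    ContMDiff 𝓘(ℝ, ℝ) 𝓘(ℝ, ℂ × ℝ) ∞ fun s : ℝ => su11.exp (s • X) := by
  have h : ContDiff ℝ ∞ fun s : ℝ =>
      NormedSpace.exp (s • (X : Matrix (Fin 2) (Fin 2) ℂ)) := by
    have h1 : ContDiff ℝ ∞ (NormedSpace.exp : Matrix (Fin 2) (Fin 2) ℂ → _) :=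
      contDiff_iff_contDiffAt.2 fun x => (NormedSpace.exp_analytic (𝕂 := ℝ) x).contDiffAt
    exact h1.comp (contDiff_id.smul contDiff_const)
  have h2 : ∀ i j, ContDiff ℝ ∞ fun s : ℝ => (su11.exp (s • X)).entry i j := fun i j =>
    (LinearMap.toContinuousLinearMap (Matrix.entryLinearMap ℝ ℂ i j)).contDiff.comp h
  exact SU11.contMDiff_of_entry _ (h2 0 0).contMDiff (h2 0 1).contMDiff

theorem SU11.contMDiff_mul_fun {E' H' M' : Type*} [NormedAddCommGroup E']
    [NormedSpace ℝ E'] [TopologicalSpace H'] {I' : ModelWithCorners ℝ E' H'}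
    [TopologicalSpace M'] [ChartedSpace H' M'] {f g : M' → SU11}
    (hf : ContMDiff I' 𝓘(ℝ, ℂ × ℝ) ∞ f) (hg : ContMDiff I' 𝓘(ℝ, ℂ × ℝ) ∞ g) :
    ContMDiff I' 𝓘(ℝ, ℂ × ℝ) ∞ fun x => f x * g x :=
  ((contMDiff_mul 𝓘(ℝ, ℂ × ℝ) ω (G := SU11)).of_le le_top).comp (hf.prodMk hg)

theorem SU11.mvfderiv_entry_curve {γ : ℝ → SU11} (hγ : ContMDiff 𝓘(ℝ, ℝ) 𝓘(ℝ, ℂ × ℝ) ∞ γ)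
    {Z : SU11} (hZ : γ 0 = Z) {i j : Fin 2} {d : ℂ}
    (hd : HasDerivAt (fun s => (γ s).entry i j) d 0) :
    mvfderiv 𝓘(ℝ, ℂ × ℝ) (fun W : SU11 => W.entry i j) Z
      (mfderiv 𝓘(ℝ, ℝ) 𝓘(ℝ, ℂ × ℝ) γ (0 : ℝ) (1 : ℝ)) = d := by
  subst hZ
  have h := mvfderiv_comp_mfderiv (J' := 𝓘(ℝ, ℝ))
    ((SU11.contMDiff_entry (n := ∞) i j).mdiffAt (γ 0)) ((hγ 0).mdifferentiableAt (by simp)) (1 : ℝ)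
  refine h.symm.trans ?_
  change mfderiv 𝓘(ℝ, ℝ) 𝓘(ℝ, ℂ) (fun s => (γ s).entry i j) 0 (1 : ℝ) = d
  rw [mfderiv_eq_fderiv]
  exact (fderiv_apply_one_eq_deriv (𝕜 := ℝ) (F := ℂ)).trans hd.deriv

theorem SU11.contMDiff_exp_curve (X : su11) (Z : SU11) :
    ContMDiff 𝓘(ℝ, ℝ) 𝓘(ℝ, ℂ × ℝ) ∞ fun s : ℝ => Z * su11.exp (s • X) :=
  SU11.contMDiff_mul_fun contMDiff_const (su11.contMDiff_exp_smul X)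

theorem SU11.mvfderiv_entry_frame (a : Fin 3) (Z : SU11) (i j : Fin 2) :
    mvfderiv 𝓘(ℝ, ℂ × ℝ) (fun W : SU11 => W.entry i j) Z (frame a Z) =
      ∑ k, Z.entry i k * (pauli a : Matrix (Fin 2) (Fin 2) ℂ) k j := by
  refine SU11.mvfderiv_entry_curve (SU11.contMDiff_exp_curve (pauli a) Z)
    (by simp [su11.exp_zero]) ?_
  simp only [SU11.entry_mul, Fin.sum_univ_two]
  exact ((su11.hasDerivAt_exp_entry_zero (pauli a) 0 j).const_mul _).add
    ((su11.hasDerivAt_exp_entry_zero (pauli a) 1 j).const_mul _)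

theorem SU11.inv_entry_mul_entry (Z : SU11) (i j : Fin 2) :
    ∑ k, (Z⁻¹).entry i k * Z.entry k j = (1 : Matrix (Fin 2) (Fin 2) ℂ) i j := by
  rw [Fin.sum_univ_two, ← SU11.entry_mul, inv_mul_cancel, SU11.entry_one]

/-- If `d Z (u) = Z B` then `B` is the value of the Maurer-Cartan form on `u`. -/
theorem maurerCartan_eq {Z : SU11} {u : TangentSpace 𝓘(ℝ, ℂ × ℝ) Z} {B : Fin 2 → Fin 2 → ℂ}
    (h : ∀ i j, mvfderiv 𝓘(ℝ, ℂ × ℝ) (fun W : SU11 => W.entry i j) Z u =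
      ∑ k, Z.entry i k * B k j) (i j : Fin 2) : maurerCartan i j Z u = B i j := by
  have h0 := Z.inv_entry_mul_entry i 0
  have h1 := Z.inv_entry_mul_entry i 1
  have hB : B i j = (1 : Matrix (Fin 2) (Fin 2) ℂ) i 0 * B 0 j +
      (1 : Matrix (Fin 2) (Fin 2) ℂ) i 1 * B 1 j := by
    obtain rfl | rfl : i = 0 ∨ i = 1 := by omega
    all_goals simp
  have hm : maurerCartan i j Z u = ∑ k, (Z⁻¹).entry i k *
      mvfderiv 𝓘(ℝ, ℂ × ℝ) (fun W : SU11 => W.entry k j) Z u := by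
    simp [maurerCartan]
  -- The form is Z⁻¹ dZ(u) = Z⁻¹ Z B, and Z⁻¹ Z = 1 entry by entry.
  rw [hm]
  simp only [Fin.sum_univ_two, h] at *
  rw [hB, ← h0, ← h1]
  ring

theorem maurerCartan_frame (a : Fin 3) (Z : SU11) (i j : Fin 2) :
    maurerCartan i j Z (frame a Z) = (pauli a : Matrix (Fin 2) (Fin 2) ℂ) i j :=
  maurerCartan_eq (B := (pauli a : Matrix (Fin 2) (Fin 2) ℂ)) (SU11.mvfderiv_entry_frame a Z) i j

theorem coframe_frame (a b : Fin 3) (Z : SU11) :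
    coframe a Z (frame b Z) = if a = b then 1 else 0 := by
  fin_cases a <;> fin_cases b <;> simp [coframe, maurerCartan_frame, pauli]

/-- The components of a tangent vector in the left-invariant frame. -/
def frameCoordL (Z : SU11) : TangentSpace 𝓘(ℝ, ℂ × ℝ) Z →ₗ[ℝ] (Fin 3 → ℝ) :=
  LinearMap.pi fun a => (coframe a Z).toLinearMap

theorem frameCoordL_sum (Z : SU11) (v : Fin 3 → ℝ) :
    frameCoordL Z (∑ a, v a • frame a Z) = v := by
  ext b
  simp only [frameCoordL, LinearMap.pi_apply, ContinuousLinearMap.coe_coe, map_sum, map_smul,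
    coframe_frame]
  simp

/-- Duality of frame and coframe gives surjectivity; both spaces have real dimension 3, so
injectivity follows. -/
theorem frameCoordL_bijective (Z : SU11) : Function.Bijective (frameCoordL Z) := by
  have hs : Function.Surjective (frameCoordL Z) := fun v => ⟨_, frameCoordL_sum Z v⟩
  refine ⟨?_, hs⟩
  have : Module.finrank ℝ (TangentSpace 𝓘(ℝ, ℂ × ℝ) Z) = Module.finrank ℝ (Fin 3 → ℝ) := by
    change Module.finrank ℝ (ℂ × ℝ) = _
    simp
  have : FiniteDimensional ℝ (TangentSpace 𝓘(ℝ, ℂ × ℝ) Z) :=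
    inferInstanceAs (FiniteDimensional ℝ (ℂ × ℝ))
  exact (LinearMap.injective_iff_surjective_of_finrank_eq_finrank ‹_›).2 hs

/-- The left-invariant trivialization of the tangent bundle. -/
def frameCoord (Z : SU11) : TangentSpace 𝓘(ℝ, ℂ × ℝ) Z ≃ₗ[ℝ] (Fin 3 → ℝ) :=
  LinearEquiv.ofBijective (frameCoordL Z) (frameCoordL_bijective Z)

@[simp]
theorem frameCoord_apply (Z : SU11) (u : TangentSpace 𝓘(ℝ, ℂ × ℝ) Z) (a : Fin 3) :
    frameCoord Z u a = coframe a Z u := rfl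

theorem frameCoord_symm_apply (Z : SU11) (v : Fin 3 → ℝ) :
    (frameCoord Z).symm v = ∑ a, v a • frame a Z := by
  rw [LinearEquiv.symm_apply_eq]
  exact (frameCoordL_sum Z v).symm

theorem frameCoord_frame (a : Fin 3) (Z : SU11) : frameCoord Z (frame a Z) = Pi.single a 1 := by
  ext b
  rw [frameCoord_apply, coframe_frame, Pi.single_apply]

theorem SU11.tangentBundle_ext {Z W : SU11} {u v : ℂ × ℝ} (h : Z = W) (huv : u = v) :
    (⟨Z, u⟩ : TangentBundle 𝓘(ℝ, ℂ × ℝ) SU11) = ⟨W, v⟩ := by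
  rw [h, huv]

/-- The field is the tangent map of the smooth map (Z, s) ↦ Z exp(sX) evaluated on the smooth
section (0 at Z, ∂/∂s at 0). -/
theorem frame_contMDiff (a : Fin 3) : IsSmoothField (frame a) := by
  have hF : ContMDiff (𝓘(ℝ, ℂ × ℝ).prod 𝓘(ℝ, ℝ)) 𝓘(ℝ, ℂ × ℝ) ∞
      fun p : SU11 × ℝ => p.1 * su11.exp (p.2 • pauli a) :=
    SU11.contMDiff_mul_fun contMDiff_fst ((su11.contMDiff_exp_smul (pauli a)).comp contMDiff_snd)
  let F₁ : SU11 → TangentBundle 𝓘(ℝ, ℂ × ℝ) SU11 × TangentBundle 𝓘(ℝ, ℝ) ℝ :=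
    fun Z => (⟨Z, 0⟩, ⟨0, (1 : ℝ)⟩)
  have S₁ : ContMDiff 𝓘(ℝ, ℂ × ℝ) (𝓘(ℝ, ℂ × ℝ).tangent.prod 𝓘(ℝ, ℝ).tangent) ∞ F₁ :=
    (Bundle.contMDiff_zeroSection _ _).prodMk contMDiff_const
  have S₃ := hF.contMDiff_tangentMap (m := ∞) (by simp)
  have S := (S₃.comp (contMDiff_equivTangentBundleProd_symm (n := ∞))).comp S₁
  refine S.congr fun Z => ?_
  have hZ : Z = Z * su11.exp ((0 : ℝ) • pauli a) := by simp [su11.exp_zero]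
  have hd := mfderiv_prod_eq_add_apply (v := ((0 : ℂ × ℝ), (1 : ℝ)))
    (hF.mdifferentiableAt (by simp) (x := (Z, (0 : ℝ))))
  refine SU11.tangentBundle_ext hZ (Eq.trans ?_ hd.symm)
  refine (zero_add (frame a Z : ℂ × ℝ)).symm.trans ?_
  exact congrArg₂ (fun u v : ℂ × ℝ => u + v) (map_zero (mfderiv 𝓘(ℝ, ℂ × ℝ) 𝓘(ℝ, ℂ × ℝ)
    (fun W : SU11 => W * su11.exp ((0 : ℝ) • pauli a)) Z)).symm rfl

/-! ### Coordinates on `su(1,1)` -/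

/-- The isomorphism `ℝ³ → su(1,1)`, `v ↦ v₀ X₀ + v₁ X₁ + v₂ X₂`. -/
def pauliL : (Fin 3 → ℝ) →ₗ[ℝ] su11 := Fintype.linearCombination ℝ pauli

theorem pauliL_apply (v : Fin 3 → ℝ) : pauliL v = ∑ a, v a • pauli a := rfl

theorem pauliL_single (a : Fin 3) : pauliL (Pi.single a 1) = pauli a := by
  rw [pauliL_apply, Fintype.sum_eq_single a]
  · simp
  · intro b hb
    simp [hb]

theorem pauliL_coe (v : Fin 3 → ℝ) : (pauliL v : Matrix (Fin 2) (Fin 2) ℂ) =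
    !![v 0 * I, v 1 + v 2 * I; v 1 - v 2 * I, -(v 0 * I)] := by
  ext i j
  fin_cases i <;> fin_cases j <;>
    simp [pauliL_apply, Fin.sum_univ_three, pauli, sub_eq_add_neg]

/-- The Lie bracket of `su(1,1)` in the basis `X₀, X₁, X₂`. -/
def pauliBracket : (Fin 3 → ℝ) →L[ℝ] (Fin 3 → ℝ) →L[ℝ] (Fin 3 → ℝ) :=
  LinearMap.toContinuousBilinearMap (LinearMap.mk₂ ℝ
    (fun u v => ![-2 * (u 1 * v 2 - u 2 * v 1), 2 * (u 2 * v 0 - u 0 * v 2),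
      2 * (u 0 * v 1 - u 1 * v 0)])
    (by intros; ext a; fin_cases a <;> simp <;> ring)
    (by intros; ext a; fin_cases a <;> simp <;> ring)
    (by intros; ext a; fin_cases a <;> simp <;> ring)
    (by intros; ext a; fin_cases a <;> simp <;> ring))

theorem pauliBracket_apply (u v : Fin 3 → ℝ) : pauliBracket u v =
    ![-2 * (u 1 * v 2 - u 2 * v 1), 2 * (u 2 * v 0 - u 0 * v 2),
      2 * (u 0 * v 1 - u 1 * v 0)] := rfl

theorem pauliL_lie (u v : Fin 3 → ℝ) : ⁅pauliL u, pauliL v⁆ = pauliL (pauliBracket u v) := by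
  apply Subtype.ext
  rw [LieSubalgebra.coe_bracket, Ring.lie_def, pauliL_coe, pauliL_coe, pauliL_coe,
    pauliBracket_apply]
  ext i j
  fin_cases i <;> fin_cases j <;> simp <;>
    ring_nf <;> simp only [Complex.I_sq] <;> ring

theorem pauliL_bijective : Function.Bijective pauliL := by
  constructor
  · rw [injective_iff_map_eq_zero]
    intro v hv
    have h : (pauliL v : Matrix (Fin 2) (Fin 2) ℂ) = 0 := by rw [hv]; rfl
    rw [pauliL_coe] at h
    have h0 := congrFun (congrFun h 0) 0
    have h1 := congrFun (congrFun h 0) 1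
    simp [Complex.ext_iff] at h0 h1
    ext a
    fin_cases a
    exacts [h0, h1.1, h1.2]
  · rintro ⟨B, hB, htr⟩
    -- The first row carries all the information: J-antihermiticity makes B₀₀ imaginary and B₁₀
    -- conjugate to B₀₁, and the trace condition gives B₁₁.
    refine ⟨![(B 0 0).im, (B 0 1).re, (B 0 1).im], Subtype.ext ?_⟩
    rw [pauliL_coe]
    have e00 := congrFun (congrFun hB 0) 0
    have e01 := congrFun (congrFun hB 0) 1
    rw [Matrix.trace_fin_two] at htr
    simp [sigJ, Matrix.mul_apply, Fin.sum_univ_two, Matrix.conjTranspose_apply,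
      Matrix.vecMul, dotProduct, Complex.ext_iff] at e00 e01 htr
    ext i j
    fin_cases i <;> fin_cases j <;> simp [Complex.ext_iff]
    · linarith
    all_goals constructor <;> linarith

/-- `pauliL` as a linear equivalence. -/
def pauliEquiv : (Fin 3 → ℝ) ≃ₗ[ℝ] su11 := LinearEquiv.ofBijective pauliL pauliL_bijective

/-- The matrix entries of `pauliL`. -/
def pauliEntry (i j : Fin 2) : (Fin 3 → ℝ) →L[ℝ] ℂ :=
  LinearMap.toContinuousLinearMap ((Matrix.entryLinearMap ℝ ℂ i j).comp
    (su11.toSubmodule.subtype.comp pauliL))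

theorem pauliEntry_apply (i j : Fin 2) (v : Fin 3 → ℝ) :
    pauliEntry i j v = (pauliL v : Matrix (Fin 2) (Fin 2) ℂ) i j := rfl

/-! ### Vector fields in the left-invariant frame -/

theorem SU11.mvfderiv_entry (Z : SU11) (u : TangentSpace 𝓘(ℝ, ℂ × ℝ) Z) (i j : Fin 2) :
    mvfderiv 𝓘(ℝ, ℂ × ℝ) (fun W : SU11 => W.entry i j) Z u =
      ∑ k, Z.entry i k * pauliEntry k j (frameCoord Z u) := by
  obtain ⟨v, rfl⟩ := (frameCoord Z).symm.surjective u
  rw [LinearEquiv.apply_symm_apply, frameCoord_symm_apply, map_sum]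
  have h : ∀ k, pauliEntry k j v = ∑ a, v a • (pauli a : Matrix (Fin 2) (Fin 2) ℂ) k j := by
    intro k
    simp [pauliEntry_apply, pauliL_apply, Fin.sum_univ_three]
  simp only [map_smul, SU11.mvfderiv_entry_frame, h, Fin.sum_univ_two, Fin.sum_univ_three,
    Complex.real_smul]
  ring

/-- A tangent vector is recovered from the derivatives of the matrix entries as Z⁻¹ dZ. Brackets,
differentials of the action and generated fields are all computed through this criterion, without
the chart. -/
theorem frameCoord_eq_of_mvfderiv_entry {Z : SU11} {u : TangentSpace 𝓘(ℝ, ℂ × ℝ) Z}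
    {v : Fin 3 → ℝ}
    (h : ∀ i j, mvfderiv 𝓘(ℝ, ℂ × ℝ) (fun W : SU11 => W.entry i j) Z u =
      ∑ k, Z.entry i k * pauliEntry k j v) : frameCoord Z u = v := by
  have e := maurerCartan_eq (B := fun i j => pauliEntry i j v) h
  ext a
  fin_cases a <;> simp [coframe, e, pauliEntry_apply, pauliL_coe]

/-- The components of a vector field in the left-invariant frame. -/
def frameComp (X : Π Z : SU11, TangentSpace 𝓘(ℝ, ℂ × ℝ) Z) (Z : SU11) : Fin 3 → ℝ :=
  frameCoord Z (X Z)

theorem SU11.contMDiff_inv_entry (i j : Fin 2) :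
    ContMDiff 𝓘(ℝ, ℂ × ℝ) 𝓘(ℝ, ℂ) ∞ fun Z : SU11 => (Z⁻¹).entry i j :=
  (SU11.contMDiff_entry i j).comp ((contMDiff_inv 𝓘(ℝ, ℂ × ℝ) ω).of_le le_top)

theorem maurerCartan_apply (i j : Fin 2) (Z : SU11) (u : TangentSpace 𝓘(ℝ, ℂ × ℝ) Z) :
    maurerCartan i j Z u = ∑ k, (Z⁻¹).entry i k *
      mvfderiv 𝓘(ℝ, ℂ × ℝ) (fun W : SU11 => W.entry k j) Z u := by
  simp [maurerCartan]

/-- The components are real or imaginary parts of entries of Z⁻¹ dZ(X). Smoothness of X is not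
presupposed, which allows the criterion to establish it for generated fields. -/
theorem contMDiff_frameComp_of_mvfderiv_entry {X : Π Z : SU11, TangentSpace 𝓘(ℝ, ℂ × ℝ) Z}
    (h : ∀ i j, ContMDiff 𝓘(ℝ, ℂ × ℝ) 𝓘(ℝ, ℂ) ∞
      fun Z => mvfderiv 𝓘(ℝ, ℂ × ℝ) (fun W : SU11 => W.entry i j) Z (X Z)) :
    ContMDiff 𝓘(ℝ, ℂ × ℝ) 𝓘(ℝ, Fin 3 → ℝ) ∞ (frameComp X) := by
  have hm : ∀ i j, ContMDiff 𝓘(ℝ, ℂ × ℝ) 𝓘(ℝ, ℂ) ∞ fun Z => maurerCartan i j Z (X Z) := by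
    intro i j
    simp only [maurerCartan_apply]
    exact contMDiff_finsetSum fun k _ =>
      (ContinuousLinearMap.mul ℝ ℂ).contMDiff_bilin (SU11.contMDiff_inv_entry i k) (h k j)
  refine contMDiff_pi_space.2 fun a => ?_
  fin_cases a
  · exact Complex.imCLM.contDiff.comp_contMDiff_fun (hm 0 0)
  · exact Complex.reCLM.contDiff.comp_contMDiff_fun (hm 0 1)
  · exact Complex.imCLM.contDiff.comp_contMDiff_fun (hm 0 1)

theorem IsSmoothField.contMDiff_frameComp {X : Π Z : SU11, TangentSpace 𝓘(ℝ, ℂ × ℝ) Z}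
    (hX : IsSmoothField X) : ContMDiff 𝓘(ℝ, ℂ × ℝ) 𝓘(ℝ, Fin 3 → ℝ) ∞ (frameComp X) :=
  contMDiff_frameComp_of_mvfderiv_entry fun i j => (SU11.contMDiff_entry i j).mvfderiv_field hX

theorem IsSmoothField.contMDiff_coframe {X : Π Z : SU11, TangentSpace 𝓘(ℝ, ℂ × ℝ) Z}
    (hX : IsSmoothField X) (a : Fin 3) :
    ContMDiff 𝓘(ℝ, ℂ × ℝ) 𝓘(ℝ, ℝ) ∞ fun Z => coframe a Z (X Z) :=
  contMDiff_pi_space.1 hX.contMDiff_frameComp a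

/-- Pointwise counterpart of `IsSmoothField.contMDiff_frameComp`, used for the additivity and
Leibniz axioms of `symbolConnection`. -/
theorem mdifferentiableAt_frameComp {X : Π Z : SU11, TangentSpace 𝓘(ℝ, ℂ × ℝ) Z} {Z : SU11}
    (hX : MDifferentiableAt 𝓘(ℝ, ℂ × ℝ) 𝓘(ℝ, ℂ × ℝ).tangent
      (fun x => (⟨x, X x⟩ : TangentBundle 𝓘(ℝ, ℂ × ℝ) SU11)) Z) :
    MDifferentiableAt 𝓘(ℝ, ℂ × ℝ) 𝓘(ℝ, Fin 3 → ℝ) (frameComp X) Z := by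
  have h : ∀ i j, MDifferentiableAt 𝓘(ℝ, ℂ × ℝ) 𝓘(ℝ, ℂ)
      (fun Z => maurerCartan i j Z (X Z)) Z := by
    intro i j
    simp only [maurerCartan_apply, Fin.sum_univ_two]
    exact (((SU11.contMDiff_inv_entry i 0).mdiffAt Z).mul
      ((SU11.contMDiff_entry 0 j).mdifferentiableAt_mvfderiv hX)).add
      (((SU11.contMDiff_inv_entry i 1).mdiffAt Z).mul
      ((SU11.contMDiff_entry 1 j).mdifferentiableAt_mvfderiv hX))
  have hs : ∀ A : ℂ →L[ℝ] ℝ, ∀ i j, MDifferentiableAt 𝓘(ℝ, ℂ × ℝ) 𝓘(ℝ, ℝ)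
      (fun Z => A (maurerCartan i j Z (X Z))) Z := fun A i j =>
    A.differentiableAt.mdifferentiableAt.comp Z (h i j)
  let T : ℝ × ℝ × ℝ →L[ℝ] (Fin 3 → ℝ) := ContinuousLinearMap.pi
    ![.fst ℝ ℝ (ℝ × ℝ), .comp (.fst ℝ ℝ ℝ) (.snd ℝ ℝ (ℝ × ℝ)),
      .comp (.snd ℝ ℝ ℝ) (.snd ℝ ℝ (ℝ × ℝ))]
  have hT := T.differentiableAt.mdifferentiableAt.comp Z ((hs Complex.imCLM 0 0).prodMk_space
    ((hs Complex.reCLM 0 1).prodMk_space (hs Complex.imCLM 0 1)))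
  refine hT.congr_of_eventuallyEq (Filter.Eventually.of_forall fun W => ?_)
  ext a
  fin_cases a <;> rfl

theorem isSmoothField_of_frameComp {X : Π Z : SU11, TangentSpace 𝓘(ℝ, ℂ × ℝ) Z}
    (h : ContMDiff 𝓘(ℝ, ℂ × ℝ) 𝓘(ℝ, Fin 3 → ℝ) ∞ (frameComp X)) : IsSmoothField X := by
  have h1 : IsSmoothField fun Z : SU11 => ∑ a, frameComp X Z a • frame a Z :=
    ContMDiff.sum_section fun a _ => (contMDiff_pi_space.1 h a).smul_section (frame_contMDiff a)
  refine h1.congr fun Z => ?_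
  beta_reduce
  rw [← frameCoord_symm_apply, frameComp, LinearEquiv.symm_apply_apply]

/-- The scalar case extends to vector values by testing with continuous functionals. The
nonvanishing auxiliary field required there is X₀. -/
theorem mvfderiv_mlieBracket {F : Type*} [NormedAddCommGroup F] [NormedSpace ℝ F]
    {X Y : Π Z : SU11, TangentSpace 𝓘(ℝ, ℂ × ℝ) Z}
    (hX : IsSmoothField X) (hY : IsSmoothField Y) {f : SU11 → F}
    (hf : ContMDiff 𝓘(ℝ, ℂ × ℝ) 𝓘(ℝ, F) ∞ f) (Z : SU11) :
    mvfderiv 𝓘(ℝ, ℂ × ℝ) f Z (VectorField.mlieBracket 𝓘(ℝ, ℂ × ℝ) X Y Z) =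
      mvfderiv 𝓘(ℝ, ℂ × ℝ) (fun W => mvfderiv 𝓘(ℝ, ℂ × ℝ) f W (Y W)) Z (X Z) -
        mvfderiv 𝓘(ℝ, ℂ × ℝ) (fun W => mvfderiv 𝓘(ℝ, ℂ × ℝ) f W (X W)) Z (Y Z) := by
  have h0 : frame 0 Z ≠ 0 := by
    intro h
    have := coframe_frame 0 0 Z
    rw [h] at this
    simp at this
  refine (SeparatingDual.eq_iff_forall_dual_eq (R := ℝ)).2 fun l => ?_
  have key := mvfderiv_mlieBracket_real hX hY (frame_contMDiff 0) h0
    (l.contDiff.comp_contMDiff_fun hf)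
  have e : ∀ (W : SU11) u, mvfderiv 𝓘(ℝ, ℂ × ℝ) (fun W => l (f W)) W u =
      l (mvfderiv 𝓘(ℝ, ℂ × ℝ) f W u) := fun W u => l.mvfderiv_comp (hf.mdiffAt W) u
  simp only [e] at key
  rw [l.mvfderiv_comp ((hf.mvfderiv_field hY).mdiffAt Z),
    l.mvfderiv_comp ((hf.mvfderiv_field hX).mdiffAt Z)] at key
  rw [key, map_sub]

/-- The Lie bracket of vector fields in the left-invariant frame. -/
theorem frameCoord_mlieBracket {X Y : Π Z : SU11, TangentSpace 𝓘(ℝ, ℂ × ℝ) Z}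
    (hX : IsSmoothField X) (hY : IsSmoothField Y) (Z : SU11) :
    frameCoord Z (VectorField.mlieBracket 𝓘(ℝ, ℂ × ℝ) X Y Z) =
      mvfderiv 𝓘(ℝ, ℂ × ℝ) (frameComp Y) Z (X Z) - mvfderiv 𝓘(ℝ, ℂ × ℝ) (frameComp X) Z (Y Z) +
        pauliBracket (frameComp X Z) (frameComp Y Z) := by
  refine frameCoord_eq_of_mvfderiv_entry fun i j => ?_
  -- Since dZ(W) = Z w, differentiating along V gives Z v w + Z dw(V). Antisymmetrizing yields
  -- Z([v,w] + dw(V) - dv(W)).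
  have e : ∀ {V W : Π Z : SU11, TangentSpace 𝓘(ℝ, ℂ × ℝ) Z}, IsSmoothField V → IsSmoothField W →
      mvfderiv 𝓘(ℝ, ℂ × ℝ) (fun A => mvfderiv 𝓘(ℝ, ℂ × ℝ) (fun B : SU11 => B.entry i j) A (W A))
        Z (V Z) = ∑ k, ((∑ l, Z.entry i l * pauliEntry l k (frameComp V Z)) *
          pauliEntry k j (frameComp W Z) +
          Z.entry i k * pauliEntry k j (mvfderiv 𝓘(ℝ, ℂ × ℝ) (frameComp W) Z (V Z))) := by
    intro V W hV hW
    simp only [SU11.mvfderiv_entry]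
    change mvfderiv 𝓘(ℝ, ℂ × ℝ) (fun A => ∑ k, A.entry i k * pauliEntry k j (frameComp W A))
        Z (V Z) = _
    have hw := hW.contMDiff_frameComp
    have hk : ∀ k, ContMDiff 𝓘(ℝ, ℂ × ℝ) 𝓘(ℝ, ℂ) ∞ fun A => pauliEntry k j (frameComp W A) :=
      fun k => (pauliEntry k j).contDiff.comp_contMDiff_fun hw
    have hp : ∀ k, MDifferentiableAt 𝓘(ℝ, ℂ × ℝ) 𝓘(ℝ, ℂ)
      (fun A : SU11 => A.entry i k * pauliEntry k j (frameComp W A)) Z := fun k =>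
        ((SU11.contMDiff_entry i k).mdiffAt Z).mul ((hk k).mdiffAt Z)
    have hd : ∀ k, mvfderiv 𝓘(ℝ, ℂ × ℝ)
        (fun A : SU11 => A.entry i k * pauliEntry k j (frameComp W A)) Z (V Z) =
        (∑ l, Z.entry i l * pauliEntry l k (frameComp V Z)) * pauliEntry k j (frameComp W Z) +
          Z.entry i k * pauliEntry k j (mvfderiv 𝓘(ℝ, ℂ × ℝ) (frameComp W) Z (V Z)) := by
      intro k
      have h := (ContinuousLinearMap.mul ℝ ℂ).mvfderiv_bilin
        ((SU11.contMDiff_entry i k).mdiffAt Z) ((hk k).mdiffAt Z) (V Z)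
      rw [(pauliEntry k j).mvfderiv_comp (hw.mdiffAt Z), SU11.mvfderiv_entry] at h
      exact h
    simp only [Fin.sum_univ_two] at hd ⊢
    rw [← hd 0, ← hd 1]
    exact DFunLike.congr_fun (mvfderiv_add (hp 0) (hp 1)) (V Z)
  rw [mvfderiv_mlieBracket hX hY (SU11.contMDiff_entry i j), e hX hY, e hY hX]
  have hl : ∀ l, pauliEntry l j (pauliBracket (frameComp X Z) (frameComp Y Z)) =
      ∑ k, (pauliEntry l k (frameComp X Z) * pauliEntry k j (frameComp Y Z) -
        pauliEntry l k (frameComp Y Z) * pauliEntry k j (frameComp X Z)) := by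
    intro l
    rw [pauliEntry_apply, ← pauliL_lie, LieSubalgebra.coe_bracket, Ring.lie_def,
      Finset.sum_sub_distrib]
    simp [Matrix.mul_apply, pauliEntry_apply]
  simp only [map_add, map_sub, hl, Fin.sum_univ_two]
  ring

/-! ### Left-invariant connections -/

/-- Vector fields on `SU(1,1)`. -/
abbrev SU11.Field : Type := Π Z : SU11, TangentSpace 𝓘(ℝ, ℂ × ℝ) Z

/-- Affine connections on `SU(1,1)`. -/
abbrev SU11.Connection : Type :=
  CovariantDerivative 𝓘(ℝ, ℂ × ℝ) (ℂ × ℝ) (TangentSpace 𝓘(ℝ, ℂ × ℝ) : SU11 → Type _)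

/-- The left-invariant vector field with the given components. -/
def leftField (v : Fin 3 → ℝ) : SU11.Field := fun Z => (frameCoord Z).symm v

theorem frameComp_leftField (v : Fin 3 → ℝ) : frameComp (leftField v) = fun _ => v :=
  funext fun Z => (frameCoord Z).apply_symm_apply v

theorem isSmoothField_leftField (v : Fin 3 → ℝ) : IsSmoothField (leftField v) :=
  isSmoothField_of_frameComp (by rw [frameComp_leftField]; exact contMDiff_const)

theorem leftField_frameCoord (Z : SU11) (u : TangentSpace 𝓘(ℝ, ℂ × ℝ) Z) :
    leftField (frameCoord Z u) Z = u := (frameCoord Z).symm_apply_apply u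

/-- The tangent vector with the given components, as a continuous linear map. -/
def frameVec (Z : SU11) : (Fin 3 → ℝ) →L[ℝ] TangentSpace 𝓘(ℝ, ℂ × ℝ) Z :=
  ∑ a, (ContinuousLinearMap.proj (R := ℝ) (φ := fun _ : Fin 3 => ℝ) a).smulRight (frame a Z)

theorem frameCoord_frameVec (Z : SU11) (v : Fin 3 → ℝ) : frameCoord Z (frameVec Z v) = v := by
  have h : frameVec Z v = (frameCoord Z).symm v := by
    rw [frameCoord_symm_apply]
    simp [frameVec]
  rw [h, LinearEquiv.apply_symm_apply]

/-- The components of a tangent vector, as a continuous linear map. -/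
def frameCoordCLM (Z : SU11) : TangentSpace 𝓘(ℝ, ℂ × ℝ) Z →L[ℝ] (Fin 3 → ℝ) :=
  ContinuousLinearMap.pi fun a => coframe a Z

/-- The connection `D` has constant Christoffel symbols `Γ` in the left-invariant frame. -/
def HasSymbol (D : SU11.Connection) (Γ : (Fin 3 → ℝ) →L[ℝ] (Fin 3 → ℝ) →L[ℝ] (Fin 3 → ℝ)) : Prop :=
  ∀ Y : SU11.Field, IsSmoothField Y → ∀ (Z : SU11) (u : TangentSpace 𝓘(ℝ, ℂ × ℝ) Z),
    frameCoord Z (D Y Z u) =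
      mvfderiv 𝓘(ℝ, ℂ × ℝ) (frameComp Y) Z u + Γ (frameCoord Z u) (frameComp Y Z)

/-- The connection with constant Christoffel symbols `Γ` in the left-invariant frame. -/
def symbolConnection (Γ : (Fin 3 → ℝ) →L[ℝ] (Fin 3 → ℝ) →L[ℝ] (Fin 3 → ℝ)) : SU11.Connection where
  toFun Y Z := (frameVec Z).comp (mvfderiv 𝓘(ℝ, ℂ × ℝ) (frameComp Y) Z +
    (Γ.flip (frameComp Y Z)).comp (frameCoordCLM Z))
  isCovariantDerivativeOnUniv :=
    { add := by
        intro X Y Z hX hY _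
        have e : frameComp (X + Y) = frameComp X + frameComp Y :=
          funext fun Z => map_add (frameCoord Z) _ _
        rw [e, mvfderiv_add (mdifferentiableAt_frameComp hX) (mdifferentiableAt_frameComp hY)]
        ext1 u
        simp only [ContinuousLinearMap.comp_apply, add_apply, Pi.add_apply, map_add]
        abel
      leibniz := by
        intro X f Z hX hf _
        have e : frameComp (f • X) = f • frameComp X :=
          funext fun Z => map_smul (frameCoord Z) _ _
        rw [e, mvfderiv_smul hf (mdifferentiableAt_frameComp hX)]
        ext1 u
        apply (frameCoord Z).injective
        simp only [ContinuousLinearMap.comp_apply, add_apply, smul_apply, Pi.smul_apply', map_add,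
          map_smul, frameCoord_frameVec, ContinuousLinearMap.smulRight_apply, smul_add]
        change _ + (mvfderiv 𝓘(ℝ, ℂ × ℝ) f Z u • frameComp X Z) + _ = _ + _ +
          mvfderiv 𝓘(ℝ, ℂ × ℝ) f Z u • frameComp X Z
        abel }

theorem hasSymbol_symbolConnection (Γ : (Fin 3 → ℝ) →L[ℝ] (Fin 3 → ℝ) →L[ℝ] (Fin 3 → ℝ)) :
    HasSymbol (symbolConnection Γ) Γ := fun _ _ Z _ => frameCoord_frameVec Z _

variable {D : SU11.Connection} {Γ : (Fin 3 → ℝ) →L[ℝ] (Fin 3 → ℝ) →L[ℝ] (Fin 3 → ℝ)}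

theorem HasSymbol.frameComp_eq (h : HasSymbol D Γ) {X Y : SU11.Field} (hY : IsSmoothField Y) :
    frameComp (fun Z => D Y Z (X Z)) = fun Z =>
      mvfderiv 𝓘(ℝ, ℂ × ℝ) (frameComp Y) Z (X Z) + Γ (frameComp X Z) (frameComp Y Z) :=
  funext fun Z => h Y hY Z (X Z)

theorem HasSymbol.isSmoothField (h : HasSymbol D Γ) {X Y : SU11.Field} (hX : IsSmoothField X)
    (hY : IsSmoothField Y) : IsSmoothField fun Z => D Y Z (X Z) := by
  apply isSmoothField_of_frameComp
  rw [h.frameComp_eq hY]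
  exact (hY.contMDiff_frameComp.mvfderiv_field hX).add
    (Γ.contMDiff_bilin hX.contMDiff_frameComp hY.contMDiff_frameComp)

/-- The curvature of a left-invariant connection with Christoffel symbols `Γ`. -/
def symbolCurvature (Γ : (Fin 3 → ℝ) →L[ℝ] (Fin 3 → ℝ) →L[ℝ] (Fin 3 → ℝ)) (u v w : Fin 3 → ℝ) :
    Fin 3 → ℝ :=
  Γ u (Γ v w) - Γ v (Γ u w) - Γ (pauliBracket u v) w

/-- The second derivatives of W, and the terms with derivatives of X and Y, cancel against the
derivative part of [X,Y]. Only the algebraic part of that bracket, `pauliBracket`, survives. -/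
theorem HasSymbol.frameCoord_curvatureField (h : HasSymbol D Γ) {X Y W : SU11.Field}
    (hX : IsSmoothField X) (hY : IsSmoothField Y) (hW : IsSmoothField W) (Z : SU11) :
    frameCoord Z (curvatureField D X Y W Z) =
      symbolCurvature Γ (frameComp X Z) (frameComp Y Z) (frameComp W Z) := by
  have e : ∀ {U V : SU11.Field}, IsSmoothField U → IsSmoothField V →
      frameCoord Z (D (fun A => D W A (V A)) Z (U Z)) =
        mvfderiv 𝓘(ℝ, ℂ × ℝ) (fun A => mvfderiv 𝓘(ℝ, ℂ × ℝ) (frameComp W) A (V A)) Z (U Z) +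
        (Γ (mvfderiv 𝓘(ℝ, ℂ × ℝ) (frameComp V) Z (U Z)) (frameComp W Z) +
          Γ (frameComp V Z) (mvfderiv 𝓘(ℝ, ℂ × ℝ) (frameComp W) Z (U Z))) +
        Γ (frameComp U Z) (mvfderiv 𝓘(ℝ, ℂ × ℝ) (frameComp W) Z (V Z) +
          Γ (frameComp V Z) (frameComp W Z)) := by
    intro U V hU hV
    have hw := hW.contMDiff_frameComp
    have hv := hV.contMDiff_frameComp
    rw [h _ (h.isSmoothField hV hW), h.frameComp_eq hW]
    have h1 := DFunLike.congr_fun (mvfderiv_add ((hw.mvfderiv_field hV).mdiffAt Z)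
      ((Γ.contMDiff_bilin hv hw).mdiffAt Z)) (U Z)
    refine congrArg₂ (· + ·) (h1.trans ?_) rfl
    exact congrArg₂ (· + ·) rfl (Γ.mvfderiv_bilin (hv.mdiffAt Z) (hw.mdiffAt Z) (U Z))
  rw [curvatureField, map_sub, map_sub, e hX hY, e hY hX, h W hW, frameCoord_mlieBracket hX hY,
    mvfderiv_mlieBracket hX hY hW.contMDiff_frameComp, symbolCurvature]
  simp only [map_add, map_sub, add_apply, sub_apply]
  abel

/-- The product rule for a trilinear map with constant coefficients; the derivative terms in ∇̃R = 0
are handled by it. -/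
theorem mvfderiv_symbolCurvature (Γ : (Fin 3 → ℝ) →L[ℝ] (Fin 3 → ℝ) →L[ℝ] (Fin 3 → ℝ))
    {x y w : SU11 → Fin 3 → ℝ} (hx : ContMDiff 𝓘(ℝ, ℂ × ℝ) 𝓘(ℝ, Fin 3 → ℝ) ∞ x)
    (hy : ContMDiff 𝓘(ℝ, ℂ × ℝ) 𝓘(ℝ, Fin 3 → ℝ) ∞ y)
    (hw : ContMDiff 𝓘(ℝ, ℂ × ℝ) 𝓘(ℝ, Fin 3 → ℝ) ∞ w) (Z : SU11)
    (u : TangentSpace 𝓘(ℝ, ℂ × ℝ) Z) :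
    mvfderiv 𝓘(ℝ, ℂ × ℝ) (fun A => symbolCurvature Γ (x A) (y A) (w A)) Z u =
      symbolCurvature Γ (mvfderiv 𝓘(ℝ, ℂ × ℝ) x Z u) (y Z) (w Z) +
      symbolCurvature Γ (x Z) (mvfderiv 𝓘(ℝ, ℂ × ℝ) y Z u) (w Z) +
      symbolCurvature Γ (x Z) (y Z) (mvfderiv 𝓘(ℝ, ℂ × ℝ) w Z u) := by
  have h1 := Γ.contMDiff_bilin hx (Γ.contMDiff_bilin hy hw)
  have h2 := Γ.contMDiff_bilin hy (Γ.contMDiff_bilin hx hw)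
  have h3 := Γ.contMDiff_bilin (pauliBracket.contMDiff_bilin hx hy) hw
  have e1 := DFunLike.congr_fun (mvfderiv_sub ((h1.sub h2).mdiffAt Z) (h3.mdiffAt Z)) u
  have e2 := DFunLike.congr_fun (mvfderiv_sub (h1.mdiffAt Z) (h2.mdiffAt Z)) u
  refine e1.trans ?_
  refine (congrArg (fun a : Fin 3 → ℝ => a - mvfderiv 𝓘(ℝ, ℂ × ℝ)
    (fun A => Γ (pauliBracket (x A) (y A)) (w A)) Z u) e2).trans ?_
  beta_reduce
  rw [sub_apply,
    Γ.mvfderiv_bilin (hx.mdiffAt Z) ((Γ.contMDiff_bilin hy hw).mdiffAt Z),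
    Γ.mvfderiv_bilin (hy.mdiffAt Z) ((Γ.contMDiff_bilin hx hw).mdiffAt Z),
    Γ.mvfderiv_bilin ((pauliBracket.contMDiff_bilin hx hy).mdiffAt Z) (hw.mdiffAt Z),
    Γ.mvfderiv_bilin (hx.mdiffAt Z) (hw.mdiffAt Z),
    Γ.mvfderiv_bilin (hy.mdiffAt Z) (hw.mdiffAt Z),
    pauliBracket.mvfderiv_bilin (hx.mdiffAt Z) (hy.mdiffAt Z)]
  simp only [symbolCurvature, map_add, add_apply]
  abel

theorem HasSymbol.canonicalConnection {s : (Fin 3 → ℝ) →L[ℝ] (Fin 3 → ℝ) →L[ℝ] (Fin 3 → ℝ)}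
    (h : HasSymbol D Γ) {S : Π Z : SU11, TangentSpace 𝓘(ℝ, ℂ × ℝ) Z →L[ℝ]
      TangentSpace 𝓘(ℝ, ℂ × ℝ) Z →L[ℝ] TangentSpace 𝓘(ℝ, ℂ × ℝ) Z}
    (hS : ∀ Z u v, frameCoord Z (S Z u v) = s (frameCoord Z u) (frameCoord Z v)) :
    HasSymbol (_root_.canonicalConnection D S) (Γ - s) := by
  intro Y hY Z u
  have e : _root_.canonicalConnection D S Y Z u = D Y Z u + -(S Z u (Y Z)) := rfl
  rw [e, map_add, map_neg, hS, h Y hY]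
  simp only [sub_apply, frameComp]
  abel

/-- Agreement is only asked along smooth X; an arbitrary u at Z is reached by its left-invariant
extension. -/
theorem HasSymbol.apply_eq {D' : SU11.Connection} (h : HasSymbol D Γ)
    (h' : ∀ X Y : SU11.Field, IsSmoothField X → IsSmoothField Y → ∀ Z,
      D' Y Z (X Z) = D Y Z (X Z)) : HasSymbol D' Γ := by
  intro Y hY Z u
  have e := h' _ Y (isSmoothField_leftField (frameCoord Z u)) hY Z
  rw [leftField_frameCoord] at e
  rw [e, h Y hY]

/-- The torsion is a tensor, so left-invariant fields suffice, and their components have zero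
derivative. -/
theorem HasSymbol.torsion_eq_zero (h : HasSymbol D Γ)
    (hΓ : ∀ u v, Γ u v - Γ v u = pauliBracket u v) : D.torsion = 0 := by
  ext Z u v
  have hu := isSmoothField_leftField (frameCoord Z u)
  have hv := isSmoothField_leftField (frameCoord Z v)
  have e := D.torsion_apply (hu.mdiffAt Z) (hv.mdiffAt Z)
  rw [leftField_frameCoord, leftField_frameCoord] at e
  rw [e]
  apply (frameCoord Z).injective
  rw [map_sub, map_sub, h _ hu, h _ hv, frameCoord_mlieBracket hu hv, leftField_frameCoord,
    leftField_frameCoord, ← hΓ]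
  simp only [frameComp, leftField_frameCoord]
  refine Eq.trans ?_ (map_zero (frameCoord Z)).symm
  abel

/-! ### Left-invariant metrics -/

section Metric

variable {g : Π Z : SU11, TangentSpace 𝓘(ℝ, ℂ × ℝ) Z →L[ℝ] TangentSpace 𝓘(ℝ, ℂ × ℝ) Z →L[ℝ] ℝ}
  {G : (Fin 3 → ℝ) →L[ℝ] (Fin 3 → ℝ) →L[ℝ] ℝ}

/-- The product rule for the constant form `G` accounts for the derivatives of the components, so
what remains is skewness of each Γ u. -/
theorem HasSymbol.parallelMetric (h : HasSymbol D Γ)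
    (hg : ∀ Z u v, g Z u v = G (frameCoord Z u) (frameCoord Z v))
    (hG : ∀ u v w, G (Γ u v) w + G v (Γ u w) = 0) : ParallelMetric D g := by
  intro W X Y _ hX hY Z
  simp only [hg]
  rw [h X hX, h Y hY]
  change _ = G _ (frameComp Y Z) + G (frameComp X Z) _
  have e := G.mvfderiv_bilin (hX.contMDiff_frameComp.mdiffAt Z) (hY.contMDiff_frameComp.mdiffAt Z)
    (W Z)
  refine e.trans ?_
  have e2 := hG (frameCoord Z (W Z)) (frameComp X Z) (frameComp Y Z)
  simp only [map_add, add_apply]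
  linear_combination -e2

/-- Two metric torsion-free connections agree. -/
theorem IsLeviCivita.eq_on_smooth {D' : SU11.Connection} (hg : IsPseudoRiemannianMetric g)
    (h : IsLeviCivita g D) (h' : IsLeviCivita g D') {X Y : SU11.Field} (hX : IsSmoothField X)
    (hY : IsSmoothField Y) (Z : SU11) : D' Y Z (X Z) = D Y Z (X Z) := by
  -- T is the difference of the two connections lowered by g. Metricity makes it skew in the last
  -- two arguments, absence of torsion makes it symmetric in the first two, and such a T vanishes.
  let T : SU11.Field → SU11.Field → SU11.Field → ℝ := fun U V W =>
    g Z (D' V Z (U Z)) (W Z) - g Z (D V Z (U Z)) (W Z)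
  have h1 : ∀ U V W : SU11.Field, IsSmoothField U → IsSmoothField V → IsSmoothField W →
      T U V W = -T U W V := by
    intro U V W hU hV hW
    have a := h.1 U V W hU hV hW Z
    have b := h'.1 U V W hU hV hW Z
    rw [hg.symm Z (V Z)] at a b
    simp only [T]
    linarith
  have h2 : ∀ U V W : SU11.Field, IsSmoothField U → IsSmoothField V → IsSmoothField W →
      T U V W = T V U W := by
    intro U V W hU hV hW
    have a := CovariantDerivative.torsion_eq_zero_iff D |>.1 h.2 (hU.mdiffAt Z) (hV.mdiffAt Z)
    have b := CovariantDerivative.torsion_eq_zero_iff D' |>.1 h'.2 (hU.mdiffAt Z) (hV.mdiffAt Z)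
    have c := congrArg (fun u => g Z u (W Z)) (a.trans b.symm)
    simp only [map_sub, sub_apply] at c
    simp only [T]
    linarith
  refine sub_eq_zero.mp (hg.nondegenerate Z _ fun v => ?_)
  have hW := isSmoothField_leftField (frameCoord Z v)
  have h0 : T X Y (leftField (frameCoord Z v)) = 0 := by
    -- Alternating the two symmetries six times returns to the same arguments with the opposite
    -- sign.
    have a1 := h1 X Y _ hX hY hW
    have a2 := h2 X _ Y hX hW hY
    have a3 := h1 _ X Y hW hX hY
    have a4 := h2 _ Y X hW hY hX
    have a5 := h1 Y _ X hY hW hX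
    have a6 := h2 Y X _ hY hX hW
    linarith
  rw [map_sub, sub_apply, ← leftField_frameCoord Z v]
  exact h0

end Metric

/-! ### The metric and its tensors in the left-invariant frame -/

/-- The bilinear form `-μ u₀v₀ + μ u₁v₁ + μ u₂v₂`. -/
def metricForm (mu : ℝ) : (Fin 3 → ℝ) →L[ℝ] (Fin 3 → ℝ) →L[ℝ] ℝ :=
  LinearMap.toContinuousBilinearMap (LinearMap.mk₂ ℝ
    (fun u v => mu * (-(u 0 * v 0) + u 1 * v 1 + u 2 * v 2))
    (by intros; simp; ring) (by intros; simp; ring) (by intros; simp; ring) (by intros; simp; ring))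

theorem metricForm_apply (mu : ℝ) (u v : Fin 3 → ℝ) :
    metricForm mu u v = mu * (-(u 0 * v 0) + u 1 * v 1 + u 2 * v 2) := rfl

/-- The paracontact endomorphism `X₀ ↦ -X₂`, `X₁ ↦ 0`, `X₂ ↦ -X₀`. -/
def paraForm : (Fin 3 → ℝ) →L[ℝ] (Fin 3 → ℝ) :=
  LinearMap.toContinuousLinearMap
    { toFun := fun v => ![-v 2, 0, -v 0]
      map_add' := by intros; ext a; fin_cases a <;> simp <;> ring
      map_smul' := by intros; ext a; fin_cases a <;> simp }

theorem paraForm_apply (v : Fin 3 → ℝ) : paraForm v = ![-v 2, 0, -v 0] := rfl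

/-- The homogeneous structure `S` with parameter `r = t/μ`. -/
def structForm (r : ℝ) : (Fin 3 → ℝ) →L[ℝ] (Fin 3 → ℝ) →L[ℝ] (Fin 3 → ℝ) :=
  LinearMap.toContinuousBilinearMap (LinearMap.mk₂ ℝ
    (fun u v => ![u 2 * v 1 - r * (u 1 * v 2), u 2 * v 0 - u 0 * v 2,
      u 0 * v 1 - r * (u 1 * v 0)])
    (by intros; ext a; fin_cases a <;> simp <;> ring)
    (by intros; ext a; fin_cases a <;> simp <;> ring)
    (by intros; ext a; fin_cases a <;> simp <;> ring)
    (by intros; ext a; fin_cases a <;> simp <;> ring))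

theorem structForm_apply (r : ℝ) (u v : Fin 3 → ℝ) : structForm r u v =
    ![u 2 * v 1 - r * (u 1 * v 2), u 2 * v 0 - u 0 * v 2, u 0 * v 1 - r * (u 1 * v 0)] := rfl

/-- The Christoffel symbols `c θ¹ ⊗ φ` of the canonical connection. -/
def canonForm (c : ℝ) : (Fin 3 → ℝ) →L[ℝ] (Fin 3 → ℝ) →L[ℝ] (Fin 3 → ℝ) :=
  (c • ContinuousLinearMap.proj (R := ℝ) (φ := fun _ : Fin 3 => ℝ) 1).smulRight paraForm

theorem canonForm_apply (c : ℝ) (u v : Fin 3 → ℝ) :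
    canonForm c u v = ![-(c * u 1 * v 2), 0, -(c * u 1 * v 0)] := by
  ext a
  fin_cases a <;> simp [canonForm, paraForm_apply]

/-- The pivot of the proof: S cancels the parts of ½[u,v] coming from u₀ and u₂ and scales the part
from u₁ by t/μ. What remains is (1-r)u₁φ(v), since ½ ad X₁ = φ. -/
theorem half_pauliBracket_sub_structForm (r : ℝ) :
    (1 / 2 : ℝ) • pauliBracket - structForm r = canonForm (1 - r) := by
  ext1 u
  ext1 v
  rw [canonForm_apply]
  ext a
  fin_cases a <;> simp [pauliBracket_apply, structForm_apply] <;> ring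

theorem canonForm_one_apply (u : Fin 3 → ℝ) (c : ℝ) (v : Fin 3 → ℝ) :
    canonForm c u v = (c * u 1) • paraForm v := rfl

theorem kkMetric_apply (mu : ℝ) (Z : SU11) (u v : TangentSpace 𝓘(ℝ, ℂ × ℝ) Z) :
    kkMetric (-mu) mu mu Z u v = metricForm mu (frameCoord Z u) (frameCoord Z v) := by
  simp only [kkMetric, Fin.sum_univ_three, add_apply, smul_apply,
    ContinuousLinearMap.smulRight_apply, metricForm_apply, frameCoord_apply]
  simp
  ring

theorem frameCoord_sharp (lam mu nu : ℝ) (a : Fin 3) (Z : SU11) :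
    frameCoord Z (sharp lam mu nu a Z) = Pi.single a (![lam, mu, nu] a)⁻¹ := by
  rw [sharp, map_smul, frameCoord_frame, ← Pi.single_smul, smul_eq_mul, mul_one]

theorem frameCoord_raisedTensor (lam mu nu : ℝ) (a b c : Fin 3) (Z : SU11)
    (u v : TangentSpace 𝓘(ℝ, ℂ × ℝ) Z) : frameCoord Z (raisedTensor lam mu nu a b c Z u v) =
      frameCoord Z u a • (frameCoord Z v b • Pi.single c (![lam, mu, nu] c)⁻¹ -
        frameCoord Z v c • Pi.single b (![lam, mu, nu] b)⁻¹) := by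
  rw [← frameCoord_sharp lam mu nu b Z, ← frameCoord_sharp lam mu nu c Z, ← map_smul, ← map_smul,
    ← map_sub, ← map_smul]
  rfl

theorem frameCoord_sMu {mu : ℝ} (hmu : mu ≠ 0) (t : ℝ) (Z : SU11)
    (u v : TangentSpace 𝓘(ℝ, ℂ × ℝ) Z) : frameCoord Z (sMu (-mu) mu mu t Z u v) =
      structForm (t / mu) (frameCoord Z u) (frameCoord Z v) := by
  have e : sMu (-mu) mu mu t Z u v = mu • raisedTensor (-mu) mu mu 2 0 1 Z u v +
      mu • raisedTensor (-mu) mu mu 0 1 2 Z u v + t • raisedTensor (-mu) mu mu 1 2 0 Z u v := rfl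
  rw [e, map_add, map_add, map_smul, map_smul, map_smul, frameCoord_raisedTensor,
    frameCoord_raisedTensor, frameCoord_raisedTensor]
  generalize frameCoord Z u = x
  generalize frameCoord Z v = y
  ext a
  fin_cases a <;> simp [structForm_apply] <;> field_simp <;> ring

theorem frameCoord_unitFrame (mu : ℝ) (a : Fin 3) (Z : SU11) :
    frameCoord Z (unitFrame (-mu) mu mu a Z) =
      Pi.single a (Real.sqrt (![|-mu|, mu, mu] a))⁻¹ := by
  rw [unitFrame, map_smul, frameCoord_frame, ← Pi.single_smul, smul_eq_mul, mul_one]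

theorem frameCoord_xi (mu : ℝ) (Z : SU11) :
    frameCoord Z (unitFrame (-mu) mu mu 1 Z) = Pi.single 1 (Real.sqrt mu)⁻¹ :=
  frameCoord_unitFrame mu 1 Z

theorem eta_apply (mu : ℝ) (Z : SU11) (u : TangentSpace 𝓘(ℝ, ℂ × ℝ) Z) :
    unitCoframe (-mu) mu mu 1 Z u = Real.sqrt mu * frameCoord Z u 1 := rfl

theorem frameCoord_phiOne {mu : ℝ} (hmu : 0 < mu) (Z : SU11) (u : TangentSpace 𝓘(ℝ, ℂ × ℝ) Z) :
    frameCoord Z (phiOne (-mu) mu mu Z u) = paraForm (frameCoord Z u) := by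
  have e : phiOne (-mu) mu mu Z u =
      -((Real.sqrt |-mu| * frameCoord Z u 0) • unitFrame (-mu) mu mu 2 Z) -
        (Real.sqrt mu * frameCoord Z u 2) • unitFrame (-mu) mu mu 0 Z := rfl
  have hs := (Real.sqrt_pos.2 hmu).ne'
  rw [e, map_sub, map_neg, map_smul, map_smul, frameCoord_unitFrame, frameCoord_unitFrame,
    paraForm_apply, abs_neg, abs_of_pos hmu]
  generalize frameCoord Z u = x
  ext a
  fin_cases a <;> simp <;> field_simp

theorem kkMetric_sMu {mu : ℝ} (hmu : mu ≠ 0) (t : ℝ) (Z : SU11)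
    (u v w : TangentSpace 𝓘(ℝ, ℂ × ℝ) Z) :
    kkMetric (-mu) mu mu Z (sMu (-mu) mu mu t Z u v) w = sMuLow mu t Z u v w := by
  rw [kkMetric_apply, frameCoord_sMu hmu, metricForm_apply, structForm_apply]
  simp only [sMuLow, wedge, ← frameCoord_apply]
  simp
  field_simp
  ring

theorem isPseudoRiemannianMetric_kkMetric {mu : ℝ} (hmu : mu ≠ 0) :
    IsPseudoRiemannianMetric (kkMetric (-mu) mu mu) where
  symm Z u v := by
    simp only [kkMetric_apply, metricForm_apply]
    ring
  nondegenerate Z u h := by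
    apply (frameCoord Z).injective
    rw [map_zero]
    have h' : ∀ a, metricForm mu (frameCoord Z u) (Pi.single a 1) = 0 := fun a => by
      have := h (frame a Z)
      rwa [kkMetric_apply, frameCoord_frame] at this
    ext a
    have ha := h' a
    rw [metricForm_apply] at ha
    fin_cases a <;> simpa [hmu] using ha
  smooth X Y hX hY := by
    simp only [kkMetric_apply]
    exact (metricForm mu).contMDiff_bilin hX.contMDiff_frameComp hY.contMDiff_frameComp

theorem hasLorentzianSignature_kkMetric {mu : ℝ} (hmu : 0 < mu) :
    HasLorentzianSignature (kkMetric (-mu) mu mu) := by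
  intro Z
  have hs := (Real.sqrt_pos.2 hmu).ne'
  have hu : IsUnit (Real.sqrt mu)⁻¹ := (isUnit_iff_ne_zero.2 hs).inv
  -- The left-invariant frame divided by √μ is orthonormal, with X₀ in the timelike slot 0.
  refine ⟨2, ((Pi.basisFun ℝ (Fin 3)).map (frameCoord Z).symm).isUnitSMul (fun _ => hu), ?_⟩
  intro i j
  rw [kkMetric_apply, Module.Basis.isUnitSMul_apply, Module.Basis.isUnitSMul_apply, map_smul,
    map_smul, Module.Basis.map_apply, Module.Basis.map_apply, LinearEquiv.apply_symm_apply,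
    smul_apply, map_smul, LinearEquiv.apply_symm_apply, map_smul, Pi.basisFun_apply,
    Pi.basisFun_apply, metricForm_apply, smul_eq_mul, smul_eq_mul, ← mul_assoc, ← mul_inv, Real.mul_self_sqrt hmu.le,
    inv_mul_cancel_left₀ hmu.ne']
  fin_cases i <;> fin_cases j <;> simp

/-! ### The Levi-Civita and the canonical connection -/

/-- The form is ad-invariant, so ½ad u is skew; the antisymmetrization of ½[u,v] is [u,v], so there
is no torsion. -/
theorem isLeviCivita_symbolConnection (mu : ℝ) :
    IsLeviCivita (kkMetric (-mu) mu mu) (symbolConnection ((1 / 2 : ℝ) • pauliBracket)) := by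
  have h := hasSymbol_symbolConnection ((1 / 2 : ℝ) • pauliBracket)
  refine ⟨h.parallelMetric (kkMetric_apply mu) fun u v w => ?_, h.torsion_eq_zero fun u v => ?_⟩
  · simp [metricForm_apply, pauliBracket_apply]
    ring
  · ext a
    fin_cases a <;> simp [pauliBracket_apply] <;> ring

section Connection

variable {mu : ℝ} {D : SU11.Connection}

/-- Uniqueness transfers the explicit symbol to an arbitrary Levi-Civita connection, which is
determined on smooth fields only. -/
theorem IsLeviCivita.hasSymbol (hmu : mu ≠ 0) (hD : IsLeviCivita (kkMetric (-mu) mu mu) D) :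
    HasSymbol D ((1 / 2 : ℝ) • pauliBracket) :=
  (hasSymbol_symbolConnection _).apply_eq fun _ _ hX hY Z =>
    (isLeviCivita_symbolConnection mu).eq_on_smooth (isPseudoRiemannianMetric_kkMetric hmu)
      hD hX hY Z

theorem IsLeviCivita.hasSymbol_canonicalConnection (hmu : mu ≠ 0)
    (hD : IsLeviCivita (kkMetric (-mu) mu mu) D) (t : ℝ) :
    HasSymbol (canonicalConnection D (sMu (-mu) mu mu t)) (canonForm (1 - t / mu)) := by
  rw [← half_pauliBracket_sub_structForm]
  exact (hD.hasSymbol hmu).canonicalConnection (frameCoord_sMu hmu t)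

theorem frameComp_phiOne (hmu : 0 < mu) (X : SU11.Field) :
    frameComp (fun Z => phiOne (-mu) mu mu Z (X Z)) = fun Z => paraForm (frameComp X Z) :=
  funext fun Z => frameCoord_phiOne hmu Z (X Z)

theorem isAlmostParacontactMetric_phiOne (hmu : 0 < mu) :
    IsAlmostParacontactMetric (kkMetric (-mu) mu mu) (phiOne (-mu) mu mu)
      (unitFrame (-mu) mu mu 1) (unitCoframe (-mu) mu mu 1) := by
  have hs := (Real.sqrt_pos.2 hmu).ne'
  constructor
  · intro X hX
    apply isSmoothField_of_frameComp
    rw [frameComp_phiOne hmu]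
    exact paraForm.contDiff.comp_contMDiff_fun hX.contMDiff_frameComp
  · apply isSmoothField_of_frameComp
    have : frameComp (unitFrame (-mu) mu mu 1) = fun _ => Pi.single 1 (Real.sqrt mu)⁻¹ :=
      funext (frameCoord_xi mu)
    rw [this]
    exact contMDiff_const
  · intro X hX
    exact ContDiff.comp_contMDiff_fun (Φ := fun x => Real.sqrt mu * x)
      (contDiff_const.mul contDiff_id) (hX.contMDiff_coframe 1)
  · intro Z u
    apply (frameCoord Z).injective
    rw [frameCoord_phiOne hmu, frameCoord_phiOne hmu, map_sub, map_smul, frameCoord_xi, eta_apply]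
    ext a
    fin_cases a <;> simp [paraForm_apply]
    field_simp
    simp
  · intro Z
    rw [eta_apply, frameCoord_xi]
    simp [hs]
  · intro Z u v
    rw [kkMetric_apply, kkMetric_apply, frameCoord_phiOne hmu, frameCoord_phiOne hmu, eta_apply,
      eta_apply, metricForm_apply, metricForm_apply, mul_mul_mul_comm, Real.mul_self_sqrt hmu.le]
    simp [paraForm_apply]
    ring

/-- As φ = ½ ad X₁ is a derivation, (∇_x φ)y = -½[φx,y] = -¼[[X₁,x],y]. The double-bracket identity
turns this into -(⟨x,y⟩X₁ - y₁x) with ⟨·,·⟩ = g/μ; the unit normalization of ξ and η produces the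
factor -1/√μ. -/
theorem IsLeviCivita.isParaSasakian (hmu : 0 < mu)
    (hD : IsLeviCivita (kkMetric (-mu) mu mu) D) :
    IsParaSasakian (-1 / Real.sqrt mu) (kkMetric (-mu) mu mu) D (phiOne (-mu) mu mu)
      (unitFrame (-mu) mu mu 1) (unitCoframe (-mu) mu mu 1) where
  almostParacontact := isAlmostParacontactMetric_phiOne hmu
  nabla_phi X Y hX hY Z := by
    have h := hD.hasSymbol hmu.ne'
    have hs := (Real.sqrt_pos.2 hmu).ne'
    have hm := Real.sq_sqrt hmu.le
    apply (frameCoord Z).injective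
    rw [map_sub, h _ ((isAlmostParacontactMetric_phiOne hmu).smooth_phi Y hY),
      frameCoord_phiOne hmu, h Y hY, frameComp_phiOne hmu,
      paraForm.mvfderiv_comp (hY.contMDiff_frameComp.mdiffAt Z), map_smul, map_sub, map_smul,
      map_smul, frameCoord_xi, kkMetric_apply, eta_apply, map_add, add_sub_add_left_eq_sub]
    change (1 / 2 : ℝ) • pauliBracket (frameComp X Z) (paraForm (frameComp Y Z)) -
      paraForm ((1 / 2 : ℝ) • pauliBracket (frameComp X Z) (frameComp Y Z)) =
      (-1 / Real.sqrt mu) • (metricForm mu (frameComp X Z) (frameComp Y Z) •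
        Pi.single 1 (Real.sqrt mu)⁻¹ - (Real.sqrt mu * frameComp Y Z 1) • frameComp X Z)
    generalize frameComp X Z = x
    generalize frameComp Y Z = y
    ext a
    fin_cases a <;> simp [pauliBracket_apply, paraForm_apply, metricForm_apply] <;> field_simp
    rw [hm]
    ring

end Connection

/-! ### The homogeneous structure -/

/-- By the Jacobi identity the first two terms give ¼[[u,v],w], and the third contributes
-½[[u,v],w]. -/
theorem symbolCurvature_half_pauliBracket (u v w : Fin 3 → ℝ) :
    symbolCurvature ((1 / 2 : ℝ) • pauliBracket) u v w =
      -(1 / 4 : ℝ) • pauliBracket (pauliBracket u v) w := by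
  ext a
  fin_cases a <;> simp [symbolCurvature, pauliBracket_apply] <;> ring

/-- The endomorphism `canonForm c w` is (c w₁/2) ad X₁, so this is the Jacobi identity. Invariance
of the curvature, a double bracket, follows formally. -/
theorem canonForm_pauliBracket (c : ℝ) (w u v : Fin 3 → ℝ) :
    canonForm c w (pauliBracket u v) =
      pauliBracket (canonForm c w u) v + pauliBracket u (canonForm c w v) := by
  simp only [canonForm_apply]
  ext a
  fin_cases a <;> simp [pauliBracket_apply] <;> ring

theorem canonForm_symbolCurvature (c : ℝ) (z u v w : Fin 3 → ℝ) :
    canonForm c z (symbolCurvature ((1 / 2 : ℝ) • pauliBracket) u v w) =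
      symbolCurvature ((1 / 2 : ℝ) • pauliBracket) (canonForm c z u) v w +
      symbolCurvature ((1 / 2 : ℝ) • pauliBracket) u (canonForm c z v) w +
      symbolCurvature ((1 / 2 : ℝ) • pauliBracket) u v (canonForm c z w) := by
  simp only [symbolCurvature_half_pauliBracket, map_smul, canonForm_pauliBracket, map_add,
    add_apply, smul_add]

/-- S is ½[·,·] minus a multiple of θ¹⊗φ. The derivation φ respects the first term; it respects the
second because it commutes with itself and θ¹∘φ = 0. -/
theorem canonForm_structForm (c r : ℝ) (w u v : Fin 3 → ℝ) :
    canonForm c w (structForm r u v) =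
      structForm r (canonForm c w u) v + structForm r u (canonForm c w v) := by
  simp only [canonForm_apply]
  ext a
  fin_cases a <;> simp [structForm_apply] <;> ring

/-- This is ad-invariance of the metric, applied to ad X₁. -/
theorem metricForm_canonForm (mu c : ℝ) (w u v : Fin 3 → ℝ) :
    metricForm mu (canonForm c w u) v + metricForm mu u (canonForm c w v) = 0 := by
  simp [canonForm_apply, metricForm_apply]
  ring

theorem contMDiff_symbolCurvature
    (Γ : (Fin 3 → ℝ) →L[ℝ] (Fin 3 → ℝ) →L[ℝ] (Fin 3 → ℝ))
    {x y w : SU11 → Fin 3 → ℝ} (hx : ContMDiff 𝓘(ℝ, ℂ × ℝ) 𝓘(ℝ, Fin 3 → ℝ) ∞ x)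
    (hy : ContMDiff 𝓘(ℝ, ℂ × ℝ) 𝓘(ℝ, Fin 3 → ℝ) ∞ y)
    (hw : ContMDiff 𝓘(ℝ, ℂ × ℝ) 𝓘(ℝ, Fin 3 → ℝ) ∞ w) :
    ContMDiff 𝓘(ℝ, ℂ × ℝ) 𝓘(ℝ, Fin 3 → ℝ) ∞
      fun A => symbolCurvature Γ (x A) (y A) (w A) :=
  ((Γ.contMDiff_bilin hx (Γ.contMDiff_bilin hy hw)).sub
    (Γ.contMDiff_bilin hy (Γ.contMDiff_bilin hx hw))).sub
    (Γ.contMDiff_bilin (pauliBracket.contMDiff_bilin hx hy) hw)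

theorem HasSymbol.frameComp_curvatureField {D : SU11.Connection}
    {Γ : (Fin 3 → ℝ) →L[ℝ] (Fin 3 → ℝ) →L[ℝ] (Fin 3 → ℝ)} (h : HasSymbol D Γ)
    {X Y W : SU11.Field} (hX : IsSmoothField X) (hY : IsSmoothField Y) (hW : IsSmoothField W) :
    frameComp (curvatureField D X Y W) =
      fun Z => symbolCurvature Γ (frameComp X Z) (frameComp Y Z) (frameComp W Z) :=
  funext (h.frameCoord_curvatureField hX hY hW)

theorem HasSymbol.isSmoothField_curvatureField {D : SU11.Connection}
    {Γ : (Fin 3 → ℝ) →L[ℝ] (Fin 3 → ℝ) →L[ℝ] (Fin 3 → ℝ)} (h : HasSymbol D Γ)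
    {X Y W : SU11.Field} (hX : IsSmoothField X) (hY : IsSmoothField Y) (hW : IsSmoothField W) :
    IsSmoothField (curvatureField D X Y W) := by
  apply isSmoothField_of_frameComp
  rw [h.frameComp_curvatureField hX hY hW]
  exact contMDiff_symbolCurvature Γ hX.contMDiff_frameComp hY.contMDiff_frameComp
    hW.contMDiff_frameComp

section Homogeneous

variable {mu : ℝ} {D : SU11.Connection}

theorem frameComp_sMu (hmu : mu ≠ 0) (t : ℝ) (X Y : SU11.Field) :
    frameComp (fun Z => sMu (-mu) mu mu t Z (X Z) (Y Z)) =
      fun Z => structForm (t / mu) (frameComp X Z) (frameComp Y Z) :=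
  funext fun Z => frameCoord_sMu hmu t Z (X Z) (Y Z)

theorem IsLeviCivita.isHomogeneousStructure (hmu : mu ≠ 0)
    (hD : IsLeviCivita (kkMetric (-mu) mu mu) D) (t : ℝ) :
    IsHomogeneousStructure (kkMetric (-mu) mu mu) D (sMu (-mu) mu mu t) := by
  have h := hD.hasSymbol hmu
  have hc := hD.hasSymbol_canonicalConnection hmu t
  have hS : ∀ X Y : SU11.Field, IsSmoothField X → IsSmoothField Y →
      IsSmoothField fun Z => sMu (-mu) mu mu t Z (X Z) (Y Z) := by
    intro X Y hX hY
    apply isSmoothField_of_frameComp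
    rw [frameComp_sMu hmu]
    exact (structForm (t / mu)).contMDiff_bilin hX.contMDiff_frameComp hY.contMDiff_frameComp
  refine ⟨hS, hc.parallelMetric (kkMetric_apply mu) (metricForm_canonForm mu _), ?_, ?_⟩
  · intro W X Y V hW hX hY hV Z
    have hX' := hc.isSmoothField hW hX
    have hY' := hc.isSmoothField hW hY
    have hV' := hc.isSmoothField hW hV
    apply (frameCoord Z).injective
    rw [map_add, map_add, hc _ (h.isSmoothField_curvatureField hX hY hV),
      h.frameComp_curvatureField hX hY hV, mvfderiv_symbolCurvature _ hX.contMDiff_frameComp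
      hY.contMDiff_frameComp hV.contMDiff_frameComp, h.frameCoord_curvatureField hX' hY hV,
      h.frameCoord_curvatureField hX hY' hV, h.frameCoord_curvatureField hX hY hV',
      hc.frameComp_eq hX, hc.frameComp_eq hY, hc.frameComp_eq hV, canonForm_symbolCurvature]
    -- Written as a double bracket, the curvature symbol is visibly additive in each slot, so
    -- derivative and algebraic terms separate.
    simp only [symbolCurvature_half_pauliBracket, map_add, add_apply, smul_add]
    simp only [frameComp]
    abel
  · intro W X Y hW hX hY Z
    apply (frameCoord Z).injective
    rw [map_add, hc _ (hS X Y hX hY), frameComp_sMu hmu, frameCoord_sMu hmu, frameCoord_sMu hmu,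
      hc X hX, hc Y hY, (structForm (t / mu)).mvfderiv_bilin (hX.contMDiff_frameComp.mdiffAt Z)
        (hY.contMDiff_frameComp.mdiffAt Z), canonForm_structForm]
    simp only [map_add, add_apply]
    simp only [frameComp]
    abel

/-- For the symbol c θ¹⊗φ, parallelism of φ, ξ and η reduces to three facts: φ commutes with itself,
φX₁ = 0 and θ¹∘φ = 0. -/
theorem IsLeviCivita.isHomogeneousAlmostParacontact (hmu : 0 < mu)
    (hD : IsLeviCivita (kkMetric (-mu) mu mu) D) (t : ℝ) :
    IsHomogeneousAlmostParacontact (kkMetric (-mu) mu mu) D (sMu (-mu) mu mu t)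
      (phiOne (-mu) mu mu) (unitFrame (-mu) mu mu 1) (unitCoframe (-mu) mu mu 1) := by
  have hc := hD.hasSymbol_canonicalConnection hmu.ne' t
  have hA := isAlmostParacontactMetric_phiOne hmu
  refine ⟨hA, hD.isHomogeneousStructure hmu.ne' t, ?_, ?_, ?_⟩
  · intro W X _ hX Z
    apply (frameCoord Z).injective
    rw [hc _ (hA.smooth_phi X hX), frameCoord_phiOne hmu, frameComp_phiOne hmu, hc X hX, map_add,
      paraForm.mvfderiv_comp (hX.contMDiff_frameComp.mdiffAt Z), canonForm_one_apply,
      canonForm_one_apply, map_smul]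
  · intro Z u
    apply (frameCoord Z).injective
    have e : frameComp (unitFrame (-mu) mu mu 1) = fun _ => Pi.single 1 (Real.sqrt mu)⁻¹ :=
      funext (frameCoord_xi mu)
    rw [hc _ hA.smooth_xi, e, mvfderiv_const, canonForm_apply, map_zero]
    ext a
    fin_cases a <;> simp
  · intro W X _ hX Z
    have hx := hX.contMDiff_frameComp
    rw [eta_apply, hc X hX]
    have e := (Real.sqrt mu • ContinuousLinearMap.proj (R := ℝ) (φ := fun _ : Fin 3 => ℝ)
      1).mvfderiv_comp (hx.mdiffAt Z) (W Z)
    refine Eq.trans e ?_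
    simp [canonForm_apply]

/-- The curvature of the canonical connection. -/
theorem symbolCurvature_canonForm (c : ℝ) (u v w : Fin 3 → ℝ) :
    symbolCurvature (canonForm c) u v w = -(pauliBracket u v 1 * c) • paraForm w := by
  -- The endomorphisms Γ u and Γ v are multiples of the same φ and commute, so only -Γ([u,v]) is
  -- left.
  simp only [symbolCurvature, canonForm_apply]
  ext a
  fin_cases a <;> simp [paraForm_apply] <;> ring

end Homogeneous

/-! ### The action of `SU(1,1) × ℝ` -/

theorem boostAction_apply (a : SU11 × Multiplicative ℝ) (Z : SU11) :
    boostAction a Z = a.1 * Z * boost a.2.toAdd := rfl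

theorem leftAction_apply (A Z : SU11) : leftAction A Z = A * Z := rfl

theorem leftAction_eq_boostAction (A : SU11) : leftAction A = boostAction (A, 1) := by
  ext1 Z
  rw [leftAction_apply, boostAction_apply, toAdd_one, boost_zero, mul_one]

theorem boost_entry (s : ℝ) (i j : Fin 2) : (boost s).entry i j =
    (!![(Real.cosh s : ℂ), -(Real.sinh s : ℂ); -(Real.sinh s : ℂ), (Real.cosh s : ℂ)] :
      Matrix (Fin 2) (Fin 2) ℂ) i j := by
  have e : (boost s).entry i j = (!![(Real.cosh s : ℂ), -(Real.sinh s : ℂ);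
    (starRingEnd ℂ) (-(Real.sinh s : ℂ)), (starRingEnd ℂ) (Real.cosh s : ℂ)] :
      Matrix (Fin 2) (Fin 2) ℂ) i j := rfl
  rw [e, map_neg, Complex.conj_ofReal, Complex.conj_ofReal]

theorem boost_neg (s : ℝ) : boost (-s) = (boost s)⁻¹ :=
  eq_inv_of_mul_eq_one_left (by rw [← boost_add, neg_add_cancel, boost_zero])

theorem contMDiff_boost : ContMDiff 𝓘(ℝ, ℝ) 𝓘(ℝ, ℂ × ℝ) ∞ boost := by
  refine SU11.contMDiff_of_entry _ ?_ ?_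
  · simp only [boost_entry]
    exact (Complex.ofRealCLM.contDiff.comp Real.contDiff_cosh).contMDiff
  · simp only [boost_entry]
    exact (Complex.ofRealCLM.contDiff.comp Real.contDiff_sinh).neg.contMDiff

theorem hasDerivAt_boost_entry (s : ℝ) (i j : Fin 2) :
    HasDerivAt (fun s => (boost s).entry i j)
      (-∑ k, (pauli 1 : Matrix (Fin 2) (Fin 2) ℂ) i k * (boost s).entry k j) s := by
  have hc : HasDerivAt (fun s : ℝ => (Real.cosh s : ℂ)) (Real.sinh s : ℂ) s :=
    (Real.hasDerivAt_cosh s).ofReal_comp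
  have hs : HasDerivAt (fun s : ℝ => (Real.sinh s : ℂ)) (Real.cosh s : ℂ) s :=
    (Real.hasDerivAt_sinh s).ofReal_comp
  simp only [boost_entry]
  fin_cases i <;> fin_cases j <;> simp [pauli, Fin.sum_univ_two] <;>
    simp only [← Complex.ofReal_cosh, ← Complex.ofReal_sinh]
  exacts [hc, hs.neg, hs.neg, hc]

/-- The product exp(rX₁) boost(r) has zero derivative, because boost solves b' = -X₁b, and it equals
1 at r = 0. -/
theorem exp_pauli_one (s : ℝ) : su11.exp (s • pauli 1) = boost (-s) := by
  rw [boost_neg]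
  refine eq_inv_of_mul_eq_one_left (SU11.ext_entry fun i j => ?_)
  have hd : ∀ r : ℝ, HasDerivAt (fun r => (su11.exp (r • pauli 1) * boost r).entry i j) 0 r := by
    intro r
    simp only [SU11.entry_mul]
    have h := ((su11.hasDerivAt_exp_entry (pauli 1) r i 0).mul (hasDerivAt_boost_entry r 0 j)).add
      ((su11.hasDerivAt_exp_entry (pauli 1) r i 1).mul (hasDerivAt_boost_entry r 1 j))
    refine h.congr_deriv ?_
    simp [pauli, Fin.sum_univ_two]
  have h := is_const_of_deriv_eq_zero (fun r => (hd r).differentiableAt) (fun r => (hd r).deriv) s 0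
  rw [h, zero_smul, su11.exp_zero, boost_zero, mul_one]

/-- The adjoint action of `boost s` on `su(1,1)`, in coordinates. -/
def boostForm (s : ℝ) : (Fin 3 → ℝ) →L[ℝ] (Fin 3 → ℝ) :=
  LinearMap.toContinuousLinearMap
    { toFun := fun v => ![Real.cosh (2 * s) * v 0 - Real.sinh (2 * s) * v 2, v 1,
        Real.cosh (2 * s) * v 2 - Real.sinh (2 * s) * v 0]
      map_add' := by intros; ext a; fin_cases a <;> simp <;> ring
      map_smul' := by intros; ext a; fin_cases a <;> simp <;> ring }

theorem boostForm_apply (s : ℝ) (v : Fin 3 → ℝ) : boostForm s v =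
    ![Real.cosh (2 * s) * v 0 - Real.sinh (2 * s) * v 2, v 1,
      Real.cosh (2 * s) * v 2 - Real.sinh (2 * s) * v 0] := rfl

theorem boostForm_neg_boostForm (s : ℝ) (v : Fin 3 → ℝ) :
    boostForm (-s) (boostForm s v) = v := by
  have h := Real.cosh_sq (2 * s)
  ext a
  fin_cases a <;> simp [boostForm_apply]
  · linear_combination (v 0) * h
  · linear_combination (v 2) * h

theorem boostForm_boostForm_neg (s : ℝ) (v : Fin 3 → ℝ) :
    boostForm s (boostForm (-s) v) = v := by
  simpa using boostForm_neg_boostForm (-s) v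

/-- `boostForm s` is conjugation by `boost s`. -/
theorem boost_mul_boostForm (s : ℝ) (v : Fin 3 → ℝ) (i j : Fin 2) :
    ∑ k, (boost s).entry i k * pauliEntry k j (boostForm s v) =
      ∑ k, pauliEntry i k v * (boost s).entry k j := by
  -- Conjugation by boost doubles the angle, as ad X₁ = 2φ and φ² = 1 on span(X₀,X₂). The
  -- double-angle formulas return everything to angle s.
  have h1 : (Real.cosh (2 * s) : ℂ) = Real.cosh s ^ 2 + Real.sinh s ^ 2 := by
    exact_mod_cast Real.cosh_two_mul s
  have h2 : (Real.sinh (2 * s) : ℂ) = 2 * Real.sinh s * Real.cosh s := by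
    exact_mod_cast Real.sinh_two_mul s
  have h3 : (Real.cosh s : ℂ) ^ 2 = Real.sinh s ^ 2 + 1 := by
    exact_mod_cast Real.cosh_sq s
  simp only [boost_entry, pauliEntry_apply, pauliL_coe, boostForm_apply, Fin.sum_univ_two]
  generalize Real.cosh (2 * s) = C at *
  generalize Real.sinh (2 * s) = S at *
  generalize Real.cosh s = c at *
  generalize Real.sinh s = d at *
  fin_cases i <;> fin_cases j <;> simp [h1, h2]
  · linear_combination (c * v 0 - d * v 2) * I * h3
  · linear_combination (c * v 2 - d * v 0) * I * h3
  · linear_combination (d * v 0 - c * v 2) * I * h3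
  · linear_combination (d * v 2 - c * v 0) * I * h3

theorem contMDiff_boostAction (a : SU11 × Multiplicative ℝ) :
    ContMDiff 𝓘(ℝ, ℂ × ℝ) 𝓘(ℝ, ℂ × ℝ) ∞ (boostAction a) :=
  SU11.contMDiff_mul_fun (SU11.contMDiff_mul_fun contMDiff_const contMDiff_id) contMDiff_const

theorem SU11.mvfderiv_linear (c : Fin 2 → Fin 2 → ℂ) (Z : SU11)
    (u : TangentSpace 𝓘(ℝ, ℂ × ℝ) Z) :
    mvfderiv 𝓘(ℝ, ℂ × ℝ) (fun W : SU11 => ∑ k, ∑ l, c k l * W.entry k l) Z u =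
      ∑ k, ∑ l, c k l * mvfderiv 𝓘(ℝ, ℂ × ℝ) (fun W : SU11 => W.entry k l) Z u := by
  have hm : ∀ k l, MDifferentiableAt 𝓘(ℝ, ℂ × ℝ) 𝓘(ℝ, ℂ)
      (fun W : SU11 => c k l * W.entry k l) Z := fun k l =>
    ((contMDiff_const (c := c k l)).mdiffAt Z).mul ((SU11.contMDiff_entry k l).mdiffAt Z)
  have hd : ∀ k l, mvfderiv 𝓘(ℝ, ℂ × ℝ) (fun W : SU11 => c k l * W.entry k l) Z u =
      c k l * mvfderiv 𝓘(ℝ, ℂ × ℝ) (fun W : SU11 => W.entry k l) Z u := fun k l =>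
    (ContinuousLinearMap.mul ℝ ℂ (c k l)).mvfderiv_comp ((SU11.contMDiff_entry k l).mdiffAt Z) u
  simp only [Fin.sum_univ_two, ← hd]
  refine (DFunLike.congr_fun (mvfderiv_add ((hm 0 0).add (hm 0 1)) ((hm 1 0).add (hm 1 1))) u).trans
    ?_
  exact congrArg₂ (fun a b : ℂ => a + b) (DFunLike.congr_fun (mvfderiv_add (hm 0 0) (hm 0 1)) u)
    (DFunLike.congr_fun (mvfderiv_add (hm 1 0) (hm 1 1)) u)

/-- The differential of the action in the left-invariant frame. -/
theorem frameCoord_mfderiv_boostAction (a : SU11 × Multiplicative ℝ) (Z : SU11)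
    (u : TangentSpace 𝓘(ℝ, ℂ × ℝ) Z) :
    frameCoord (boostAction a Z) (mfderiv 𝓘(ℝ, ℂ × ℝ) 𝓘(ℝ, ℂ × ℝ) (boostAction a) Z u) =
      boostForm a.2.toAdd (frameCoord Z u) := by
  refine frameCoord_eq_of_mvfderiv_entry fun i j => ?_
  rw [← mvfderiv_comp_mfderiv ((SU11.contMDiff_entry i j).mdiffAt _)
    ((contMDiff_boostAction a Z).mdifferentiableAt (by simp))]
  have e : (fun W : SU11 => (boostAction a W).entry i j) = fun W => ∑ k, ∑ l,
      (a.1.entry i k * (boost a.2.toAdd).entry l j) * W.entry k l := by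
    funext W
    simp only [boostAction_apply, SU11.entry_mul, Fin.sum_univ_two]
    ring
  rw [e, SU11.mvfderiv_linear]
  have h0 := boost_mul_boostForm a.2.toAdd (frameCoord Z u) 0 j
  have h1 := boost_mul_boostForm a.2.toAdd (frameCoord Z u) 1 j
  simp only [SU11.mvfderiv_entry, boostAction_apply, SU11.entry_mul, Fin.sum_univ_two] at *
  -- With b the boost and v the components of u, d(AZb)(u) = AZ v b = (AZb)(b⁻¹vb). The coefficients
  -- are the entries of AZ in row i.
  linear_combination -(a.1.entry i 0 * Z.entry 0 0 + a.1.entry i 1 * Z.entry 1 0) * h0 -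
    (a.1.entry i 0 * Z.entry 0 1 + a.1.entry i 1 * Z.entry 1 1) * h1

/-! ### Invariance of the metric, the paracontact structure and the connection -/

theorem isIsometricAction_boostAction (mu : ℝ) :
    IsIsometricAction boostAction (kkMetric (-mu) mu mu) := by
  intro a Z u v
  rw [kkMetric_apply, kkMetric_apply, frameCoord_mfderiv_boostAction,
    frameCoord_mfderiv_boostAction, metricForm_apply, metricForm_apply, boostForm_apply,
    boostForm_apply]
  have h := Real.cosh_sq (2 * a.2.toAdd)
  congr 1
  simp
  linear_combination (coframe 2 Z u * coframe 2 Z v - coframe 0 Z u * coframe 0 Z v) * h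

/-- The map `boostForm s` is exp(2sφ) and therefore commutes with φ. -/
theorem boostForm_paraForm (s : ℝ) (v : Fin 3 → ℝ) :
    boostForm s (paraForm v) = paraForm (boostForm s v) := by
  ext a
  fin_cases a <;> simp [boostForm_apply, paraForm_apply] <;> ring

theorem boostForm_canonForm (s c : ℝ) (u v : Fin 3 → ℝ) :
    boostForm s (canonForm c u v) = canonForm c (boostForm s u) (boostForm s v) := by
  rw [canonForm_one_apply, canonForm_one_apply, map_smul, boostForm_paraForm]
  rfl

theorem preservesParacontact_boostAction {mu : ℝ} (hmu : 0 < mu) :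
    PreservesParacontact boostAction (phiOne (-mu) mu mu)
      (unitFrame (-mu) mu mu 1) (unitCoframe (-mu) mu mu 1) where
  phi a Z u := by
    apply (frameCoord _).injective
    rw [frameCoord_mfderiv_boostAction, frameCoord_phiOne hmu, frameCoord_phiOne hmu,
      frameCoord_mfderiv_boostAction, boostForm_paraForm]
  xi a Z := by
    apply (frameCoord _).injective
    rw [frameCoord_mfderiv_boostAction, frameCoord_xi, frameCoord_xi, boostForm_apply]
    ext i
    fin_cases i <;> simp
  eta a Z u := by
    rw [eta_apply, eta_apply, frameCoord_mfderiv_boostAction]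
    rfl

theorem frameCoord_mpullback_boostAction (a : SU11 × Multiplicative ℝ) (Y : SU11.Field) (Z : SU11) :
    frameCoord Z (VectorField.mpullback 𝓘(ℝ, ℂ × ℝ) 𝓘(ℝ, ℂ × ℝ) (boostAction a) Y Z) =
      boostForm (-a.2.toAdd) (frameComp Y (boostAction a Z)) := by
  -- The pullback of a field uses the inverse of the differential; T is that inverse, with frame
  -- matrix `boostForm (-s)`.
  let T := (frameVec Z).comp ((boostForm (-a.2.toAdd)).comp (frameCoordCLM (boostAction a Z)))
  have hT : (mfderiv 𝓘(ℝ, ℂ × ℝ) 𝓘(ℝ, ℂ × ℝ) (boostAction a) Z).inverse = T := by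
    apply ContinuousLinearMap.inverse_eq
    · ext1 u
      apply (frameCoord _).injective
      change frameCoord _ (mfderiv 𝓘(ℝ, ℂ × ℝ) 𝓘(ℝ, ℂ × ℝ) (boostAction a) Z (T u)) = _
      rw [frameCoord_mfderiv_boostAction]
      change boostForm _ (frameCoord Z (frameVec Z _)) = _
      rw [frameCoord_frameVec]
      exact boostForm_boostForm_neg _ _
    · ext1 u
      apply (frameCoord _).injective
      change frameCoord Z (frameVec Z (boostForm _ (frameCoord _
        (mfderiv 𝓘(ℝ, ℂ × ℝ) 𝓘(ℝ, ℂ × ℝ) (boostAction a) Z u)))) = _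
      rw [frameCoord_frameVec, frameCoord_mfderiv_boostAction]
      exact boostForm_neg_boostForm _ _
  rw [VectorField.mpullback_apply, hT]
  exact frameCoord_frameVec Z _

/-- The action has a frame matrix independent of the point, so derivatives pass through it by the
chain rule. The algebraic term is handled by equivariance of c θ¹⊗φ under that matrix. -/
theorem HasSymbol.invariant_boostAction {D : SU11.Connection} {c : ℝ}
    (h : HasSymbol D (canonForm c)) (a : SU11 × Multiplicative ℝ) (Y : SU11.Field)
    (hY : IsSmoothField Y) (Z : SU11) (u : TangentSpace 𝓘(ℝ, ℂ × ℝ) Z) :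
    mfderiv 𝓘(ℝ, ℂ × ℝ) 𝓘(ℝ, ℂ × ℝ) (boostAction a) Z
        (D (VectorField.mpullback 𝓘(ℝ, ℂ × ℝ) 𝓘(ℝ, ℂ × ℝ) (boostAction a) Y) Z u) =
      D Y (boostAction a Z) (mfderiv 𝓘(ℝ, ℂ × ℝ) 𝓘(ℝ, ℂ × ℝ) (boostAction a) Z u) := by
  have hψ := contMDiff_boostAction a
  have hy := hY.contMDiff_frameComp
  have hcomp : ContMDiff 𝓘(ℝ, ℂ × ℝ) 𝓘(ℝ, Fin 3 → ℝ) ∞ fun W => frameComp Y (boostAction a W) :=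
    hy.comp hψ
  have e : frameComp (VectorField.mpullback 𝓘(ℝ, ℂ × ℝ) 𝓘(ℝ, ℂ × ℝ) (boostAction a) Y) =
      fun W => boostForm (-a.2.toAdd) (frameComp Y (boostAction a W)) :=
    funext (frameCoord_mpullback_boostAction a Y)
  have hP : IsSmoothField
      (VectorField.mpullback 𝓘(ℝ, ℂ × ℝ) 𝓘(ℝ, ℂ × ℝ) (boostAction a) Y) := by
    apply isSmoothField_of_frameComp
    rw [e]
    exact (boostForm (-a.2.toAdd)).contDiff.comp_contMDiff_fun hcomp
  apply (frameCoord _).injective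
  rw [frameCoord_mfderiv_boostAction, h _ hP, h Y hY, e,
    (boostForm (-a.2.toAdd)).mvfderiv_comp (hcomp.mdiffAt Z),
    mvfderiv_comp_mfderiv (hy.mdiffAt _) ((hψ Z).mdifferentiableAt (by simp)), map_add,
    boostForm_boostForm_neg, boostForm_canonForm, boostForm_boostForm_neg,
    frameCoord_mfderiv_boostAction]

/-! ### Smooth, transitive and effective actions -/

theorem contMDiff_boostAction_uncurry :
    ContMDiff ((𝓘(ℝ, ℂ × ℝ).prod 𝓘(ℝ, ℝ)).prod 𝓘(ℝ, ℂ × ℝ)) 𝓘(ℝ, ℂ × ℝ) ∞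
      fun p : (SU11 × Multiplicative ℝ) × SU11 => boostAction p.1 p.2 := by
  have h1 : ContMDiff 𝓘(ℝ, ℝ) 𝓘(ℝ, ℂ × ℝ) ∞ fun s : Multiplicative ℝ => boost s.toAdd :=
    contMDiff_boost
  have h2 : ContMDiff ((𝓘(ℝ, ℂ × ℝ).prod 𝓘(ℝ, ℝ)).prod 𝓘(ℝ, ℂ × ℝ)) 𝓘(ℝ, ℂ × ℝ) ∞
      fun p : (SU11 × Multiplicative ℝ) × SU11 => boost p.1.2.toAdd :=
    h1.comp (contMDiff_snd.comp contMDiff_fst)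
  exact SU11.contMDiff_mul_fun (SU11.contMDiff_mul_fun (contMDiff_fst.comp contMDiff_fst)
    contMDiff_snd) h2

theorem isTransitiveEffectiveAction_boostAction :
    IsTransitiveEffectiveAction (𝓘(ℝ, ℂ × ℝ).prod 𝓘(ℝ, ℝ)) 𝓘(ℝ, ℂ × ℝ) boostAction where
  smooth := contMDiff_boostAction_uncurry
  transitive x y := ⟨(y * x⁻¹, 1), by
    rw [boostAction_apply, toAdd_one, boost_zero, mul_one, inv_mul_cancel_right]⟩
  effective := by
    rintro ⟨A, s⟩ h
    simp only [boostAction_apply] at h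
    have h1 := h 1
    rw [mul_one] at h1
    -- Fixing I₂ forces A to be the inverse boost, so fixing diag(i,-i) forces the boost to commute
    -- with it. Comparing the (0,1) entries gives sinh s = 0.
    let W : SU11 := SU11.mk' I 0 (by simp)
    have h2 : W * boost s.toAdd = boost s.toAdd * W := by
      have h3 := h W
      rw [eq_inv_of_mul_eq_one_left h1, mul_assoc, inv_mul_eq_iff_eq_mul] at h3
      exact h3
    have h3 := congrArg (fun Z : SU11 => (Z.entry 0 1).im) h2
    simp only [SU11.entry_mul, boost_entry] at h3
    simp [W, SU11.mk', SU11.entry, -Complex.ofReal_sinh] at h3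
    have hs : s.toAdd = 0 := Real.sinh_eq_zero.1 (by linarith)
    rw [hs, boost_zero, mul_one] at h1
    exact Prod.ext h1 hs

theorem isTransitiveEffectiveAction_leftAction :
    IsTransitiveEffectiveAction 𝓘(ℝ, ℂ × ℝ) 𝓘(ℝ, ℂ × ℝ) leftAction where
  smooth := SU11.contMDiff_mul_fun contMDiff_fst contMDiff_snd
  transitive x y := ⟨y * x⁻¹, by rw [leftAction_apply, inv_mul_cancel_right]⟩
  effective A h := by simpa [leftAction_apply] using h 1

theorem isIsometricAction_leftAction (mu : ℝ) :
    IsIsometricAction leftAction (kkMetric (-mu) mu mu) := by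
  intro A
  rw [leftAction_eq_boostAction]
  exact isIsometricAction_boostAction mu _

theorem preservesParacontact_leftAction {mu : ℝ} (hmu : 0 < mu) :
    PreservesParacontact leftAction (phiOne (-mu) mu mu)
      (unitFrame (-mu) mu mu 1) (unitCoframe (-mu) mu mu 1) where
  phi A := by
    rw [leftAction_eq_boostAction]
    exact (preservesParacontact_boostAction hmu).phi _
  xi A := by
    rw [leftAction_eq_boostAction]
    exact (preservesParacontact_boostAction hmu).xi _
  eta A := by
    rw [leftAction_eq_boostAction]
    exact (preservesParacontact_boostAction hmu).eta _

/-! ### Generated vector fields -/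

theorem contMDiff_prodExp_orbit (X : su11 × ℝ) (Z : SU11) :
    ContMDiff 𝓘(ℝ, ℝ) 𝓘(ℝ, ℂ × ℝ) ∞ fun s : ℝ => boostAction (prodExp (s • X)) Z :=
  SU11.contMDiff_mul_fun
    (SU11.contMDiff_mul_fun (su11.contMDiff_exp_smul X.1) contMDiff_const)
    (contMDiff_boost.comp (contDiff_id.smul contDiff_const).contMDiff)

theorem mvfderiv_entry_generatedField (X : su11 × ℝ) (Z : SU11) (i j : Fin 2) :
    mvfderiv 𝓘(ℝ, ℂ × ℝ) (fun W : SU11 => W.entry i j) Z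
      (generatedField 𝓘(ℝ, ℂ × ℝ) prodExp boostAction X Z) =
      ∑ k, ∑ l, ((X.1 : Matrix (Fin 2) (Fin 2) ℂ) i k * (1 : Matrix (Fin 2) (Fin 2) ℂ) l j -
        (1 : Matrix (Fin 2) (Fin 2) ℂ) i k *
          (X.2 * (pauli 1 : Matrix (Fin 2) (Fin 2) ℂ) l j)) * Z.entry k l := by
  refine SU11.mvfderiv_entry_curve (contMDiff_prodExp_orbit X Z)
    (by simp [boostAction_apply, prodExp, su11.exp_zero, boost_zero]) ?_
  have hb : ∀ l, HasDerivAt (fun s : ℝ => (boost (s • X.2)).entry l j)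
      (X.2 * -(pauli 1 : Matrix (Fin 2) (Fin 2) ℂ) l j) 0 := by
    intro l
    have h0 : HasDerivAt (fun s : ℝ => s • X.2) X.2 0 := by
      simpa using (hasDerivAt_id (0 : ℝ)).smul_const X.2
    have h := (hasDerivAt_boost_entry ((0 : ℝ) • X.2) l j).scomp (0 : ℝ) h0
    refine h.congr_deriv ?_
    rw [zero_smul, boost_zero]
    simp [SU11.entry_one, Matrix.one_apply]
  have he := fun k => su11.hasDerivAt_exp_entry_zero X.1 i k
  have e : (fun s : ℝ => (boostAction (prodExp (s • X)) Z).entry i j) = fun s : ℝ =>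
      ∑ k, ∑ l, (su11.exp (s • X.1)).entry i k * Z.entry k l * (boost (s • X.2)).entry l j := by
    funext s
    simp only [boostAction_apply, prodExp, SU11.entry_mul, Fin.sum_univ_two, Prod.smul_fst,
      Prod.smul_snd, toAdd_ofAdd]
    ring
  rw [e]
  refine HasDerivAt.fun_sum fun k _ => HasDerivAt.fun_sum fun l _ => ?_
  refine (((he k).mul_const (Z.entry k l)).mul (hb l)).congr_deriv ?_
  have e1 : su11.exp ((0 : ℝ) • X.1) = 1 := by rw [zero_smul, su11.exp_zero]
  have e2 : boost ((0 : ℝ) • X.2) = 1 := by rw [zero_smul, boost_zero]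
  rw [e1, e2, SU11.entry_one, SU11.entry_one]
  ring

theorem contMDiff_frameComp_generatedField (X : su11 × ℝ) :
    ContMDiff 𝓘(ℝ, ℂ × ℝ) 𝓘(ℝ, Fin 3 → ℝ) ∞
      (frameComp (generatedField 𝓘(ℝ, ℂ × ℝ) prodExp boostAction X)) := by
  refine contMDiff_frameComp_of_mvfderiv_entry fun i j => ?_
  simp only [mvfderiv_entry_generatedField]
  exact contMDiff_finsetSum fun k _ => contMDiff_finsetSum fun l _ =>
    (ContinuousLinearMap.mul ℝ ℂ _).contDiff.comp_contMDiff_fun (SU11.contMDiff_entry k l)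

/-- The map `𝔤 → T_o`, `X ↦ X*_o`, in coordinates. -/
def orbitCoord : su11 × ℝ →ₗ[ℝ] (Fin 3 → ℝ) :=
  pauliEquiv.symm.toLinearMap.comp (LinearMap.fst ℝ su11 ℝ) -
    (LinearMap.toSpanSingleton ℝ (Fin 3 → ℝ) (Pi.single 1 1)).comp (LinearMap.snd ℝ su11 ℝ)

theorem orbitCoord_apply (x : Fin 3 → ℝ) (d : ℝ) :
    orbitCoord (pauliL x, d) = ![x 0, x 1 - d, x 2] := by
  have h : pauliEquiv.symm (pauliL x) = x := pauliEquiv.symm_apply_apply x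
  ext a
  fin_cases a <;> simp [orbitCoord, h]

theorem frameCoord_generatedField_one (X : su11 × ℝ) :
    frameCoord 1 (generatedField 𝓘(ℝ, ℂ × ℝ) prodExp boostAction X 1) = orbitCoord X := by
  obtain ⟨x, d⟩ := X
  obtain ⟨x, rfl⟩ := pauliL_bijective.2 x
  refine frameCoord_eq_of_mvfderiv_entry fun i j => ?_
  rw [mvfderiv_entry_generatedField, orbitCoord_apply]
  simp only [SU11.entry_one, pauliEntry_apply, pauliL_coe, Fin.sum_univ_two]
  obtain rfl | rfl : i = 0 ∨ i = 1 := by omega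
  all_goals obtain rfl | rfl : j = 0 ∨ j = 1 := by omega
  all_goals simp [pauli] <;> ring

/-- The derivative at `o` of the components of a generated vector field. -/
theorem mvfderiv_frameComp_generatedField (y : Fin 3 → ℝ) (d : ℝ)
    (u : TangentSpace 𝓘(ℝ, ℂ × ℝ) (1 : SU11)) :
    mvfderiv 𝓘(ℝ, ℂ × ℝ)
      (frameComp (generatedField 𝓘(ℝ, ℂ × ℝ) prodExp boostAction (pauliL y, d))) 1 u =
      pauliBracket y (frameCoord 1 u) := by
  set f := frameComp (generatedField 𝓘(ℝ, ℂ × ℝ) prodExp boostAction (pauliL y, d)) with hf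
  have hs : ContMDiff 𝓘(ℝ, ℂ × ℝ) 𝓘(ℝ, Fin 3 → ℝ) ∞ f := contMDiff_frameComp_generatedField _
  have h1 : f 1 = orbitCoord (pauliL y, d) := frameCoord_generatedField_one _
  have key : ∀ i j, pauliEntry i j (mvfderiv 𝓘(ℝ, ℂ × ℝ) f 1 u) =
      pauliEntry i j (pauliBracket y (frameCoord 1 u)) := by
    intro i j
    have hp : ∀ k, ContMDiff 𝓘(ℝ, ℂ × ℝ) 𝓘(ℝ, ℂ) ∞ fun A => pauliEntry k j (f A) :=
      fun k => (pauliEntry k j).contDiff.comp_contMDiff_fun hs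
    have hb : ∀ k, mvfderiv 𝓘(ℝ, ℂ × ℝ) (fun A : SU11 => A.entry i k * pauliEntry k j (f A)) 1 u =
        mvfderiv 𝓘(ℝ, ℂ × ℝ) (fun A : SU11 => A.entry i k) 1 u * pauliEntry k j (f 1) +
          (1 : SU11).entry i k * pauliEntry k j (mvfderiv 𝓘(ℝ, ℂ × ℝ) f 1 u) := by
      intro k
      rw [← (pauliEntry k j).mvfderiv_comp (hs.mdiffAt 1)]
      exact (ContinuousLinearMap.mul ℝ ℂ).mvfderiv_bilin
        ((SU11.contMDiff_entry i k).mdiffAt 1) ((hp k).mdiffAt 1) u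
    have hm : ∀ k, MDifferentiableAt 𝓘(ℝ, ℂ × ℝ) 𝓘(ℝ, ℂ)
        (fun A : SU11 => A.entry i k * pauliEntry k j (f A)) 1 := fun k =>
      ((SU11.contMDiff_entry i k).mdiffAt 1).mul ((hp k).mdiffAt 1)
    -- The velocity of the action gives A f(A) = yA - dAX₁. Differentiating at 1, where f(1) = y -
    -- dX₁, gives f'(u) = yu - uy; the terms in d cancel.
    have e : (fun A : SU11 => A.entry i 0 * pauliEntry 0 j (f A) +
        A.entry i 1 * pauliEntry 1 j (f A)) = fun A => ∑ k, ∑ l,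
        ((pauliL y : Matrix (Fin 2) (Fin 2) ℂ) i k * (1 : Matrix (Fin 2) (Fin 2) ℂ) l j -
        (1 : Matrix (Fin 2) (Fin 2) ℂ) i k *
          (d * (pauli 1 : Matrix (Fin 2) (Fin 2) ℂ) l j)) * A.entry k l := by
      funext A
      rw [← mvfderiv_entry_generatedField (pauliL y, d) A i j, SU11.mvfderiv_entry,
        Fin.sum_univ_two]
      rfl
    have h := (DFunLike.congr_fun (mvfderiv_add (hm 0) (hm 1)) u).symm.trans
      (congrArg (fun g : SU11 → ℂ => mvfderiv 𝓘(ℝ, ℂ × ℝ) g 1 u) e)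
    rw [add_apply, hb, hb] at h
    rw [SU11.mvfderiv_linear] at h
    simp only [SU11.mvfderiv_entry, h1, orbitCoord_apply] at h
    have hl : pauliEntry i j (pauliBracket y (frameCoord 1 u)) =
        ∑ k, (pauliEntry i k y * pauliEntry k j (frameCoord 1 u) -
          pauliEntry i k (frameCoord 1 u) * pauliEntry k j y) := by
      rw [pauliEntry_apply, ← pauliL_lie, LieSubalgebra.coe_bracket, Ring.lie_def,
        Finset.sum_sub_distrib]
      simp [Matrix.mul_apply, pauliEntry_apply]
    rw [hl]
    generalize mvfderiv 𝓘(ℝ, ℂ × ℝ) f 1 u = w at *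
    generalize frameCoord 1 u = v at *
    simp only [SU11.entry_one, pauliEntry_apply, pauliL_coe, Fin.sum_univ_two] at h ⊢
    obtain rfl | rfl : i = 0 ∨ i = 1 := by omega
    all_goals obtain rfl | rfl : j = 0 ∨ j = 1 := by omega
    all_goals (simp [pauli] at h ⊢; linear_combination h)
  have hw : pauliL (mvfderiv 𝓘(ℝ, ℂ × ℝ) f 1 u) = pauliL (pauliBracket y (frameCoord 1 u)) := by
    apply Subtype.ext
    ext i j
    exact key i j
  exact pauliL_bijective.1 hw

theorem HasSymbol.generatedField_at_base {D : SU11.Connection} {c : ℝ}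
    (h : HasSymbol D (canonForm c)) (X : su11 × ℝ) (y : Fin 3 → ℝ) (d : ℝ) :
    frameCoord 1 (D (generatedField 𝓘(ℝ, ℂ × ℝ) prodExp boostAction (pauliL y, d)) 1
      (generatedField 𝓘(ℝ, ℂ × ℝ) prodExp boostAction X 1)) =
      pauliBracket y (orbitCoord X) + canonForm c (orbitCoord X) (orbitCoord (pauliL y, d)) := by
  rw [h _ (isSmoothField_of_frameComp (contMDiff_frameComp_generatedField _)),
    mvfderiv_frameComp_generatedField, frameCoord_generatedField_one, frameComp,
    frameCoord_generatedField_one]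

/-- Left translations form the s = 0 part of the larger action, so its computations are reused with
D-component zero. -/
theorem generatedField_leftAction (X : su11) :
    generatedField 𝓘(ℝ, ℂ × ℝ) su11.exp leftAction X =
      generatedField 𝓘(ℝ, ℂ × ℝ) prodExp boostAction (X, 0) := by
  funext Z
  have e : (fun s : ℝ => leftAction (su11.exp (s • X)) Z) =
      fun s : ℝ => boostAction (prodExp (s • (X, (0 : ℝ)))) Z := by
    funext s
    rw [leftAction_eq_boostAction]
    simp [prodExp]
  unfold generatedField
  rw [e]
  rfl

/-! ### The reductive decomposition of `su(1,1) ⊕ ℝ` -/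

theorem mem_hSub {X : su11 × ℝ} : X ∈ hSub ↔ ∃ r : ℝ, X = (r • pauli 1, r) := by
  simp [hSub, Submodule.mem_span_singleton, eq_comm]

/-- The vectors of `mSub mu t` in the given basis. -/
def mSubParam (mu t : ℝ) : (Fin 3 → ℝ) →ₗ[ℝ] su11 × ℝ :=
  Fintype.linearCombination ℝ ![(pauli 0, 0),
    (((mu + t) / (2 * mu)) • pauli 1, -((mu - t) / (2 * mu))), (pauli 2, 0)]

theorem mSubParam_apply (mu t : ℝ) (v : Fin 3 → ℝ) : mSubParam mu t v =
    (pauliL ![v 0, (mu + t) / (2 * mu) * v 1, v 2], -((mu - t) / (2 * mu) * v 1)) := by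
  simp [mSubParam, Fintype.linearCombination_apply, Fin.sum_univ_three, pauliL_apply, smul_smul,
    mul_comm]

theorem range_mSubParam (mu t : ℝ) : LinearMap.range (mSubParam mu t) = mSub mu t := by
  rw [mSubParam, Fintype.range_linearCombination, mSub]
  congr 1
  simp only [Matrix.range_cons, Matrix.range_empty, Set.union_empty, Set.singleton_union]

theorem mem_mSub {mu t : ℝ} {X : su11 × ℝ} : X ∈ mSub mu t ↔ ∃ v, mSubParam mu t v = X := by
  rw [← range_mSubParam, LinearMap.mem_range]

theorem mSubParam_mem (mu t : ℝ) (v : Fin 3 → ℝ) : mSubParam mu t v ∈ mSub mu t :=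
  mem_mSub.2 ⟨v, rfl⟩

/-- The boost moves I₂ in direction -X₁, so the middle vector has velocity ((μ+t)/2μ + (μ-t)/2μ)X₁ =
X₁. The weights sum to 1 for every t. -/
theorem orbitCoord_mSubParam {mu : ℝ} (hmu : mu ≠ 0) (t : ℝ) (v : Fin 3 → ℝ) :
    orbitCoord (mSubParam mu t v) = v := by
  rw [mSubParam_apply, orbitCoord_apply]
  ext a
  fin_cases a
  · rfl
  · simp
    field_simp
    ring
  · rfl

theorem mem_hSub_iff_orbitCoord {X : su11 × ℝ} : X ∈ hSub ↔ orbitCoord X = 0 := by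
  obtain ⟨x, d⟩ := X
  obtain ⟨x, rfl⟩ := pauliL_bijective.2 x
  rw [mem_hSub, orbitCoord_apply, ← pauliL_single]
  simp only [← map_smul, Prod.mk.injEq, pauliL_bijective.1.eq_iff]
  constructor
  · rintro ⟨r, rfl, rfl⟩
    ext a
    fin_cases a <;> simp
  · intro h
    have h0 := congrFun h 0
    have h1 := congrFun h 1
    have h2 := congrFun h 2
    refine ⟨d, ?_, rfl⟩
    simp at h0 h1 h2
    ext a
    fin_cases a <;> simp [h0, h2]
    linarith

/-- 𝔥 is the kernel of `orbitCoord` and 𝔪 the image of its section `mSubParam`. -/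
theorem isCompl_hSub_mSub {mu : ℝ} (hmu : mu ≠ 0) (t : ℝ) : IsCompl hSub (mSub mu t) := by
  refine ⟨Submodule.disjoint_def.2 fun X hX hX' => ?_, codisjoint_iff.2 ?_⟩
  · obtain ⟨v, rfl⟩ := mem_mSub.1 hX'
    rw [mem_hSub_iff_orbitCoord, orbitCoord_mSubParam hmu] at hX
    rw [hX, map_zero]
  · rw [eq_top_iff]
    intro X _
    have h : X - mSubParam mu t (orbitCoord X) ∈ hSub := by
      rw [mem_hSub_iff_orbitCoord, map_sub, orbitCoord_mSubParam hmu, sub_self]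
    simpa using Submodule.add_mem_sup h (mSubParam_mem mu t (orbitCoord X))

theorem su11.inv_mul_exp_mul {A : SU11} {X Y : su11}
    (h : (A.1.1 : Matrix (Fin 2) (Fin 2) ℂ) * (Y : Matrix (Fin 2) (Fin 2) ℂ) =
      (X : Matrix (Fin 2) (Fin 2) ℂ) * A.1.1) :
    A⁻¹ * su11.exp X * A = su11.exp Y := by
  have hc : ∀ B C : SU11, B.1.1 * C.1.1 = (B * C).1.1 := fun B C => rfl
  let U : (Matrix (Fin 2) (Fin 2) ℂ)ˣ :=
    ⟨A.1.1, (A⁻¹).1.1, by rw [hc, mul_inv_cancel]; rfl, by rw [hc, inv_mul_cancel]; rfl⟩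
  apply Subtype.ext
  apply Subtype.ext
  have e : (Y : Matrix (Fin 2) (Fin 2) ℂ) = (U⁻¹ : (Matrix (Fin 2) (Fin 2) ℂ)ˣ) * X * U := by
    rw [mul_assoc, Units.eq_inv_mul_iff_mul_eq]
    exact h
  change _ = NormedSpace.exp (Y : Matrix (Fin 2) (Fin 2) ℂ)
  rw [e, Matrix.exp_units_conj']
  rfl

/-- Conjugation by `boost s` is the linear map `boostForm s`. -/
theorem boost_inv_mul_exp_mul_boost (s : ℝ) (v : Fin 3 → ℝ) :
    (boost s)⁻¹ * su11.exp (pauliL v) * boost s = su11.exp (pauliL (boostForm s v)) := by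
  refine su11.inv_mul_exp_mul ?_
  ext i j
  rw [Matrix.mul_apply, Matrix.mul_apply]
  exact boost_mul_boostForm s v i j

theorem isReductiveDecomposition_boostAction {mu : ℝ} (hmu : mu ≠ 0) (t : ℝ) :
    IsReductiveDecomposition prodExp boostAction 1 hSub (mSub mu t) where
  isCompl := isCompl_hSub_mSub hmu t
  mem_isotropy X := by
    constructor
    · intro hX s
      obtain ⟨r, rfl⟩ := mem_hSub.1 hX
      rw [boostAction_apply, mul_one]
      simp only [prodExp, Prod.smul_fst, Prod.smul_snd, smul_smul, exp_pauli_one, toAdd_ofAdd,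
        smul_eq_mul]
      rw [← boost_add, neg_add_cancel, boost_zero]
    · intro h
      -- A one-parameter group fixing I₂ has zero velocity there, which places its generator in the
      -- kernel 𝔥.
      rw [mem_hSub_iff_orbitCoord, ← frameCoord_generatedField_one]
      have e : (fun s : ℝ => boostAction (prodExp (s • X)) 1) = fun _ => 1 := funext h
      unfold generatedField
      rw [e, mfderiv_const]
      exact map_zero _
  ad_invariant := by
    rintro ⟨A, s⟩ hA X hX
    obtain ⟨v, rfl⟩ := mem_mSub.1 hX
    rw [boostAction_apply, mul_one] at hA
    replace hA : A = (boost s.toAdd)⁻¹ := eq_inv_of_mul_eq_one_left hA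
    subst hA
    -- An isotropy element is (boost(s)⁻¹, s), so conjugation by it is exp(2sφ) on su(1,1) and
    -- trivial on ℝ. It fixes the middle vector of 𝔪 and mixes X₀ with X₂.
    refine ⟨mSubParam mu t (boostForm s.toAdd v), mSubParam_mem _ _ _, fun r => ?_⟩
    rw [← map_smul, ← map_smul, ← map_smul, mSubParam_apply, mSubParam_apply]
    refine Prod.ext ?_ ?_
    · have e := boost_inv_mul_exp_mul_boost s.toAdd
        ![(r • v) 0, (mu + t) / (2 * mu) * (r • v) 1, (r • v) 2]
      simp only [prodExp, Prod.fst_mul, Prod.fst_inv, inv_inv]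
      rw [e]
      rfl
    · simp [prodExp, boostForm_apply]

theorem prod_lie (X Y : su11 × ℝ) : ⁅X, Y⁆ = (⁅X.1, Y.1⁆, (0 : ℝ)) := by
  refine Prod.ext rfl ?_
  exact (Ring.lie_def X.2 Y.2).trans (by ring)

theorem isCanonicalConnection_boostAction {mu t : ℝ} (hmu : mu ≠ 0) {D : SU11.Connection}
    (h : HasSymbol D (canonForm (1 - t / mu))) :
    IsCanonicalConnection prodExp boostAction 1 hSub (mSub mu t) D where
  invariant := h.invariant_boostAction
  at_base := by
    intro X hX Y hY V hV hXY
    obtain ⟨x, rfl⟩ := mem_mSub.1 hX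
    obtain ⟨y, rfl⟩ := mem_mSub.1 hY
    -- V differs from [X,Y] by an element of the kernel, so both have the same velocity at I₂ and V
    -- itself need not be computed.
    rw [mem_hSub_iff_orbitCoord, map_sub, sub_eq_zero] at hXY
    apply (frameCoord 1).injective
    rw [map_neg, frameCoord_generatedField_one V, ← hXY, mSubParam_apply mu t y,
      h.generatedField_at_base, ← mSubParam_apply, orbitCoord_mSubParam hmu,
      orbitCoord_mSubParam hmu, prod_lie, mSubParam_apply, mSubParam_apply, pauliL_lie,
      orbitCoord_apply]
    -- Let x', y' be the su(1,1)-parts of X, Y, with κ = (μ+t)/2μ on the middle coordinate. Then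
    -- [y',x] - [y',x'] = -2(1-κ)x₁φ(y), and 2(1-κ) = 1 - t/μ cancels it against the connection
    -- term.
    ext a
    fin_cases a <;> simp [pauliBracket_apply, canonForm_apply] <;> field_simp <;> ring

/-! ### The holonomy algebra -/

/-- The generator of the holonomy algebra. -/
def paraEnd : Module.End ℝ (TangentSpace 𝓘(ℝ, ℂ × ℝ) (1 : SU11)) :=
  (frameCoord 1).symm.conj (paraForm : (Fin 3 → ℝ) →ₗ[ℝ] (Fin 3 → ℝ))

theorem frameCoord_paraEnd (u : TangentSpace 𝓘(ℝ, ℂ × ℝ) (1 : SU11)) :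
    frameCoord 1 (paraEnd u) = paraForm (frameCoord 1 u) := by
  simp [paraEnd, LinearEquiv.conj_apply]

/-- Left-invariant extensions of the three vectors determine A; conversely, the curvature depends
only on the values at I₂, so the formula holds for all smooth extensions. -/
theorem HasSymbol.isCurvatureOperator_iff {D : SU11.Connection} {c : ℝ}
    (h : HasSymbol D (canonForm c)) (u v : TangentSpace 𝓘(ℝ, ℂ × ℝ) (1 : SU11))
    (A : Module.End ℝ (TangentSpace 𝓘(ℝ, ℂ × ℝ) (1 : SU11))) :
    IsCurvatureOperator D 1 u v A ↔
      A = -(pauliBracket (frameCoord 1 u) (frameCoord 1 v) 1 * c) • paraEnd := by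
  constructor
  · intro hA
    ext w
    apply (frameCoord 1).injective
    have e := hA (leftField (frameCoord 1 u)) (leftField (frameCoord 1 v))
      (leftField (frameCoord 1 w)) (isSmoothField_leftField _) (isSmoothField_leftField _)
      (isSmoothField_leftField _) (leftField_frameCoord 1 u) (leftField_frameCoord 1 v)
    rw [leftField_frameCoord] at e
    rw [e, h.frameCoord_curvatureField (isSmoothField_leftField _) (isSmoothField_leftField _)
      (isSmoothField_leftField _), symbolCurvature_canonForm]
    simp only [frameComp_leftField]
    rw [LinearMap.smul_apply, map_smul, frameCoord_paraEnd]
  · rintro rfl X Y Z hX hY hZ rfl rfl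
    apply (frameCoord 1).injective
    rw [h.frameCoord_curvatureField hX hY hZ, symbolCurvature_canonForm, LinearMap.smul_apply,
      map_smul, frameCoord_paraEnd]
    rfl

/-- The line spanned by `paraEnd`. -/
def paraLine : LieSubalgebra ℝ (Module.End ℝ (TangentSpace 𝓘(ℝ, ℂ × ℝ) (1 : SU11))) :=
  { Submodule.span ℝ {paraEnd} with
    lie_mem' := by
      intro A B hA hB
      obtain ⟨r, rfl⟩ := Submodule.mem_span_singleton.1 hA
      obtain ⟨s, rfl⟩ := Submodule.mem_span_singleton.1 hB
      rw [smul_lie, lie_smul, lie_self, smul_zero, smul_zero]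
      exact Submodule.zero_mem _ }

theorem mem_paraLine {A : Module.End ℝ (TangentSpace 𝓘(ℝ, ℂ × ℝ) (1 : SU11))} :
    A ∈ paraLine ↔ ∃ r : ℝ, r • paraEnd = A :=
  Submodule.mem_span_singleton

theorem HasSymbol.holonomyAlgebra_eq {D : SU11.Connection} {c : ℝ} (hc : c ≠ 0)
    (h : HasSymbol D (canonForm c)) : holonomyAlgebra D 1 = paraLine := by
  apply le_antisymm
  · refine LieSubalgebra.lieSpan_le.2 ?_
    rintro A ⟨u, v, hA⟩
    exact mem_paraLine.2 ⟨_, ((h.isCurvatureOperator_iff u v A).1 hA).symm⟩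
  · intro A hA
    obtain ⟨r, rfl⟩ := mem_paraLine.1 hA
    -- Since θ¹([X₀,X₂]) = -2, dividing X₀ by 2c makes R̃ exactly φ.
    refine LieSubalgebra.smul_mem _ r (LieSubalgebra.subset_lieSpan
      ⟨(frameCoord 1).symm ((2 * c)⁻¹ • Pi.single 0 1), (frameCoord 1).symm (Pi.single 2 1), ?_⟩)
    rw [h.isCurvatureOperator_iff, LinearEquiv.apply_symm_apply, LinearEquiv.apply_symm_apply]
    simp [pauliBracket_apply]
    field_simp
    simp

theorem HasSymbol.holonomyAlgebra_eq_bot {D : SU11.Connection}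
    (h : HasSymbol D (canonForm 0)) : holonomyAlgebra D 1 = ⊥ := by
  rw [eq_bot_iff]
  refine LieSubalgebra.lieSpan_le.2 ?_
  rintro A ⟨u, v, hA⟩
  rw [h.isCurvatureOperator_iff, mul_zero, neg_zero, zero_smul] at hA
  exact hA

/-! ### The brackets of the decomposition -/

theorem paraEnd_ne_zero : paraEnd ≠ 0 := by
  intro h
  have h1 := frameCoord_paraEnd ((frameCoord 1).symm (Pi.single 0 1))
  rw [h, LinearEquiv.apply_symm_apply, LinearMap.zero_apply, map_zero] at h1
  simpa [paraForm_apply] using congrFun h1 2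

/-- The identification of `𝔪` with `T_o`. -/
def mSubEquiv {mu : ℝ} (hmu : mu ≠ 0) (t : ℝ) :
    mSub mu t ≃ₗ[ℝ] TangentSpace 𝓘(ℝ, ℂ × ℝ) (1 : SU11) :=
  LinearEquiv.trans (M₂ := Fin 3 → ℝ)
    { toFun := fun X : mSub mu t => orbitCoord X
      invFun := fun v => ⟨mSubParam mu t v, mSubParam_mem mu t v⟩
      map_add' := fun X Y => map_add orbitCoord _ _
      map_smul' := fun r X => map_smul orbitCoord r _
      left_inv := by
        rintro ⟨X, hX⟩
        obtain ⟨v, rfl⟩ := mem_mSub.1 hX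
        simp only [orbitCoord_mSubParam hmu]
      right_inv := fun v => orbitCoord_mSubParam hmu t v } (frameCoord 1).symm

theorem mSubEquiv_apply {mu : ℝ} (hmu : mu ≠ 0) (t : ℝ) (X : mSub mu t) :
    mSubEquiv hmu t X = (frameCoord 1).symm (orbitCoord X) := rfl

theorem mSubEquiv_symm_apply {mu : ℝ} (hmu : mu ≠ 0) (t : ℝ)
    (w : TangentSpace 𝓘(ℝ, ℂ × ℝ) (1 : SU11)) :
    ((mSubEquiv hmu t).symm w : su11 × ℝ) = mSubParam mu t (frameCoord 1 w) := rfl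

theorem frameCoord_mSubEquiv {mu : ℝ} (hmu : mu ≠ 0) (t : ℝ) (v : Fin 3 → ℝ)
    (hv : mSubParam mu t v ∈ mSub mu t) :
    frameCoord 1 (mSubEquiv hmu t ⟨mSubParam mu t v, hv⟩) = v := by
  rw [mSubEquiv_apply, LinearEquiv.apply_symm_apply, orbitCoord_mSubParam hmu]

/-- The isotropy representation of `𝔥` on `T_o`. -/
def hSubMap : hSub →ₗ[ℝ] paraLine where
  -- The D-component of r(X₁ + D) is r, and its bracket with 𝔪 is r ad X₁ = 2rφ.
  toFun U := ⟨(2 * (U : su11 × ℝ).2) • paraEnd, mem_paraLine.2 ⟨_, rfl⟩⟩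
  map_add' U V := Subtype.ext (by
    change (2 * ((U : su11 × ℝ).2 + (V : su11 × ℝ).2)) • paraEnd =
      (2 * (U : su11 × ℝ).2) • paraEnd + (2 * (V : su11 × ℝ).2) • paraEnd
    rw [mul_add, add_smul])
  map_smul' r U := Subtype.ext (by
    change (2 * (r * (U : su11 × ℝ).2)) • paraEnd = r • (2 * (U : su11 × ℝ).2) • paraEnd
    rw [smul_smul, mul_left_comm])

theorem hSubMap_bijective : Function.Bijective hSubMap := by
  constructor
  · rw [injective_iff_map_eq_zero]
    rintro ⟨U, hU⟩ h
    obtain ⟨r, rfl⟩ := mem_hSub.1 hU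
    have h1 : (2 * r) • paraEnd = 0 := congrArg Subtype.val h
    have h2 : r = 0 := by simpa [paraEnd_ne_zero] using h1
    subst h2
    exact Subtype.ext (by simp)
  · rintro ⟨A, hA⟩
    obtain ⟨r, rfl⟩ := mem_paraLine.1 hA
    refine ⟨⟨((r / 2) • pauli 1, r / 2), mem_hSub.2 ⟨_, rfl⟩⟩, Subtype.ext ?_⟩
    change (2 * (r / 2)) • paraEnd = r • paraEnd
    rw [mul_div_cancel₀ r two_ne_zero]

/-- The identification of `𝔥` with the holonomy algebra. -/
def hSubEquiv : hSub ≃ₗ[ℝ] paraLine := LinearEquiv.ofBijective hSubMap hSubMap_bijective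

theorem hSubEquiv_apply (U : hSub) :
    (hSubEquiv U : Module.End ℝ (TangentSpace 𝓘(ℝ, ℂ × ℝ) (1 : SU11))) =
      (2 * (U : su11 × ℝ).2) • paraEnd := rfl

/-- D is central and φ annihilates the middle coordinate, so ad(X₁ + D) is 2φ on 𝔪 despite the
different weight of the middle vector. -/
theorem smul_pauli_one_lie_mSubParam (mu t r : ℝ) (v : Fin 3 → ℝ) :
    ⁅((r • pauli 1, r) : su11 × ℝ), mSubParam mu t v⁆ =
      mSubParam mu t ((2 * r) • paraForm v) := by
  rw [prod_lie, mSubParam_apply, mSubParam_apply, ← pauliL_single, ← map_smul, pauliL_lie]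
  refine Prod.ext (congrArg pauliL ?_) ?_
  · ext a
    fin_cases a <;> simp [pauliBracket_apply, paraForm_apply] <;> ring
  · simp [paraForm_apply]

/-- The 𝔪-part is minus the torsion of ∇ - S, namely S_x y - S_y x. The 𝔥-part is the multiple of X₁
+ D that acts as R̃(x,y); the factor ½ compensates ad X₁ = 2φ. The D-components cancel because the
bracket of su(1,1) ⊕ ℝ has none. -/
theorem mSubParam_lie_mSubParam {mu : ℝ} (hmu : mu ≠ 0) (t : ℝ) (x y : Fin 3 → ℝ) :
    ⁅mSubParam mu t x, mSubParam mu t y⁆ =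
      mSubParam mu t (structForm (t / mu) x y - structForm (t / mu) y x) -
        ((-(pauliBracket x y 1 * (1 - t / mu)) / 2) • pauli 1,
          -(pauliBracket x y 1 * (1 - t / mu)) / 2) := by
  rw [prod_lie, mSubParam_apply, mSubParam_apply, mSubParam_apply, ← pauliL_single, ← map_smul,
    pauliL_lie]
  refine Prod.ext ?_ ?_
  · rw [Prod.fst_sub, ← map_sub]
    refine congrArg pauliL ?_
    ext a
    fin_cases a <;> simp [pauliBracket_apply, structForm_apply] <;> field_simp <;> ring
  · simp [pauliBracket_apply, structForm_apply]
    field_simp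
    ring

theorem isDecompositionOfStructure_boostAction {mu t : ℝ} (hmu : mu ≠ 0) (ht : t ≠ mu)
    {D : SU11.Connection}
    (h : HasSymbol (canonicalConnection D (sMu (-mu) mu mu t)) (canonForm (1 - t / mu))) :
    IsDecompositionOfStructure prodExp boostAction 1 hSub (mSub mu t) D (sMu (-mu) mu mu t) := by
  -- Here t ≠ μ is essential: 𝔥 is one-dimensional and can only match a nonzero holonomy algebra.
  have hc : 1 - t / mu ≠ 0 := by
    rw [sub_ne_zero, ne_comm, Ne, div_eq_one_iff_eq hmu]
    exact ht
  rw [IsDecompositionOfStructure, h.holonomyAlgebra_eq hc]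
  refine ⟨hSubEquiv, mSubEquiv hmu t, ?_, ?_, ?_, ?_⟩
  · intro X
    rw [mSubEquiv_apply, LinearEquiv.symm_apply_eq, frameCoord_generatedField_one]
  · rintro ⟨U, hU⟩ ⟨V, hV⟩
    obtain ⟨r, rfl⟩ := mem_hSub.1 hU
    obtain ⟨s, rfl⟩ := mem_hSub.1 hV
    have e : ⁅hSubEquiv ⟨_, hU⟩, hSubEquiv ⟨_, hV⟩⁆ = 0 := by
      apply Subtype.ext
      rw [LieSubalgebra.coe_bracket, hSubEquiv_apply, hSubEquiv_apply, smul_lie, lie_smul,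
        lie_self, smul_zero, smul_zero]
      rfl
    rw [e, map_zero, prod_lie]
    simp
  · rintro ⟨U, hU⟩ ⟨X, hX⟩
    obtain ⟨r, rfl⟩ := mem_hSub.1 hU
    obtain ⟨v, rfl⟩ := mem_mSub.1 hX
    rw [smul_pauli_one_lie_mSubParam, mSubEquiv_symm_apply, hSubEquiv_apply,
      LinearMap.smul_apply, map_smul (frameCoord 1), frameCoord_paraEnd, frameCoord_mSubEquiv]
  · rintro ⟨X, hX⟩ ⟨Y, hY⟩
    obtain ⟨x, rfl⟩ := mem_mSub.1 hX
    obtain ⟨y, rfl⟩ := mem_mSub.1 hY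
    refine ⟨⟨((-(pauliBracket x y 1 * (1 - t / mu)) / 2) • pauli 1,
      -(pauliBracket x y 1 * (1 - t / mu)) / 2), mem_hSub.2 ⟨_, rfl⟩⟩, ?_, ?_⟩
    · rw [h.isCurvatureOperator_iff, frameCoord_mSubEquiv, frameCoord_mSubEquiv, hSubEquiv_apply]
      rw [mul_div_cancel₀ _ two_ne_zero]
    · rw [mSubParam_lie_mSubParam hmu, mSubEquiv_symm_apply, map_sub (frameCoord 1),
        frameCoord_sMu hmu, frameCoord_sMu hmu, frameCoord_mSubEquiv, frameCoord_mSubEquiv]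

/-! ### Left translations -/

theorem pauliEquiv_symm_pauliL (v : Fin 3 → ℝ) : pauliEquiv.symm (pauliL v) = v :=
  pauliEquiv.symm_apply_apply v

theorem orbitCoord_left (X : su11) : orbitCoord (X, 0) = pauliEquiv.symm X := by
  simp [orbitCoord]

theorem frameCoord_generatedField_leftAction (X : su11) :
    frameCoord 1 (generatedField 𝓘(ℝ, ℂ × ℝ) su11.exp leftAction X 1) = pauliEquiv.symm X := by
  rw [generatedField_leftAction, frameCoord_generatedField_one, orbitCoord_left]

theorem isReductiveDecomposition_leftAction :
    IsReductiveDecomposition su11.exp leftAction 1 ⊥ ⊤ where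
  isCompl := isCompl_bot_top
  mem_isotropy X := by
    constructor
    · intro hX s
      rw [(Submodule.mem_bot ℝ).1 hX, smul_zero, su11.exp_zero, leftAction_apply, mul_one]
    · intro h
      have e : (fun s : ℝ => leftAction (su11.exp (s • X)) 1) = fun _ => 1 := funext h
      rw [Submodule.mem_bot, ← LinearEquiv.map_eq_zero_iff pauliEquiv.symm,
        ← frameCoord_generatedField_leftAction]
      unfold generatedField
      rw [e, mfderiv_const]
      exact map_zero _
  ad_invariant := by
    intro A hA X _
    rw [leftAction_apply, mul_one] at hA
    exact ⟨X, Submodule.mem_top, fun s => by rw [hA, one_mul, inv_one, mul_one]⟩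

theorem isCanonicalConnection_leftAction {D : SU11.Connection} (h : HasSymbol D (canonForm 0)) :
    IsCanonicalConnection su11.exp leftAction 1 ⊥ ⊤ D where
  invariant A := by
    rw [leftAction_eq_boostAction]
    exact h.invariant_boostAction _
  at_base := by
    intro X _ Y _ V _ hXY
    rw [Submodule.mem_bot, sub_eq_zero] at hXY
    subst hXY
    obtain ⟨x, rfl⟩ := pauliL_bijective.2 X
    obtain ⟨y, rfl⟩ := pauliL_bijective.2 Y
    apply (frameCoord 1).injective
    rw [map_neg, frameCoord_generatedField_leftAction, generatedField_leftAction,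
      generatedField_leftAction, h.generatedField_at_base, pauliL_lie, orbitCoord_left,
      orbitCoord_left, pauliEquiv_symm_pauliL, pauliEquiv_symm_pauliL, pauliEquiv_symm_pauliL]
    ext a
    fin_cases a <;> simp [pauliBracket_apply, canonForm_apply] <;> ring

/-- The identification of `su(1,1)` with `T_o`. -/
def su11TopEquiv : (⊤ : Submodule ℝ su11) ≃ₗ[ℝ] TangentSpace 𝓘(ℝ, ℂ × ℝ) (1 : SU11) :=
  Submodule.topEquiv.trans (pauliEquiv.symm.trans (frameCoord 1).symm)

theorem frameCoord_su11TopEquiv (X : (⊤ : Submodule ℝ su11)) :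
    frameCoord 1 (su11TopEquiv X) = pauliEquiv.symm X :=
  (frameCoord 1).apply_symm_apply _

theorem su11TopEquiv_symm_apply (w : TangentSpace 𝓘(ℝ, ℂ × ℝ) (1 : SU11)) :
    (su11TopEquiv.symm w : su11) = pauliL (frameCoord 1 w) := rfl

/-- At t = μ the canonical connection is flat and S_x y = ½[x,y], so S_x y - S_y x is the whole
bracket and both 𝔥 and the holonomy vanish. -/
theorem isDecompositionOfStructure_leftAction {mu : ℝ} (hmu : mu ≠ 0) {D : SU11.Connection}
    (h : HasSymbol (canonicalConnection D (sMu (-mu) mu mu mu)) (canonForm 0)) :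
    IsDecompositionOfStructure su11.exp leftAction 1 ⊥ ⊤ D (sMu (-mu) mu mu mu) := by
  rw [IsDecompositionOfStructure, h.holonomyAlgebra_eq_bot]
  have hb : ∀ U : (⊥ : Submodule ℝ su11), (U : su11) = 0 := fun U => (Submodule.mem_bot ℝ).1 U.2
  let ρ : (⊥ : Submodule ℝ su11) ≃ₗ[ℝ]
      (⊥ : LieSubalgebra ℝ (Module.End ℝ (TangentSpace 𝓘(ℝ, ℂ × ℝ) (1 : SU11)))) :=
    { (0 : (⊥ : Submodule ℝ su11) →ₗ[ℝ]
        (⊥ : LieSubalgebra ℝ (Module.End ℝ (TangentSpace 𝓘(ℝ, ℂ × ℝ) (1 : SU11))))) with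
      invFun := 0
      left_inv := fun U => Subsingleton.elim _ _
      right_inv := fun A => Subtype.ext ((LieSubalgebra.mem_bot _).1 A.2).symm }
  have hρ : ∀ U, (ρ U : Module.End ℝ (TangentSpace 𝓘(ℝ, ℂ × ℝ) (1 : SU11))) = 0 := fun _ => rfl
  refine ⟨ρ, su11TopEquiv, ?_, ?_, ?_, ?_⟩
  · intro X
    apply (frameCoord 1).injective
    rw [frameCoord_su11TopEquiv, frameCoord_generatedField_leftAction]
  · intro U V
    rw [hb U, zero_lie, hb]
  · intro U X
    rw [hb U, zero_lie, hρ, LinearMap.zero_apply, map_zero]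
    rfl
  · rintro ⟨X, hX⟩ ⟨Y, hY⟩
    obtain ⟨x, rfl⟩ := pauliL_bijective.2 X
    obtain ⟨y, rfl⟩ := pauliL_bijective.2 Y
    refine ⟨0, ?_, ?_⟩
    · rw [h.isCurvatureOperator_iff, mul_zero, neg_zero, zero_smul, hρ]
    · rw [su11TopEquiv_symm_apply, map_sub (frameCoord 1), frameCoord_sMu hmu, frameCoord_sMu hmu,
        frameCoord_su11TopEquiv, frameCoord_su11TopEquiv, pauliEquiv_symm_pauliL,
        pauliEquiv_symm_pauliL, pauliL_lie, hb, sub_zero, div_self hmu]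
      refine congrArg pauliL ?_
      ext a
      fin_cases a <;> simp [pauliBracket_apply, structForm_apply] <;> ring

end

theorem mainTheorem11 (lam mu nu t : ℝ) (hmu : 0 < mu) (hlam : -lam = mu) (hnu : mu = nu) :
    IsPseudoRiemannianMetric (kkMetric lam mu nu) ∧
    HasLorentzianSignature (kkMetric lam mu nu) ∧
    (∀ Z u v w, kkMetric lam mu nu Z (sMu lam mu nu t Z u v) w = sMuLow mu t Z u v w) ∧
    (∃ D : CovariantDerivative 𝓘(ℝ, ℂ × ℝ) (ℂ × ℝ)
        (TangentSpace 𝓘(ℝ, ℂ × ℝ) : SU11 → Type _), IsLeviCivita (kkMetric lam mu nu) D) ∧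
    ∀ D : CovariantDerivative 𝓘(ℝ, ℂ × ℝ) (ℂ × ℝ)
        (TangentSpace 𝓘(ℝ, ℂ × ℝ) : SU11 → Type _), IsLeviCivita (kkMetric lam mu nu) D →
      IsParaSasakian (-1 / Real.sqrt mu) (kkMetric lam mu nu) D (phiOne lam mu nu)
        (unitFrame lam mu nu 1) (unitCoframe lam mu nu 1) ∧
      IsHomogeneousAlmostParacontact (kkMetric lam mu nu) D (sMu lam mu nu t) (phiOne lam mu nu)
        (unitFrame lam mu nu 1) (unitCoframe lam mu nu 1) ∧
      (t ≠ mu →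
        IsTransitiveEffectiveAction (𝓘(ℝ, ℂ × ℝ).prod 𝓘(ℝ, ℝ)) 𝓘(ℝ, ℂ × ℝ) boostAction ∧
        IsIsometricAction boostAction (kkMetric lam mu nu) ∧
        PreservesParacontact boostAction (phiOne lam mu nu)
          (unitFrame lam mu nu 1) (unitCoframe lam mu nu 1) ∧
        IsReductiveDecomposition prodExp boostAction 1 hSub (mSub mu t) ∧
        IsCanonicalConnection prodExp boostAction 1 hSub (mSub mu t)
          (canonicalConnection D (sMu lam mu nu t)) ∧
        IsDecompositionOfStructure prodExp boostAction 1 hSub (mSub mu t) D (sMu lam mu nu t)) ∧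
      (t = mu →
        IsTransitiveEffectiveAction 𝓘(ℝ, ℂ × ℝ) 𝓘(ℝ, ℂ × ℝ) leftAction ∧
        IsIsometricAction leftAction (kkMetric lam mu nu) ∧
        PreservesParacontact leftAction (phiOne lam mu nu)
          (unitFrame lam mu nu 1) (unitCoframe lam mu nu 1) ∧
        IsReductiveDecomposition su11.exp leftAction 1 ⊥ ⊤ ∧
        IsCanonicalConnection su11.exp leftAction 1 ⊥ ⊤
          (canonicalConnection D (sMu lam mu nu t)) ∧
        IsDecompositionOfStructure su11.exp leftAction 1 ⊥ ⊤ D (sMu lam mu nu t)) := by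
  obtain rfl : lam = -mu := by linarith
  subst hnu
  have h0 := hmu.ne'
  refine ⟨isPseudoRiemannianMetric_kkMetric h0, hasLorentzianSignature_kkMetric hmu,
    kkMetric_sMu h0 t, ⟨_, isLeviCivita_symbolConnection mu⟩, fun D hD => ?_⟩
  have hs := hD.hasSymbol_canonicalConnection h0 t
  refine ⟨hD.isParaSasakian hmu, hD.isHomogeneousAlmostParacontact hmu t, fun ht => ?_,
    fun ht => ?_⟩
  · exact ⟨isTransitiveEffectiveAction_boostAction, isIsometricAction_boostAction mu,
      preservesParacontact_boostAction hmu, isReductiveDecomposition_boostAction h0 t,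
      isCanonicalConnection_boostAction h0 hs, isDecompositionOfStructure_boostAction h0 ht hs⟩
  · subst ht
    -- At t = μ the coefficient 1 - t/μ is zero: left-invariant fields are parallel for ∇ - S.
    rw [div_self h0, sub_self] at hs
    exact ⟨isTransitiveEffectiveAction_leftAction, isIsometricAction_leftAction t,
      preservesParacontact_leftAction hmu, isReductiveDecomposition_leftAction,
      isCanonicalConnection_leftAction hs, isDecompositionOfStructure_leftAction h0 hs⟩
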